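/- **Setting.** Let $d\ge 1$ and let $\Omega\subseteq\mathbb{R}^d$ be a bounded simplicial Lipschitz domain (open and connected) whose boundary is split into pairwise disjoint, relatively open parts $\Gamma_I\neq\emptyset$, $\Gamma_D$, $\Gamma_N$ with $\partial\Omega=\overline{\Gamma}_I\cup\overline{\Gamma}_D\cup\overline{\Gamma}_N$. Let $\mathcal{T}_h$ be a conforming triangulation of $\Omega$ into closed $d$-simplices, let $\mathcal{S}_h^i$ be its interior sides (shared by two elements), and let $\mathcal{S}_h^{\mathrm X}$, $\mathrm X\in\{I,D,N\}$, be its boundary sides with relative interior contained in $\Gamma_{\mathrm X}$; every boundary side is assumed to lie in one of $\mathcal{S}_h^I,\mathcal{S}_h^D,\mathcal{S}_h^N$. Let $\mathcal{L}^k(\mathcal{T}_h)$ be the element-wise polynomials of degree $\le k$ and $\mathcal{L}^0(\mathcal{S}_h^{\mathrm X})$ the side-wise constants; let $\Pi_h$ and $\pi_h$ be the element-wise and side-wise mean values, $\nabla_h$ the element-wise gradient, $n_T$ the outward unit normal of $T$, and $n$ that of $\Omega$. For $\omega=\Omega$ or $\omega=\Gamma_{\mathrm X}$, $(\cdot,\cdot)_\omega$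 is the $L^2(\omega)$ inner product, $\|\cdot\|_\omega$ its norm, and $\|\cdot\|_{p,\omega}$ the $L^p(\omega)$ norm. Let $$\mathcal{S}^{1,cr}(\mathcal{T}_h)=\{v_h\in\mathcal{L}^1(\mathcal{T}_h)\mid \textstyle\int_S (v_h|_{T_+}-v_h|_{T_-})\,\mathrm ds=0 \text{ for all } S=T_+\cap T_-\in\mathcal{S}_h^i\},$$ $$\mathcal{R}T^0(\mathcal{T}_h)=\{y_h\in(\mathcal{L}^1(\mathcal{T}_h))^d\mid y_h|_T\cdot n_T \text{ is constant on each side of each } T\in\mathcal{T}_h,\ y_h|_{T_+}\!\cdot n_{T_+}+y_h|_{T_-}\!\cdot n_{T_-}=0 \text{ on each } S=T_+\cap T_-\in\mathcal{S}_h^i\}.$$ Let $m>0$, $f_h\in\mathcal{L}^0(\mathcal{T}_h)$, $g_h\in\mathcal{L}^0(\mathcal{S}_h^N)$, $u_D^h\in\mathcal{L}^0(\mathcal{S}_h^D)$. For $v_h\in\mathcal{S}^{1,cr}(\mathcal{T}_h)$ let $$I_h^{cr}(v_h)=\tfrac12\|\nabla_hv_h\|_\Omega^2+\tfrac1{2m}\|\pi_hv_h\|_{1,\Gamma_I}^2-(f_h,\Pi_hv_h)_\Omega-(g_h,\pi_hv_h)_{\Gamma_N}$$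 if $\pi_hv_h=u_D^h$ on $\Gamma_D$, and $I_h^{cr}(v_h)=+\infty$ otherwise. For $y_h\in\mathcal{R}T^0(\mathcal{T}_h)$ let $$D_h^{rt}(y_h)=-\tfrac12\|\Pi_hy_h\|_\Omega^2-\tfrac m2\|y_h\cdot n\|_{\infty,\Gamma_I}^2+(y_h\cdot n,u_D^h)_{\Gamma_D}$$ if $\operatorname{div}y_h=-f_h$ in $\Omega$ and $y_h\cdot n=g_h$ on $\Gamma_N$, and $D_h^{rt}(y_h)=-\infty$ otherwise. A discrete primal solution is a minimizer of $I_h^{cr}$ over $\mathcal{S}^{1,cr}(\mathcal{T}_h)$. Finally, for $\overline y_h\in(\mathcal{L}^0(\mathcal{T}_h))^d$ and $v_h\in\mathcal{S}^{1,cr}(\mathcal{T}_h)$ let $G_h(\overline y_h)=\tfrac12\|\overline y_h\|_\Omega^2$ and let $F_h(v_h)$ be $-(f_h,\Pi_hv_h)_\Omega-(g_h,\pi_hv_h)_{\Gamma_N}+\tfrac1{2m}\|\pi_hv_h\|_{1,\Gamma_I}^2$ if $\pi_hv_h=u_D^h$ on $\Gamma_D$, and $+\infty$ otherwise. **Theorem.**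 (i) $I_h^{cr}(v_h)=G_h(\nabla_hv_h)+F_h(v_h)$ for all $v_h\in\mathcal{S}^{1,cr}(\mathcal{T}_h)$, and the Fenchel dual problem to the minimization of $I_h^{cr}$, i.e. the maximization over $(\mathcal{L}^0(\mathcal{T}_h))^d$ of $D_h^0(\overline y_h)=-G_h^*(\overline y_h)-F_h^*(-\nabla_h^*\overline y_h)$ (conjugates, $(\mathcal{L}^0(\mathcal{T}_h))^d$ being identified with its dual by $(\cdot,\cdot)_\Omega$), is given by the maximization of $D_h^{rt}$ over $\mathcal{R}T^0(\mathcal{T}_h)$: for every $\overline y_h\in(\mathcal{L}^0(\mathcal{T}_h))^d$, $$D_h^0(\overline y_h)=\sup\{D_h^{rt}(y_h)\mid y_h\in\mathcal{R}T^0(\mathcal{T}_h),\ \Pi_hy_h=\overline y_h\}$$ (with $\sup\emptyset=-\infty$), and $D_h^0(\Pi_hy_h)=D_h^{rt}(y_h)$ for every $y_h\in\mathcal{R}T^0(\mathcal{T}_h)$ with $\operatorname{div}y_h=-f_h$. (ii) A discrete primal solution exists. There is a unique maximizer $z_h^{rt}$ of $D_h^{rt}$ over $\mathcal{R}T^0(\mathcal{T}_h)$,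 and it satisfies $\operatorname{div}z_h^{rt}=-f_h$ in $\Omega$ and $z_h^{rt}\cdot n=g_h$ on $\Gamma_N$. For every discrete primal solution $u_h^{cr}$, there holds $I_h^{cr}(u_h^{cr})=D_h^{rt}(z_h^{rt})$. (iii) For every discrete primal solution $u_h^{cr}$, there hold $$\Pi_hz_h^{rt}=\nabla_hu_h^{cr}\ \text{ in }\Omega,\qquad -(z_h^{rt}\cdot n,\pi_hu_h^{cr})_{\Gamma_I}=\tfrac m2\|z_h^{rt}\cdot n\|_{\infty,\Gamma_I}^2+\tfrac1{2m}\|\pi_hu_h^{cr}\|_{1,\Gamma_I}^2.$$ -/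

import Mathlib

open MeasureTheory
open scoped InnerProductSpace

noncomputable section

/-- The Euclidean space `ℝᵈ`. -/
abbrev Euc (d : ℕ) : Type := EuclideanSpace ℝ (Fin d)

/-- The simplex with the given vertices, as a closed set. -/
abbrev hull {d : ℕ} (s : Finset (Euc d)) : Set (Euc d) := convexHull ℝ (s : Set (Euc d))

/-- The `(d-1)`-dimensional surface measure on `ℝᵈ` (normalised Hausdorff measure). -/
abbrev surf (d : ℕ) : Measure (Euc d) := Measure.euclideanHausdorffMeasure (d - 1)

/-- A conforming (face-to-face) simplicial mesh in `ℝᵈ`: a finite geometric simplicial complex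
every face of which is a face of a `d`-dimensional simplex of the complex. -/
structure Mesh (d : ℕ) extends Geometry.SimplicialComplex ℝ (Euc d) where
  finite_faces : faces.Finite
  pure : ∀ s ∈ faces, ∃ t ∈ faces, s ⊆ t ∧ t.card = d + 1

/-- The outward unit normal of the `d`-simplex `T` on its side `S`. -/
def IsOutwardUnitNormal {d : ℕ} (T S : Finset (Euc d)) (n : Euc d) : Prop :=
  ‖n‖ = 1 ∧ (∀ p ∈ S, ∀ q ∈ S, ⟪n, p - q⟫_ℝ = 0) ∧
    ∀ p ∈ T, p ∉ S → ∀ q ∈ S, ⟪n, p - q⟫_ℝ < 0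

/-- `n_T` on the side `S` of `T`, i.e. the (only) vector with `IsOutwardUnitNormal T S n`. -/
def outwardNormal {d : ℕ} (T S : Finset (Euc d)) : Euc d :=
  Classical.epsilon (IsOutwardUnitNormal T S)

/-- The (constant) gradient of an affine function. -/
def affGrad {d : ℕ} (v : Euc d →ᵃ[ℝ] ℝ) : Euc d :=
  (InnerProductSpace.toDual ℝ (Euc d)).symm (LinearMap.toContinuousLinearMap v.linear)

/-- The (constant) divergence of an affine vector field: the trace of its Jacobian. -/
def affDiv {d : ℕ} (y : Euc d →ᵃ[ℝ] Euc d) : ℝ :=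
  LinearMap.trace ℝ (Euc d) y.linear

/-- The indicator functional in the sense of convex analysis: `0` if `p` holds, `+∞` else. -/
def indic (p : Prop) : EReal :=
  open Classical in if p then 0 else ⊤

/-- The Fenchel conjugate of `F : V → ℝ ∪ {+∞}`. -/
def fenchelConj {V : Type*} [AddCommGroup V] [Module ℝ V] (F : V → EReal)
    (φ : Module.Dual ℝ V) : EReal :=
  ⨆ v : V, ((φ v : ℝ) : EReal) - F v

/-- The objective of the Fenchel dual problem to the minimization of `v ↦ G (Λ v) + F v`, namely
`p ↦ - G* p - F* (- Λ* p)`. -/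
def fenchelDual {V Y : Type*} [AddCommGroup V] [Module ℝ V] [AddCommGroup Y] [Module ℝ Y]
    (F : V → EReal) (G : Y → EReal) (L : V →ₗ[ℝ] Y) (p : Module.Dual ℝ Y) : EReal :=
  - fenchelConj G p - fenchelConj F (-(L.dualMap p))

theorem surf_hull_lt_top {d : ℕ} {S : Finset (Euc d)} (hS : AffineIndependent ℝ ((↑) : S → Euc d))
    (hne : S.Nonempty) (hcard : S.card = d) : surf d (hull S) < ⊤ := by
  set A : AffineSubspace ℝ (Euc d) := affineSpan ℝ (S : Set (Euc d)) with hA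
  obtain ⟨p, hp⟩ := hne
  have hpA : p ∈ A := subset_affineSpan ℝ _ hp
  have : Nonempty A := ⟨⟨p, hpA⟩⟩
  have hfr : Module.finrank ℝ A.direction = d - 1 := by
    rw [hA, direction_affineSpan]
    have h := hS.finrank_vectorSpan (n := d - 1) (by
      have : 0 < S.card := Finset.card_pos.mpr ⟨p, hp⟩
      simp only [Fintype.card_coe]; omega)
    rwa [Subtype.range_coe_subtype, Finset.setOfPred_mem] at h
  have hsub : hull S ⊆ (A : Set (Euc d)) := convexHull_subset_affineSpan _
  have himg : hull S = Subtype.val '' ((↑) ⁻¹' hull S : Set A) := by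
    ext x
    exact ⟨fun hx => ⟨⟨x, hsub hx⟩, hx, rfl⟩, fun ⟨a, ha, hax⟩ => hax ▸ ha⟩
  have hcpt : IsCompact (hull S) := S.finite_toSet.isCompact_convexHull (𝕜 := ℝ)
  have hclosed : IsClosed (A : Set (Euc d)) := A.closed_of_finiteDimensional
  have hK : IsCompact ((↑) ⁻¹' hull S : Set A) :=
    hclosed.isClosedEmbedding_subtypeVal.isCompact_preimage hcpt
  rw [himg, AffineSubspace.euclideanHausdorffMeasure_coe_image, ← hfr,
    EuclideanGeometry.euclideanHausdorffMeasure_eq (⟨p, hpA⟩ : A)]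
  rw [Measure.map_apply (IsometryEquiv.vaddConst _).continuous.measurable hK.measurableSet]
  exact ((IsometryEquiv.vaddConst (⟨p, hpA⟩ : A)).toHomeomorph.isCompact_preimage.mpr
    hK).measure_lt_top

namespace Mesh

variable {d : ℕ} (K : Mesh d)

/-- The elements `T ∈ 𝒯_h`. -/
abbrev Elem : Type := {T : Finset (Euc d) // T ∈ K.faces ∧ T.card = d + 1}

/-- The sides `S ∈ 𝒮_h`. -/
abbrev Side : Type := {S : Finset (Euc d) // S ∈ K.faces ∧ S.card = d}

instance : Finite K.Elem := (K.finite_faces.subset (fun _ h => h.1)).to_subtype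

instance : Finite K.Side := (K.finite_faces.subset (fun _ h => h.1)).to_subtype

instance : Fintype K.Elem := Fintype.ofFinite _

/-- An element having `S` as a side (for a boundary side, the only one). -/
def elemOf (S : K.Side) : K.Elem :=
  ⟨(K.pure S.1 S.2.1).choose, (K.pure S.1 S.2.1).choose_spec.1,
    (K.pure S.1 S.2.1).choose_spec.2.2⟩

/-- The boundary sides that belong to the boundary part `Γ ⊆ ∂Ω`: those contained in `∂Ω` whose
relative interior is contained in `Γ`. -/
abbrev BdrySide (Ω Γ : Set (Euc d)) : Type :=
  {S : K.Side // hull S.1 ⊆ frontier Ω ∧ intrinsicInterior ℝ (hull S.1) ⊆ Γ}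

instance (Ω Γ : Set (Euc d)) : Fintype (K.BdrySide Ω Γ) := Fintype.ofFinite _

/-- `K` triangulates `Ω`. -/
def Triangulates (Ω : Set (Euc d)) : Prop := K.space = closure Ω

/-! Element-wise affine functions, i.e. `ℒ¹(𝒯_h)`, are families of affine functions indexed by the
elements (the member at `T` being the restriction to `T`); element-wise constant functions, i.e.
`ℒ⁰(𝒯_h)`, are families of constants. Side-wise constant functions are families of constants
indexed by sides. -/

/-- The inner product `(v, w)_Ω` of element-wise constant functions or vector fields. -/
def innerΩ {F : Type*} [NormedAddCommGroup F] [InnerProductSpace ℝ F] (v w : K.Elem → F) : ℝ :=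
  ∑ T : K.Elem, ∫ _x in hull T.1, ⟪v T, w T⟫_ℝ

/-- The squared norm `‖v‖_Ω²` of an element-wise constant function or vector field. -/
def normSqΩ {F : Type*} [NormedAddCommGroup F] [InnerProductSpace ℝ F] (v : K.Elem → F) : ℝ :=
  ∑ T : K.Elem, ∫ _x in hull T.1, ‖v T‖ ^ 2

/-- The inner product `(a, b)_Γ` of side-wise constant functions on `Γ`. -/
def innerΓ {Ω Γ : Set (Euc d)} (a b : K.BdrySide Ω Γ → ℝ) : ℝ :=
  ∑ S : K.BdrySide Ω Γ, ∫ _x in hull S.1.1, a S * b S ∂(surf d)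

/-- The norm `‖a‖_{1,Γ}` of a side-wise constant function on `Γ`. -/
def normOneΓ {Ω Γ : Set (Euc d)} (a : K.BdrySide Ω Γ → ℝ) : ℝ :=
  ∑ S : K.BdrySide Ω Γ, ∫ _x in hull S.1.1, |a S| ∂(surf d)

/-- The norm `‖a‖_{∞,Γ}` of a side-wise constant function on `Γ`. -/
def normInfΓ {Ω Γ : Set (Euc d)} (a : K.BdrySide Ω Γ → ℝ) : ℝ :=
  ⨆ S : K.BdrySide Ω Γ, |a S|

theorem integrableOn_side (S : K.Side) {F : Type*} [NormedAddCommGroup F] {φ : Euc d → F}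
    (hφ : Continuous φ) : Integrable φ ((surf d).restrict (hull S.1)) := by
  have hcpt : IsCompact (hull S.1) := S.1.finite_toSet.isCompact_convexHull (𝕜 := ℝ)
  have hlt := surf_hull_lt_top (K.indep S.2.1) (K.toSimplicialComplex.nonempty_of_mem_faces S.2.1)
    S.2.2
  have : IsFiniteMeasure ((surf d).restrict (hull S.1)) :=
    ⟨by simpa using hlt⟩
  obtain ⟨C, hC⟩ := hcpt.exists_bound_of_continuousOn hφ.continuousOn
  refine Integrable.of_bound hφ.aestronglyMeasurable C ?_
  exact (ae_restrict_iff' hcpt.measurableSet).mpr (Filter.Eventually.of_forall hC)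

/-- The Crouzeix–Raviart space: element-wise affine functions all of whose jumps across interior
sides (sides shared by two elements) have mean value zero. -/
def CR : Submodule ℝ (K.Elem → (Euc d →ᵃ[ℝ] ℝ)) where
  carrier := {v | ∀ (S : K.Side) (T T' : K.Elem), S.1 ⊆ T.1 → S.1 ⊆ T'.1 → T ≠ T' →
    ⨍ x in hull S.1, (v T x - v T' x) ∂(surf d) = 0}
  zero_mem' := by
    intro S T T' _ _ _
    simp [average]
  add_mem' := by
    intro v w hv hw S T T' h h' hne
    have e1 := hv S T T' h h' hne
    have e2 := hw S T T' h h' hne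
    rw [setAverage_eq] at e1 e2 ⊢
    have key : ∀ u : K.Elem → (Euc d →ᵃ[ℝ] ℝ),
        Integrable (fun x => u T x - u T' x) ((surf d).restrict (hull S.1)) := fun u =>
      K.integrableOn_side S ((u T).continuous_of_finiteDimensional.sub
        (u T').continuous_of_finiteDimensional)
    have : (fun x => (v + w) T x - (v + w) T' x)
        = fun x => (v T x - v T' x) + (w T x - w T' x) := by
      funext x; simp; ring
    rw [this, integral_add (key v) (key w), smul_add, e1, e2, add_zero]
  smul_mem' := by
    intro c v hv S T T' h h' hne
    have e1 := hv S T T' h h' hne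
    rw [setAverage_eq] at e1 ⊢
    have : (fun x => (c • v) T x - (c • v) T' x) = fun x => c * (v T x - v T' x) := by
      funext x; simp; ring
    rw [this, integral_const_mul, smul_eq_mul, mul_left_comm, ← smul_eq_mul (a := ((surf d).real _)⁻¹),
      e1, mul_zero]

/-- The lowest order Raviart–Thomas space: element-wise affine vector fields whose normal component
is constant on each side of each element and does not jump across interior sides. -/
def RT : Submodule ℝ (K.Elem → (Euc d →ᵃ[ℝ] Euc d)) where
  carrier := {y |
    (∀ (T : K.Elem) (S : K.Side), S.1 ⊆ T.1 → ∃ c : ℝ, ∀ x ∈ hull S.1,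
      ⟪y T x, outwardNormal T.1 S.1⟫_ℝ = c) ∧
    ∀ (S : K.Side) (T T' : K.Elem), S.1 ⊆ T.1 → S.1 ⊆ T'.1 → T ≠ T' → ∀ x ∈ hull S.1,
      ⟪y T x, outwardNormal T.1 S.1⟫_ℝ + ⟪y T' x, outwardNormal T'.1 S.1⟫_ℝ = 0}
  zero_mem' := ⟨fun T S _ => ⟨0, by simp⟩, by simp⟩
  add_mem' := by
    rintro y w ⟨hy, hy'⟩ ⟨hw, hw'⟩
    refine ⟨fun T S h => ?_, fun S T T' h h' hne x hx => ?_⟩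
    · obtain ⟨a, ha⟩ := hy T S h
      obtain ⟨b, hb⟩ := hw T S h
      exact ⟨a + b, fun x hx => by simp [inner_add_left, ha x hx, hb x hx]⟩
    · have e1 := hy' S T T' h h' hne x hx
      have e2 := hw' S T T' h h' hne x hx
      simp only [Pi.add_apply, AffineMap.coe_add, inner_add_left]
      linarith
  smul_mem' := by
    rintro c y ⟨hy, hy'⟩
    refine ⟨fun T S h => ?_, fun S T T' h h' hne x hx => ?_⟩
    · obtain ⟨a, ha⟩ := hy T S h
      exact ⟨c * a, fun x hx => by simp [inner_smul_left, ha x hx]⟩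
    · have e1 := hy' S T T' h h' hne x hx
      simp only [Pi.smul_apply, AffineMap.coe_smul, real_inner_smul_left]
      rw [← mul_add, e1, mul_zero]

/-- The `L²`-projection `Π_h` of an element-wise affine function or vector field onto element-wise
constants. -/
def proj {F : Type*} [NormedAddCommGroup F] [NormedSpace ℝ F] (v : K.Elem → (Euc d →ᵃ[ℝ] F)) :
    K.Elem → F :=
  fun T => ⨍ x in hull T.1, v T x

/-- The element-wise gradient `∇_h` on the Crouzeix–Raviart space. -/
def gradh : K.CR →ₗ[ℝ] (K.Elem → Euc d) where
  toFun v := fun T => affGrad (v.1 T)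
  map_add' v w := by
    funext T
    simp [affGrad]
  map_smul' c v := by
    funext T
    simp [affGrad]

/-- The element-wise divergence, `ℛT⁰(𝒯_h) → ℒ⁰(𝒯_h)`. -/
def divh (y : K.RT) : K.Elem → ℝ := fun T => affDiv (y.1 T)

/-- `π_h v` on the sides in `Γ ⊆ ∂Ω`: the side-wise mean values of `v`. -/
def sideMean {Ω Γ : Set (Euc d)} (v : K.CR) : K.BdrySide Ω Γ → ℝ :=
  fun S => ⨍ x in hull S.1.1, v.1 (K.elemOf S.1) x ∂(surf d)

/-- `y · n` on the sides in `Γ ⊆ ∂Ω`, a side-wise constant function, written as the mean value of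
`y · n` on each side. -/
def normalTrace {Ω Γ : Set (Euc d)} (y : K.RT) : K.BdrySide Ω Γ → ℝ :=
  fun S => ⨍ x in hull S.1.1,
    ⟪y.1 (K.elemOf S.1) x, outwardNormal (K.elemOf S.1).1 S.1.1⟫_ℝ ∂(surf d)

/-- The element `w ↦ (y, w)_Ω` of the dual space of `(ℒ⁰(𝒯_h))ᵈ`. -/
def toDualΩ (y : K.Elem → Euc d) : Module.Dual ℝ (K.Elem → Euc d) where
  toFun w := K.innerΩ y w
  map_add' v w := by
    simp [innerΩ, inner_add_right, mul_add, Finset.sum_add_distrib]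
  map_smul' c v := by
    simp [innerΩ, inner_smul_right, Finset.mul_sum, mul_left_comm]

section Functionals

variable {Ω : Set (Euc d)} (ΓI : Set (Euc d)) {ΓD ΓN : Set (Euc d)} (m : ℝ) (f : K.Elem → ℝ)
  (g : K.BdrySide Ω ΓN → ℝ) (uD : K.BdrySide Ω ΓD → ℝ)

/-- The discrete primal energy functional `I_h^cr`. -/
def primal (v : K.CR) : EReal :=
  ((1 / 2 * K.normSqΩ (K.gradh v)
      + 1 / (2 * m) * K.normOneΓ (K.sideMean v : K.BdrySide Ω ΓI → ℝ) ^ 2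
      - K.innerΩ f (K.proj v.1) - K.innerΓ g (K.sideMean v) : ℝ) : EReal)
    + indic (K.sideMean v = uD)

/-- The discrete dual energy functional `D_h^rt`. -/
def dual (y : K.RT) : EReal :=
  ((- (1 / 2) * K.normSqΩ (K.proj y.1)
      - m / 2 * K.normInfΓ (K.normalTrace y : K.BdrySide Ω ΓI → ℝ) ^ 2
      + K.innerΓ (K.normalTrace y) uD : ℝ) : EReal)
    - indic (K.divh y = -f) - indic (K.normalTrace y = g)

/-- `G_h = ½ ‖·‖_Ω²` on element-wise constant vector fields. -/
def Gh (y : K.Elem → Euc d) : EReal := ((1 / 2 * K.normSqΩ y : ℝ) : EReal)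

/-- `F_h`, the part of the discrete primal energy functional that does not involve the gradient. -/
def Fh (v : K.CR) : EReal :=
  ((- K.innerΩ f (K.proj v.1) - K.innerΓ g (K.sideMean v)
      + 1 / (2 * m) * K.normOneΓ (K.sideMean v : K.BdrySide Ω ΓI → ℝ) ^ 2 : ℝ) : EReal)
    + indic (K.sideMean v = uD)

/-- The Fenchel dual functional `D_h⁰` of `v ↦ G_h (∇_h v) + F_h v`, the dual space of
`(ℒ⁰(𝒯_h))ᵈ` being represented by `(·, ·)_Ω`. -/
def fenchelDualh (y : K.Elem → Euc d) : EReal :=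
  fenchelDual (K.Fh ΓI m f g uD) K.Gh K.gradh (K.toDualΩ y)

end Functionals

end Mesh

/-- `∂Ω` is split into the relatively open, pairwise disjoint parts `ΓI`, `ΓD`, `ΓN`. -/
structure IsBoundarySplit {d : ℕ} (Ω ΓI ΓD ΓN : Set (Euc d)) : Prop where
  openI : ∃ U, IsOpen U ∧ ΓI = U ∩ frontier Ω
  openD : ∃ U, IsOpen U ∧ ΓD = U ∩ frontier Ω
  openN : ∃ U, IsOpen U ∧ ΓN = U ∩ frontier Ω
  disjID : Disjoint ΓI ΓD
  disjIN : Disjoint ΓI ΓN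
  disjDN : Disjoint ΓD ΓN
  cover : frontier Ω = closure ΓI ∪ closure ΓD ∪ closure ΓN

/-- Every boundary side belongs to one of the three boundary parts. -/
def Mesh.Resolves {d : ℕ} (K : Mesh d) (Ω ΓI ΓD ΓN : Set (Euc d)) : Prop :=
  ∀ S : K.Side, hull S.1 ⊆ frontier Ω →
    intrinsicInterior ℝ (hull S.1) ⊆ ΓI ∨ intrinsicInterior ℝ (hull S.1) ⊆ ΓD ∨
      intrinsicInterior ℝ (hull S.1) ⊆ ΓN

end

/-! ### Mean values of affine functions over simplices -/

section Means

/-! Everything rests on the discrete integration by parts formula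
(`IsAdmissible.integration_by_parts`): in the sum of `(∇_h v, Π_h y)` and `(div y, Π_h v)` the
contributions of interior sides cancel, since normal components of `y` are constant on sides and do
not jump while `v` has continuous side means. Only pairings of `y · n` with `π_h v` on `∂Ω` survive.

For an admissible pair this turns the duality gap into `½ ‖∇_h v - Π_h y‖²` plus the defect `(y · n,
π_h v) + m/2 ‖y · n‖_∞² + 1/(2m) ‖π_h v‖_1²` on `Γ_I` (`IsAdmissible.primalReal_sub_dualReal`). The
defect is nonnegative by Hölder and Young (`neg_innerΓ_le`). Weak duality follows, and a vanishing
gap is equivalent to the two optimality relations.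

For strong duality, a primal minimizer `u` exists by coercivity: a function with zero gradient and
zero means on `Γ_I` vanishes, because elements are connected through sides and `Γ_I` contains a
side. The `L¹` term is not differentiable, so `u` satisfies only a variational inequality. Tested
with functions of zero boundary means, it says that `∇_h u` has weak divergence `-f`. Side means can
be prescribed freely, so testing one side at a time shows that the element-wise affine field with
mean `∇_h u` and divergence `-f` has no normal jumps (`exists_RT_of_forall`): it is a Raviart–Thomas
field `z`. Tests on `Γ_N` give `z · n = g`, and a test attaining equality in Young's inequality on
`Γ_I` closes the gap. Uniqueness holds because mean and divergence determine a Raviart–Thomas field.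

For the Fenchel dual, the same representation shows that `F_h*(-∇_h* p)` is `+∞` unless `p = Π_h y`
with `div y = -f` and `y · n = g`. Otherwise integration by parts leaves a supremum over boundary
means, which Young's inequality computes.

The topology of the mesh enters through three facts: an interior side has exactly two elements and a
boundary side exactly one; elements are connected through sides; and boundary sides cover `∂Ω`. -/

theorem affineMap_apply_eq_sum_coord {V F ι : Type*} [AddCommGroup V] [Module ℝ V]
    [AddCommGroup F] [Module ℝ F] [Fintype ι] (b : AffineBasis ι ℝ V) (φ : V →ᵃ[ℝ] F) (x : V) :
    φ x = ∑ i, b.coord i x • φ (b i) := by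
  conv_lhs => rw [← b.affineCombination_coord_eq_self x]
  rw [Finset.map_affineCombination _ _ _ (b.sum_coord_apply_eq_one x),
    Finset.affineCombination_eq_linear_combination _ _ _ (b.sum_coord_apply_eq_one x)]
  rfl

variable {V : Type*} [NormedAddCommGroup V] [InnerProductSpace ℝ V] [FiniteDimensional ℝ V]
  [MeasurableSpace V] [BorelSpace V] {ι : Type*}

/-- The affine map exchanging `b i` and `b j` and fixing the other vertices preserves the simplex
and swaps the two coordinates. Its linear part `L` is an involution, hence has determinant `±1`, so
volume is preserved. -/
theorem setIntegral_coord_eq (b : AffineBasis ι ℝ V) (i j : ι) :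
    ∫ x in convexHull ℝ (Set.range b), b.coord i x
      = ∫ x in convexHull ℝ (Set.range b), b.coord j x := by
  classical
  rcases eq_or_ne i j with rfl | hij
  · rfl
  set ℓ : V →ₗ[ℝ] ℝ := (b.coord i).linear - (b.coord j).linear with hℓ
  set L : V →ₗ[ℝ] V := LinearMap.id + ℓ.smulRight (b j - b i) with hL
  have hcoord : ∀ k (x w : V), b.coord k (x + w) = b.coord k x + (b.coord k).linear w := by
    intro k x w
    have := (b.coord k).map_vadd x w
    simp only [vadd_eq_add] at this
    rw [add_comm x w, this, add_comm]
  have hlin : ∀ k, (b.coord k).linear (b j - b i)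
      = (if k = j then 1 else 0) - (if k = i then 1 else 0) := by
    intro k
    have := (b.coord k).linearMap_vsub (b j) (b i)
    simp only [vsub_eq_sub] at this
    rw [this, b.coord_apply, b.coord_apply]
  have hℓb : ℓ (b j - b i) = -2 := by
    simp only [hℓ, LinearMap.sub_apply, hlin]
    simp [hij, hij.symm]; norm_num
  have hLL : L ∘ₗ L = LinearMap.id := by
    ext v
    simp only [hL, LinearMap.comp_apply, LinearMap.add_apply, LinearMap.id_apply,
      LinearMap.smulRight_apply, map_add, map_smul, hℓb]
    module
  have hdet : LinearMap.det L * LinearMap.det L = 1 := by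
    rw [← LinearMap.det_comp, hLL, LinearMap.det_id]
  have hdet0 : LinearMap.det L ≠ 0 := fun h => by simp [h] at hdet
  have habs : |(LinearMap.det L)⁻¹| = 1 := by
    rcases mul_self_eq_one_iff.mp hdet with h | h <;> simp [h]
  have hmpL : MeasurePreserving L (volume : Measure V) volume := by
    refine ⟨L.continuous_of_finiteDimensional.measurable, ?_⟩
    rw [Measure.map_linearMap_addHaar_eq_smul_addHaar _ hdet0, habs]; simp
  set c : V := (b.coord i 0 - b.coord j 0) • (b j - b i) with hc
  -- The translation `c` is chosen so that the map is `x + (λ_i x - λ_j x) (b j - b i)`, with `λ`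
  -- the barycentric coordinates.
  have hmp : MeasurePreserving (fun x => c + L x) (volume : Measure V) volume :=
    (measurePreserving_add_left volume c).comp hmpL
  have hA : ∀ x, c + L x = x + (b.coord i x - b.coord j x) • (b j - b i) := by
    intro x
    have h1 := hcoord i 0 x
    have h2 := hcoord j 0 x
    rw [zero_add] at h1 h2
    simp only [hL, hc, LinearMap.add_apply, LinearMap.id_apply, LinearMap.smulRight_apply, hℓ,
      LinearMap.sub_apply, h1, h2]
    module
  have hk : ∀ k x, b.coord k (c + L x) = b.coord (Equiv.swap i j k) x := by
    intro k x
    rw [hA, hcoord, map_smul, hlin, smul_eq_mul]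
    by_cases h1 : k = i
    · subst h1; simp [hij]
    · by_cases h2 : k = j
      · subst h2; simp [h1]
      · simp [h1, h2, Equiv.swap_apply_of_ne_of_ne h1 h2]
  have hemb : MeasurableEmbedding (fun x => c + L x) := by
    refine Measurable.measurableEmbedding hmp.measurable ?_
    intro x y hxy
    simp only [add_right_inj] at hxy
    have := congrArg L hxy
    rw [← LinearMap.comp_apply, ← LinearMap.comp_apply, hLL] at this
    exact this
  have hpre : (fun x => c + L x) ⁻¹' (convexHull ℝ (Set.range b)) = convexHull ℝ (Set.range b) := by
    ext x
    simp only [AffineBasis.convexHull_eq_nonneg_coord, Set.mem_preimage, Set.mem_ofPred_eq, hk]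
    exact ⟨fun h k => by simpa using h (Equiv.swap i j k), fun h k => h _⟩
  have := hmp.setIntegral_preimage_emb hemb (b.coord i) (convexHull ℝ (Set.range b))
  rw [hpre] at this
  rw [← this]
  simp [hk]

theorem volume_convexHull_affineBasis_pos (b : AffineBasis ι ℝ V) :
    0 < volume (convexHull ℝ (Set.range b)) :=
  (isOpen_interior.measure_pos _ (interior_convexHull_nonempty_iff_affineSpan_eq_top.mpr b.tot)).trans_le
    (measure_mono interior_subset)

/-- The mean value of an affine function over a full-dimensional simplex is the mean of its values
at the vertices. -/
theorem setAverage_affineMap_convexHull {F : Type*} [NormedAddCommGroup F] [NormedSpace ℝ F]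
    [CompleteSpace F] [Fintype ι] (b : AffineBasis ι ℝ V) (φ : V →ᵃ[ℝ] F) :
    ⨍ x in convexHull ℝ (Set.range b), φ x = (Fintype.card ι : ℝ)⁻¹ • ∑ i, φ (b i) := by
  classical
  set H := convexHull ℝ (Set.range b) with hH
  have hcpt : IsCompact H := (Set.finite_range b).isCompact_convexHull (𝕜 := ℝ)
  have hpos : 0 < volume.real H :=
    ENNReal.toReal_pos (volume_convexHull_affineBasis_pos b).ne' hcpt.measure_lt_top.ne
  have hint : ∀ i, IntegrableOn (b.coord i) H := fun i =>
    (b.coord i).continuous_of_finiteDimensional.continuousOn.integrableOn_compact hcpt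
  obtain ⟨i₀⟩ := b.nonempty
  have hcard : (Fintype.card ι : ℝ) ≠ 0 := by
    have : Nonempty ι := ⟨i₀⟩
    exact_mod_cast Fintype.card_ne_zero
  have hM : ∀ i, ∫ x in H, b.coord i x = volume.real H / Fintype.card ι := by
    intro i
    have h1 : ∑ j, ∫ x in H, b.coord j x = volume.real H := by
      rw [← integral_finsetSum _ (fun j _ => hint j)]
      simp [b.sum_coord_apply_eq_one]
    rw [Finset.sum_congr rfl (fun j _ => setIntegral_coord_eq b j i)] at h1
    rw [eq_div_iff hcard, ← h1]
    simp [hH, mul_comm]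
  rw [setAverage_eq]
  have : ∀ x, φ x = ∑ i, b.coord i x • φ (b i) := affineMap_apply_eq_sum_coord b φ
  rw [integral_congr_ae (Filter.Eventually.of_forall this),
    integral_finsetSum _ (fun i _ => (hint i).smul_const _)]
  simp_rw [integral_smul_const, hM]
  rw [← Finset.smul_sum, smul_smul]
  congr 1
  field_simp

/-- An affinely independent set of `k + 1` points, seen as an affine basis of the direction of its
span, together with the comparison of measures. -/
theorem exists_affineBasis_direction {d k : ℕ} {S : Finset (Euc d)}
    (hS : AffineIndependent ℝ ((↑) : S → Euc d)) (hcard : S.card = k + 1) :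
    ∃ (W : Submodule ℝ (Euc d)) (b : AffineBasis S ℝ W) (x₀ : Euc d),
      Module.finrank ℝ W = k ∧ ∀ i, (b i : Euc d) + x₀ = i := by
  obtain ⟨p, hp⟩ : S.Nonempty := Finset.card_pos.mp (by omega)
  set A : AffineSubspace ℝ (Euc d) := affineSpan ℝ (S : Set (Euc d)) with hA
  have hfr : Module.finrank ℝ A.direction = k := by
    rw [hA, direction_affineSpan]
    have h := hS.finrank_vectorSpan (n := k) (by simpa using hcard)
    rwa [Subtype.range_coe_subtype, Finset.setOfPred_mem] at h
  have hmem : ∀ i : S, (i : Euc d) - p ∈ A.direction := fun i =>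
    AffineSubspace.vsub_mem_direction (subset_affineSpan ℝ _ i.2) (subset_affineSpan ℝ _ hp)
  have hind : AffineIndependent ℝ (fun i : S => (⟨(i : Euc d) - p, hmem i⟩ : A.direction)) := by
    refine AffineIndependent.of_comp (A.direction.subtype.toAffineMap) ?_
    have : (A.direction.subtype.toAffineMap ∘ fun i : S => (⟨(i : Euc d) - p, hmem i⟩ : A.direction))
        = (AffineEquiv.vaddConst ℝ p).symm ∘ ((↑) : S → Euc d) := by
      ext i; simp
    rw [this, AffineEquiv.affineIndependent_iff]
    exact hS
  refine ⟨A.direction, ⟨_, hind, ?_⟩, p, hfr, fun i => sub_add_cancel _ _⟩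
  rw [hind.affineSpan_eq_top_iff_card_eq_finrank_add_one, hfr]
  simpa using hcard

theorem hull_eq_image {d : ℕ} {S : Finset (Euc d)} {W : Submodule ℝ (Euc d)}
    {b : S → W} {x₀ : Euc d} (hb : ∀ i, (b i : Euc d) + x₀ = i) :
    hull S = (fun w : W => (w : Euc d) + x₀) '' convexHull ℝ (Set.range b) := by
  have : (fun w : W => (w : Euc d) + x₀)
      = ((AffineEquiv.vaddConst ℝ x₀).toAffineMap.comp W.subtype.toAffineMap) := by
    ext; simp
  have hcomp : (((AffineEquiv.vaddConst ℝ x₀).toAffineMap.comp W.subtype.toAffineMap) : W → Euc d) ∘ b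
      = ((↑) : S → Euc d) := by
    funext i; rw [← this]; exact hb i
  rw [this, AffineMap.image_convexHull, ← Set.range_comp, hcomp]
  simp

/-- The map `w ↦ w + x₀` is an isometry, and on `W` the normalised Hausdorff measure of dimension
`finrank W` is Lebesgue measure. Statements about lower-dimensional simplices thus reduce to the
full-dimensional case. -/
theorem restrict_hull_eq_map {d k : ℕ} {S : Finset (Euc d)} {W : Submodule ℝ (Euc d)}
    {b : S → W} {x₀ : Euc d} (hW : Module.finrank ℝ W = k) (hb : ∀ i, (b i : Euc d) + x₀ = i) :
    MeasurableEmbedding (fun w : W => (w : Euc d) + x₀) ∧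
    (μHE[k] : Measure (Euc d)).restrict (hull S)
      = ((volume : Measure W).restrict (convexHull ℝ (Set.range b))).map
          (fun w : W => (w : Euc d) + x₀) := by
  have hiso : Isometry (fun w : W => (w : Euc d) + x₀) :=
    (IsometryEquiv.addRight x₀).isometry.comp W.subtypeₗᵢ.isometry
  have hemb : MeasurableEmbedding (fun w : W => (w : Euc d) + x₀) :=
    hiso.isClosedEmbedding.measurableEmbedding
  have hmap := hiso.map_euclideanHausdorffMeasure (d := k)
  have hvol : (μHE[k] : Measure W) = volume := by
    rw [← hW]; exact InnerProductSpace.euclideanHausdorffMeasure_eq_volume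
  rw [hvol] at hmap
  refine ⟨hemb, ?_⟩
  have h := hemb.restrict_map volume (hull S)
  rw [hmap, hull_eq_image hb, Set.preimage_image_eq _ hemb.injective] at h
  rw [← h, hull_eq_image hb, Measure.restrict_restrict_of_subset (Set.image_subset_range _ _)]

theorem hausdorff_hull_pos {d k : ℕ} {S : Finset (Euc d)}
    (hS : AffineIndependent ℝ ((↑) : S → Euc d)) (hcard : S.card = k + 1) :
    0 < (μHE[k] : Measure (Euc d)).real (hull S) := by
  obtain ⟨W, b, x₀, hW, hb⟩ := exists_affineBasis_direction hS hcard
  obtain ⟨hemb, h⟩ := restrict_hull_eq_map hW hb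
  have h2 := congrArg (fun ν => ν Set.univ) h
  simp only [Measure.restrict_apply_univ, hemb.map_apply, Set.preimage_univ] at h2
  rw [Measure.real, h2]
  exact ENNReal.toReal_pos (volume_convexHull_affineBasis_pos b).ne'
    ((Set.finite_range b).isCompact_convexHull (𝕜 := ℝ)).measure_lt_top.ne

/-- The mean value of an affine function over a simplex is the mean of its values at the
vertices. -/
theorem setAverage_affineMap_hull {d k : ℕ} {S : Finset (Euc d)}
    (hS : AffineIndependent ℝ ((↑) : S → Euc d)) (hcard : S.card = k + 1)
    {F : Type*} [NormedAddCommGroup F] [NormedSpace ℝ F] [CompleteSpace F] (φ : Euc d →ᵃ[ℝ] F) :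
    ⨍ x in hull S, φ x ∂(μHE[k]) = ((k : ℝ) + 1)⁻¹ • ∑ p ∈ S, φ p := by
  obtain ⟨W, b, x₀, hW, hb⟩ := exists_affineBasis_direction hS hcard
  obtain ⟨hemb, h⟩ := restrict_hull_eq_map hW hb
  have h2 := congrArg (fun ν => ν Set.univ) h
  simp only [Measure.restrict_apply_univ, hemb.map_apply, Set.preimage_univ] at h2
  have key := setAverage_affineMap_convexHull b
    (φ.comp ((AffineEquiv.vaddConst ℝ x₀).toAffineMap.comp W.subtype.toAffineMap))
  rw [setAverage_eq] at key ⊢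
  rw [h, hemb.integral_map, Measure.real, h2]
  have e : ∀ w : W, (φ.comp ((AffineEquiv.vaddConst ℝ x₀).toAffineMap.comp W.subtype.toAffineMap)) w
      = φ ((w : Euc d) + x₀) := fun w => by simp
  simp only [e, hb] at key
  rw [Measure.real] at key
  rw [key, Fintype.card_coe, hcard, Finset.sum_coe_sort S (fun p => φ p)]
  push_cast
  rfl

end Means

/-! ### Barycentric coordinates, their gradients, and outward normals -/

section Simplex

open scoped Classical

variable {d : ℕ} {T : Finset (Euc d)}

/-- `T` is the vertex set of a nondegenerate `d`-simplex. -/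
def IsSimplex (T : Finset (Euc d)) : Prop :=
  AffineIndependent ℝ ((↑) : T → Euc d) ∧ T.card = d + 1

/-- The vertices of a `d`-simplex as an affine basis. -/
noncomputable def IsSimplex.basis (hT : IsSimplex T) : AffineBasis T ℝ (Euc d) where
  toFun := (↑)
  ind' := hT.1
  tot' := by
    rw [hT.1.affineSpan_eq_top_iff_card_eq_finrank_add_one]
    simpa using hT.2

/-- The barycentric coordinate of the `d`-simplex `T` that belongs to the vertex `p`. -/
noncomputable def bary (T : Finset (Euc d)) (p : Euc d) : Euc d →ᵃ[ℝ] ℝ :=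
  if h : IsSimplex T ∧ p ∈ T then h.1.basis.coord ⟨p, h.2⟩ else 0

namespace IsSimplex

theorem bary_eq (hT : IsSimplex T) {p : Euc d} (hp : p ∈ T) :
    bary T p = hT.basis.coord ⟨p, hp⟩ := dif_pos ⟨hT, hp⟩

theorem basis_apply (hT : IsSimplex T) (i : T) : hT.basis i = i := rfl

theorem nonempty (hT : IsSimplex T) : T.Nonempty := Finset.card_pos.mp (by rw [hT.2]; omega)

theorem bary_apply (hT : IsSimplex T) {p q : Euc d} (hp : p ∈ T) (hq : q ∈ T) :
    bary T p q = if p = q then 1 else 0 := by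
  have := hT.basis.coord_apply ⟨p, hp⟩ ⟨q, hq⟩
  rw [hT.basis_apply] at this
  simpa [hT.bary_eq hp] using this

theorem sum_bary (hT : IsSimplex T) (x : Euc d) : ∑ p ∈ T, bary T p x = 1 := by
  rw [← Finset.sum_coe_sort, ← hT.basis.sum_coord_apply_eq_one x]
  exact Finset.sum_congr rfl fun i _ => by rw [hT.bary_eq i.2]

theorem apply_eq_sum_bary (hT : IsSimplex T) {F : Type*} [AddCommGroup F] [Module ℝ F]
    (φ : Euc d →ᵃ[ℝ] F) (x : Euc d) : φ x = ∑ p ∈ T, bary T p x • φ p := by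
  rw [affineMap_apply_eq_sum_coord hT.basis φ x,
    ← Finset.sum_coe_sort T (fun p => bary T p x • φ p)]
  exact Finset.sum_congr rfl fun i _ => by rw [hT.bary_eq i.2, hT.basis_apply]

theorem eq_sum_bary (hT : IsSimplex T) (x : Euc d) : x = ∑ p ∈ T, bary T p x • p :=
  hT.apply_eq_sum_bary (AffineMap.id ℝ (Euc d)) x

theorem ext_bary (hT : IsSimplex T) {x y : Euc d} (h : ∀ p ∈ T, bary T p x = bary T p y) :
    x = y := by
  rw [hT.eq_sum_bary x, hT.eq_sum_bary y]
  exact Finset.sum_congr rfl fun p hp => by rw [h p hp]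

theorem ext_affineMap (hT : IsSimplex T) {F : Type*} [AddCommGroup F] [Module ℝ F]
    {φ ψ : Euc d →ᵃ[ℝ] F} (h : ∀ p ∈ T, φ p = ψ p) : φ = ψ := by
  ext x
  rw [hT.apply_eq_sum_bary φ x, hT.apply_eq_sum_bary ψ x]
  exact Finset.sum_congr rfl fun p hp => by rw [h p hp]

theorem range_basis (hT : IsSimplex T) : Set.range hT.basis = (T : Set (Euc d)) :=
  Subtype.range_coe

theorem mem_hull_iff (hT : IsSimplex T) {x : Euc d} :
    x ∈ hull T ↔ ∀ p ∈ T, 0 ≤ bary T p x := by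
  rw [hull, ← hT.range_basis, AffineBasis.convexHull_eq_nonneg_coord]
  exact ⟨fun h p hp => by rw [hT.bary_eq hp]; exact h _,
    fun h i => by rw [← hT.bary_eq i.2]; exact h i i.2⟩

theorem mem_interior_hull_iff (hT : IsSimplex T) {x : Euc d} :
    x ∈ interior (hull T) ↔ ∀ p ∈ T, 0 < bary T p x := by
  rw [hull, ← hT.range_basis, AffineBasis.interior_convexHull]
  exact ⟨fun h p hp => by rw [hT.bary_eq hp]; exact h _,
    fun h i => by rw [← hT.bary_eq i.2]; exact h i i.2⟩

/-- Faces are cut out by the vanishing of the coordinates of the missing vertices. This is the form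
in which conformity of the mesh is exploited later. -/
theorem mem_hull_subset_iff (hT : IsSimplex T) {F : Finset (Euc d)} (hF : F ⊆ T) {x : Euc d} :
    x ∈ hull F ↔ (∀ p ∈ T, 0 ≤ bary T p x) ∧ ∀ p ∈ T, p ∉ F → bary T p x = 0 := by
  constructor
  · intro hx
    refine ⟨hT.mem_hull_iff.mp (convexHull_mono (by exact_mod_cast hF) hx), fun p hp hpF => ?_⟩
    have hsub : hull F ⊆ bary T p ⁻¹' {0} := by
      refine convexHull_min (fun q hq => ?_) ((convex_singleton 0).affine_preimage _)
      have hq : q ∈ F := hq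
      simp [hT.bary_apply hp (hF hq), show p ≠ q from fun h => hpF (h ▸ hq)]
    exact hsub hx
  · rintro ⟨h0, h1⟩
    rw [Finset.mem_convexHull']
    have hz : ∀ p ∈ T, p ∉ F → bary T p x = 0 := h1
    refine ⟨fun p => bary T p x, fun p hp => h0 p (hF hp), ?_, ?_⟩
    · rw [← hT.sum_bary x]
      exact Finset.sum_subset hF hz
    · conv_rhs => rw [hT.eq_sum_bary x]
      exact Finset.sum_subset hF fun p hp hpF => by
        beta_reduce; rw [hz p hp hpF, zero_smul]

end IsSimplex

theorem affGrad_inner (v : Euc d →ᵃ[ℝ] ℝ) (w : Euc d) : ⟪affGrad v, w⟫_ℝ = v.linear w := by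
  simp [affGrad]

theorem affGrad_inner_sub (v : Euc d →ᵃ[ℝ] ℝ) (x y : Euc d) :
    ⟪affGrad v, x - y⟫_ℝ = v x - v y := by
  rw [affGrad_inner]; exact v.linearMap_vsub x y

namespace IsSimplex

theorem affGrad_eq_sum (hT : IsSimplex T) (v : Euc d →ᵃ[ℝ] ℝ) :
    affGrad v = ∑ p ∈ T, v p • affGrad (bary T p) := by
  refine ext_inner_right ℝ fun w => ?_
  have h := affGrad_inner_sub v w 0
  rw [sub_zero] at h
  rw [h, hT.apply_eq_sum_bary v w, hT.apply_eq_sum_bary v 0, ← Finset.sum_sub_distrib, sum_inner]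
  refine Finset.sum_congr rfl fun p _ => ?_
  have h := affGrad_inner_sub (bary T p) w 0
  rw [sub_zero] at h
  rw [real_inner_smul_left, h, smul_eq_mul, smul_eq_mul]; ring

theorem sum_affGrad_bary (hT : IsSimplex T) : ∑ p ∈ T, affGrad (bary T p) = 0 := by
  have h := hT.affGrad_eq_sum (AffineMap.const ℝ (Euc d) 1)
  simp only [AffineMap.const_apply, one_smul] at h
  rw [← h]; simp [affGrad]

theorem eq_of_inner_affGrad (hT : IsSimplex T) {x y : Euc d}
    (h : ∀ p ∈ T, ⟪affGrad (bary T p), x⟫_ℝ = ⟪affGrad (bary T p), y⟫_ℝ) : x = y := by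
  refine hT.ext_bary fun p hp => ?_
  have := affGrad_inner_sub (bary T p) x y
  rw [inner_sub_right, h p hp] at this
  linarith

/-- The linear part of `y` is a sum of rank-one maps, one per vertex, and the trace of each is an
inner product. -/
theorem affDiv_eq_sum (hT : IsSimplex T) (y : Euc d →ᵃ[ℝ] Euc d) :
    affDiv y = ∑ p ∈ T, ⟪affGrad (bary T p), y p⟫_ℝ := by
  have hlin : y.linear = ∑ p ∈ T, (bary T p).linear.smulRight (y p) := by
    ext1 w
    have h1 := y.linearMap_vsub w 0
    simp only [vsub_eq_sub, sub_zero] at h1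
    rw [h1, hT.apply_eq_sum_bary y w, hT.apply_eq_sum_bary y 0, ← Finset.sum_sub_distrib,
      LinearMap.sum_apply]
    refine Finset.sum_congr rfl fun p _ => ?_
    have h2 := (bary T p).linearMap_vsub w 0
    simp only [vsub_eq_sub, sub_zero] at h2
    rw [LinearMap.smulRight_apply, h2, sub_smul]
  rw [affDiv, hlin, map_sum]
  refine Finset.sum_congr rfl fun p _ => ?_
  rw [LinearMap.trace_smulRight, affGrad_inner]

theorem affGrad_bary_ne_zero (hT : IsSimplex T) (hd : 0 < d) {p : Euc d} (hp : p ∈ T) :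
    affGrad (bary T p) ≠ 0 := by
  intro h
  obtain ⟨q, hq, hqp⟩ : ∃ q ∈ T, q ≠ p :=
    Finset.exists_mem_ne (by rw [hT.2]; omega) p
  have := affGrad_inner_sub (bary T p) p q
  rw [h, inner_zero_left, hT.bary_apply hp hp, hT.bary_apply hp hq] at this
  simp [hqp.symm] at this

theorem card_erase (hT : IsSimplex T) {p : Euc d} (hp : p ∈ T) : (T.erase p).card = d := by
  rw [Finset.card_erase_of_mem hp, hT.2]; omega

/-- `outwardNormal` is a choice, so existence and uniqueness are both needed: the normalised
negative gradient qualifies, and any qualifying vector equals it. -/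
theorem outwardNormal_erase (hT : IsSimplex T) (hd : 0 < d) {p : Euc d} (hp : p ∈ T) :
    outwardNormal T (T.erase p) = -(‖affGrad (bary T p)‖⁻¹ • affGrad (bary T p)) := by
  set G := affGrad (bary T p) with hG
  have hG0 : 0 < ‖G‖ := norm_pos_iff.mpr (hT.affGrad_bary_ne_zero hd hp)
  have hex : IsOutwardUnitNormal T (T.erase p) (-(‖G‖⁻¹ • G)) := by
    refine ⟨by rw [norm_neg, norm_smul, norm_inv, norm_norm, inv_mul_cancel₀ hG0.ne'], ?_, ?_⟩
    · intro a ha b hb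
      rw [Finset.mem_erase] at ha hb
      rw [inner_neg_left, real_inner_smul_left, hG, affGrad_inner_sub, hT.bary_apply hp ha.2,
        hT.bary_apply hp hb.2]
      simp [ha.1.symm, hb.1.symm]
    · intro a ha haS b hb
      rw [Finset.mem_erase] at hb
      have : a = p := by by_contra h; exact haS (Finset.mem_erase.mpr ⟨h, ha⟩)
      subst this
      rw [inner_neg_left, real_inner_smul_left, hG, affGrad_inner_sub, hT.bary_apply hp hp,
        hT.bary_apply hp hb.2]
      simp only [↓reduceIte, hb.1.symm, sub_zero, mul_one, Left.neg_neg_iff]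
      positivity
  obtain ⟨hn1, hn2, hn3⟩ := Classical.epsilon_spec (p := IsOutwardUnitNormal T (T.erase p)) ⟨_, hex⟩
  change ‖outwardNormal T (T.erase p)‖ = 1 at hn1
  change ∀ a ∈ T.erase p, ∀ b ∈ T.erase p, ⟪outwardNormal T (T.erase p), a - b⟫_ℝ = 0 at hn2
  change ∀ a ∈ T, a ∉ T.erase p → ∀ b ∈ T.erase p, ⟪outwardNormal T (T.erase p), a - b⟫_ℝ < 0 at hn3
  set n := outwardNormal T (T.erase p) with hn
  obtain ⟨q, hq⟩ : (T.erase p).Nonempty := Finset.card_pos.mp (by rw [hT.card_erase hp]; exact hd)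
  have hα := hn3 p hp (Finset.notMem_erase p T) q hq
  set α := ⟪n, p - q⟫_ℝ with hαdef
  -- The affine function `⟪n, · - q⟫` vanishes on the side, so it is `α` times the coordinate of
  -- `p`. Unit length and `α < 0` then fix `α`.
  have hnG : n = α • G := by
    refine ext_inner_right ℝ fun w => ?_
    have hw : ∀ x : Euc d, ⟪n, x - q⟫_ℝ = bary T p x * α := by
      intro x
      let φ : Euc d →ᵃ[ℝ] ℝ := (innerSL ℝ n).toLinearMap.toAffineMap.comp
        (AffineEquiv.vaddConst ℝ q).symm.toAffineMap
      have hφ : ∀ x, φ x = ⟪n, x - q⟫_ℝ := fun x => by simp [φ]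
      rw [← hφ, hT.apply_eq_sum_bary φ x, Finset.sum_eq_single_of_mem p hp]
      · rw [hφ, smul_eq_mul]
      · intro r hr hrp
        rw [hφ, hn2 r (Finset.mem_erase.mpr ⟨hrp, hr⟩) q hq, smul_zero]
    have h1 := hw (q + w)
    have h2 := affGrad_inner_sub (bary T p) (q + w) q
    rw [add_sub_cancel_left] at h1 h2
    rw [hT.bary_apply hp (Finset.mem_of_mem_erase hq), if_neg (Finset.ne_of_mem_erase hq).symm,
      sub_zero] at h2
    rw [h1, real_inner_smul_left, h2, mul_comm]
  have hαn : |α| * ‖G‖ = 1 := by rw [← hn1, hnG, norm_smul, Real.norm_eq_abs]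
  rw [abs_of_neg hα] at hαn
  have : α = -‖G‖⁻¹ := by field_simp; linarith
  rw [hnG, this, neg_smul]

end IsSimplex

end Simplex

/-! ### Volume of a simplex from base and height -/

section Cone

open scoped Classical

variable {d : ℕ} {T : Finset (Euc d)}

namespace IsSimplex

theorem bary_lineMap (p a b : Euc d) (t : ℝ) :
    bary T p (AffineMap.lineMap a b t) = (1 - t) * bary T p a + t * bary T p b := by
  rw [AffineMap.apply_lineMap, AffineMap.lineMap_apply_ring]

/-- The slices of a simplex parallel to the side opposite to the vertex `p`. -/
theorem hull_inter_slice (hT : IsSimplex T) {p : Euc d} (hp : p ∈ T) {t : ℝ}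
    (ht : 0 < t) (ht1 : t ≤ 1) :
    {z | z ∈ hull T ∧ bary T p z = 1 - t} = AffineMap.homothety p t '' hull (T.erase p) := by
  ext z
  simp only [Set.mem_ofPred_eq, Set.mem_image, hT.mem_hull_iff,
    hT.mem_hull_subset_iff (Finset.erase_subset p T), AffineMap.homothety_eq_lineMap]
  constructor
  · rintro ⟨h0, h1⟩
    refine ⟨AffineMap.lineMap p z t⁻¹, ⟨fun r hr => ?_, fun r hr hrp => ?_⟩, ?_⟩
    · rw [bary_lineMap, hT.bary_apply hr hp]
      by_cases hrp : r = p
      · subst hrp; rw [h1, if_pos rfl]; apply le_of_eq; field_simp; ring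
      · rw [if_neg hrp, mul_zero, zero_add]; exact mul_nonneg (by positivity) (h0 r hr)
    · have : r = p := by by_contra h; exact hrp (Finset.mem_erase.mpr ⟨h, hr⟩)
      subst this
      rw [bary_lineMap, hT.bary_apply hr hr, h1, if_pos rfl]; field_simp; ring
    · rw [AffineMap.lineMap_apply, AffineMap.lineMap_apply]
      simp [smul_smul, mul_inv_cancel₀ ht.ne']
  · rintro ⟨w, ⟨h0, h1⟩, rfl⟩
    refine ⟨fun r hr => ?_, ?_⟩
    · rw [bary_lineMap, hT.bary_apply hr hp]
      have := h0 r hr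
      split_ifs <;> nlinarith
    · rw [bary_lineMap, hT.bary_apply hp hp, h1 p hp (Finset.notMem_erase p T)]; simp

/-- The volume of a simplex is `1 / d` times the product of the area of a side and the
corresponding height `1 / ‖∇ bary‖`. -/
theorem volume_mul_norm_affGrad (hT : IsSimplex T) (hd : 0 < d) {p : Euc d} (hp : p ∈ T) :
    volume.real (hull T) * (d * ‖affGrad (bary T p)‖) = (surf d).real (hull (T.erase p)) := by
  set G := affGrad (bary T p) with hG
  have hG0 : G ≠ 0 := hT.affGrad_bary_ne_zero hd hp
  have hn : 0 < ‖G‖ := norm_pos_iff.mpr hG0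
  set g := ‖G‖ ^ 2 with hg
  have hgpos : 0 < g := by positivity
  have hmeas : MeasurableSet (hull T) :=
    (T.finite_toSet.isCompact_convexHull (𝕜 := ℝ)).measurableSet
  -- Cavalieri's principle along `G`: the slice at parameter `x` is the level set of the coordinate
  -- of `p` at height `1 + x ‖G‖²`, a copy of the side scaled by `-x ‖G‖²`.
  have key := EuclideanGeometry.euclideanHausdorffMeasure_eq_lintegral p hG0 hmeas
  rw [InnerProductSpace.euclideanHausdorffMeasure_eq_volume] at key
  have hslice : ∀ x : ℝ, hull T ∩ AffineSubspace.mk' (x • G +ᵥ p) (ℝ ∙ G)ᗮ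
      = {z | z ∈ hull T ∧ bary T p z = 1 - (-(x * g))} := by
    intro x
    ext z
    simp only [Set.mem_inter_iff, SetLike.mem_coe, AffineSubspace.mem_mk', Set.mem_ofPred_eq,
      Submodule.mem_orthogonal_singleton_iff_inner_right, vsub_eq_sub, vadd_eq_add]
    have h1 : ⟪G, z - (x • G + p)⟫_ℝ = bary T p z - 1 - x * g := by
      have h2 := affGrad_inner_sub (bary T p) z p
      rw [hT.bary_apply hp hp, if_pos rfl, ← hG] at h2
      rw [show z - (x • G + p) = (z - p) - x • G by abel, inner_sub_right, h2,
        real_inner_smul_right, real_inner_self_eq_norm_sq]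
    rw [h1]
    constructor <;> rintro ⟨h, h'⟩ <;> exact ⟨h, by linarith⟩
  set S := hull (T.erase p) with hS
  have hint : (∫⁻ x : ℝ, (surf d) (hull T ∩ AffineSubspace.mk' (x • G +ᵥ p) (ℝ ∙ G)ᗮ))
      = ENNReal.ofReal (1 / (d * g)) * surf d S := by
    have hae : (fun x : ℝ => (surf d) (hull T ∩ AffineSubspace.mk' (x • G +ᵥ p) (ℝ ∙ G)ᗮ))
        =ᵐ[volume] (Set.Ioc (-(1 / g)) 0).indicator
          (fun x => ENNReal.ofReal ((-(x * g)) ^ (d - 1)) * surf d S) := by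
      -- The two extreme slices, the vertex and the full side, are discarded as a null set: the
      -- homothety needs a nonzero ratio, and the half-open interval omits its left end.
      have hne0 : ∀ᵐ x : ℝ ∂volume, x ≠ 0 := by
        simp [ae_iff, measure_singleton]
      have hne1 : ∀ᵐ x : ℝ ∂volume, x ≠ -(1 / g) := by
        simp only [ae_iff, not_not]
        exact measure_singleton _
      filter_upwards [hne0, hne1] with x hx0 hx1
      rw [hslice]
      by_cases hx : x ∈ Set.Ioc (-(1 / g)) 0
      · rw [Set.indicator_of_mem hx]
        have h1 : 0 < -(x * g) := by
          have : x < 0 := lt_of_le_of_ne hx.2 hx0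
          nlinarith
        have h2 : -(x * g) ≤ 1 := by
          have := hx.1
          rw [neg_lt, lt_div_iff₀ hgpos] at this
          linarith
        rw [hT.hull_inter_slice hp h1 h2,
          euclideanHausdorffMeasure_homothety_image (d - 1) p h1.ne']
        rw [ENNReal.smul_def, smul_eq_mul, ENNReal.ofReal_pow h1.le]
        congr 1
        rw [ENNReal.coe_pow, ← enorm_eq_nnnorm, Real.enorm_eq_ofReal h1.le]
      · rw [Set.indicator_of_notMem hx]
        convert measure_empty (μ := surf d)
        ext z
        simp only [Set.mem_ofPred_eq, Set.mem_empty_iff_false, iff_false, not_and]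
        intro hz hzp
        apply hx
        have hz := hT.mem_hull_iff.mp hz
        have h1 := hz p hp
        have h2 : bary T p z ≤ 1 := by
          rw [← hT.sum_bary z]
          exact Finset.single_le_sum (fun r hr => hz r hr) hp
        rw [hzp] at h1 h2
        have h3 : -(1 / g) ≤ x := by
          rw [neg_le, le_div_iff₀ hgpos]
          linarith
        refine ⟨lt_of_le_of_ne h3 hx1.symm, ?_⟩
        by_contra hcon
        push Not at hcon
        nlinarith
    rw [lintegral_congr_ae hae, lintegral_indicator measurableSet_Ioc,
      lintegral_mul_const _ (by fun_prop)]
    congr 1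
    rw [← ofReal_integral_eq_lintegral_ofReal]
    · congr 1
      rw [← intervalIntegral.integral_of_le (by simp; positivity)]
      have h := intervalIntegral.integral_comp_mul_left (a := -(1 / g)) (b := 0)
        (fun x : ℝ => x ^ (d - 1)) (neg_ne_zero.mpr hgpos.ne')
      have e : ∀ x : ℝ, -(x * g) = -g * x := fun x => by ring
      simp only [e]
      rw [h, integral_pow]
      have hd' : (d - 1 + 1 : ℕ) = d := by omega
      have hd'' : ((d - 1 : ℕ) : ℝ) + 1 = d := by exact_mod_cast hd'
      rw [hd', hd'']
      have : -g * -(1 / g) = 1 := by field_simp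
      rw [this]
      simp [hd.ne']
      ring
    · exact (Continuous.integrableOn_Ioc (by fun_prop))
    · refine (ae_restrict_iff' measurableSet_Ioc).mpr (Filter.Eventually.of_forall fun x hx => ?_)
      have : 0 ≤ -(x * g) := by nlinarith [hx.2]
      positivity
  have hfin : Module.finrank ℝ (Euc d) - 1 = d - 1 := by simp
  rw [hfin, hint] at key
  rw [Measure.real, key, Measure.real, ENNReal.toReal_mul, ENNReal.toReal_mul,
    ENNReal.toReal_ofReal (by positivity), toReal_enorm, hg]
  have hd0 : (d : ℝ) ≠ 0 := by exact_mod_cast hd.ne'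
  field_simp

end IsSimplex

end Cone

/-! ### Raviart–Thomas fields on a single simplex -/

section LocalAlgebra

open scoped Classical

variable {d : ℕ} {T : Finset (Euc d)}

namespace IsSimplex

/-- By the volume formula, the flux of `w` through any side is its component along the barycentric
gradient, up to the factor `-d |T|` common to all sides. Local computations can therefore use
gradients instead of normals. -/
theorem surf_mul_inner_outwardNormal (hT : IsSimplex T) (hd : 0 < d) {p : Euc d} (hp : p ∈ T)
    (w : Euc d) :
    (surf d).real (hull (T.erase p)) * ⟪w, outwardNormal T (T.erase p)⟫_ℝ
      = -(d * volume.real (hull T) * ⟪affGrad (bary T p), w⟫_ℝ) := by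
  have hn : ‖affGrad (bary T p)‖ ≠ 0 := norm_ne_zero_iff.mpr (hT.affGrad_bary_ne_zero hd hp)
  rw [← hT.volume_mul_norm_affGrad hd hp, hT.outwardNormal_erase hd hp, inner_neg_right,
    real_inner_smul_right, real_inner_comm]
  field_simp

theorem volume_eq_hausdorff : (volume : Measure (Euc d)) = μHE[d] :=
  (EuclideanSpace.euclideanHausdorffMeasure_eq_volume d).symm

theorem volume_pos (hT : IsSimplex T) : 0 < volume.real (hull T) := by
  rw [volume_eq_hausdorff]; exact hausdorff_hull_pos hT.1 hT.2

theorem setAverage_hull (hT : IsSimplex T) {F : Type*} [NormedAddCommGroup F] [NormedSpace ℝ F]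
    [CompleteSpace F] (φ : Euc d →ᵃ[ℝ] F) :
    ⨍ x in hull T, φ x = ((d : ℝ) + 1)⁻¹ • ∑ p ∈ T, φ p := by
  rw [volume_eq_hausdorff]; exact setAverage_affineMap_hull hT.1 hT.2 φ

/-- The normal fluxes through the sides determine the vertex values of an affine field whose normal
components are constant on the sides. -/
theorem inner_affGrad_vertex (hT : IsSimplex T) {y : Euc d →ᵃ[ℝ] Euc d} {c : Euc d → ℝ}
    (hc : ∀ p ∈ T, ∀ q ∈ T, q ≠ p → ⟪affGrad (bary T p), y q⟫_ℝ = c p) {p q : Euc d}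
    (hp : p ∈ T) (hq : q ∈ T) :
    ⟪affGrad (bary T p), y q⟫_ℝ = c p - if p = q then ∑ r ∈ T, c r else 0 := by
  split_ifs with h
  · subst h
    -- At the vertex `p` all components but the one for `p` itself are prescribed; the last one
    -- follows because the gradients sum to zero.
    have h0 : ∑ r ∈ T, ⟪affGrad (bary T r), y p⟫_ℝ = 0 := by
      rw [← sum_inner, hT.sum_affGrad_bary, inner_zero_left]
    rw [← Finset.add_sum_erase _ _ hp, Finset.sum_congr rfl fun r hr =>
      hc r (Finset.mem_of_mem_erase hr) p hp (Finset.ne_of_mem_erase hr).symm] at h0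
    rw [← Finset.add_sum_erase _ _ hp]
    linarith
  · rw [hc p hp q hq (Ne.symm h), sub_zero]

theorem affDiv_eq_flux (hT : IsSimplex T) {y : Euc d →ᵃ[ℝ] Euc d} {c : Euc d → ℝ}
    (hc : ∀ p ∈ T, ∀ q ∈ T, q ≠ p → ⟪affGrad (bary T p), y q⟫_ℝ = c p) :
    affDiv y = -(d * ∑ r ∈ T, c r) := by
  rw [hT.affDiv_eq_sum, Finset.sum_congr rfl fun p hp => hT.inner_affGrad_vertex hc hp hp]
  simp only [↓reduceIte, Finset.sum_sub_distrib, Finset.sum_const, hT.2, nsmul_eq_mul]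
  push_cast; ring

theorem inner_affGrad_mean (hT : IsSimplex T) {y : Euc d →ᵃ[ℝ] Euc d} {c : Euc d → ℝ}
    (hc : ∀ p ∈ T, ∀ q ∈ T, q ≠ p → ⟪affGrad (bary T p), y q⟫_ℝ = c p) {p : Euc d} (hp : p ∈ T) :
    ⟪affGrad (bary T p), ((d : ℝ) + 1)⁻¹ • ∑ q ∈ T, y q⟫_ℝ
      = c p - ((d : ℝ) + 1)⁻¹ * ∑ r ∈ T, c r := by
  rw [real_inner_smul_right, inner_sum,
    Finset.sum_congr rfl fun q hq => hT.inner_affGrad_vertex hc hp hq, Finset.sum_sub_distrib,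
    Finset.sum_ite_eq, if_pos hp, Finset.sum_const, hT.2, nsmul_eq_mul]
  push_cast
  have : (d : ℝ) + 1 ≠ 0 := by positivity
  field_simp

/-- Integration by parts on a single simplex. -/
theorem integration_by_parts (hT : IsSimplex T) {y : Euc d →ᵃ[ℝ] Euc d} {c : Euc d → ℝ}
    (hc : ∀ p ∈ T, ∀ q ∈ T, q ≠ p → ⟪affGrad (bary T p), y q⟫_ℝ = c p) (v : Euc d →ᵃ[ℝ] ℝ) :
    ⟪affGrad v, ((d : ℝ) + 1)⁻¹ • ∑ q ∈ T, y q⟫_ℝ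
        + affDiv y * (((d : ℝ) + 1)⁻¹ • ∑ q ∈ T, v q)
      = -∑ p ∈ T, c p * ∑ q ∈ T.erase p, v q := by
  -- With `C = ∑ c p`, `V = ∑ v p` and `P = ∑ c p * v p`, the left side is `P - C V / (d + 1) - d C
  -- V / (d + 1) = P - C V`, which is the right side.
  rw [hT.affGrad_eq_sum v, sum_inner, hT.affDiv_eq_flux hc]
  simp_rw [real_inner_smul_left]
  rw [Finset.sum_congr rfl fun p hp => by rw [hT.inner_affGrad_mean hc hp]]
  have he : ∀ p ∈ T, c p * ∑ q ∈ T.erase p, v q = c p * ∑ q ∈ T, v q - v p * c p := by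
    intro p hp
    rw [← Finset.add_sum_erase _ _ hp]; ring
  rw [Finset.sum_congr rfl he, Finset.sum_sub_distrib, ← Finset.sum_mul]
  simp_rw [mul_sub]
  rw [Finset.sum_sub_distrib, ← Finset.sum_mul, smul_eq_mul]
  have : (d : ℝ) + 1 ≠ 0 := by positivity
  field_simp
  ring

/-- The mean determines the fluxes `c p` up to a common constant, the divergence determines their
sum, and the fluxes determine the vertex values. -/
theorem eq_of_mean_eq_of_affDiv_eq (hT : IsSimplex T) (hd : 0 < d) {y y' : Euc d →ᵃ[ℝ] Euc d}
    {c c' : Euc d → ℝ}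
    (hc : ∀ p ∈ T, ∀ q ∈ T, q ≠ p → ⟪affGrad (bary T p), y q⟫_ℝ = c p)
    (hc' : ∀ p ∈ T, ∀ q ∈ T, q ≠ p → ⟪affGrad (bary T p), y' q⟫_ℝ = c' p)
    (hmean : ((d : ℝ) + 1)⁻¹ • ∑ q ∈ T, y q = ((d : ℝ) + 1)⁻¹ • ∑ q ∈ T, y' q)
    (hdiv : affDiv y = affDiv y') : y = y' := by
  rw [hT.affDiv_eq_flux hc, hT.affDiv_eq_flux hc', neg_inj,
    mul_right_inj' (by exact_mod_cast hd.ne')] at hdiv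
  have hcc : ∀ p ∈ T, c p = c' p := by
    intro p hp
    have h1 := hT.inner_affGrad_mean hc hp
    have h2 := hT.inner_affGrad_mean hc' hp
    rw [hmean, hdiv] at h1
    linarith
  refine hT.ext_affineMap fun q hq => hT.eq_of_inner_affGrad fun p hp => ?_
  rw [hT.inner_affGrad_vertex hc hp hq, hT.inner_affGrad_vertex hc' hp hq, hdiv, hcc p hp]

/-- The affine field with mean value `a` and divergence `-r` whose normal components are constant
on the sides. -/
theorem exists_affineMap_mean_affDiv (hT : IsSimplex T) (hd : 0 < d) (a : Euc d) (r : ℝ) :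
    ∃ y : Euc d →ᵃ[ℝ] Euc d, ((d : ℝ) + 1)⁻¹ • ∑ q ∈ T, y q = a ∧ affDiv y = -r ∧
      ∀ p ∈ T, ∃ c, ∀ q ∈ T, q ≠ p → ⟪affGrad (bary T p), y q⟫_ℝ = c := by
  set x₀ : Euc d := ((d : ℝ) + 1)⁻¹ • ∑ q ∈ T, q with hx₀
  set b : ℝ := -r / d with hb
  have hd0 : (d : ℝ) ≠ 0 := by exact_mod_cast hd.ne'
  have hd1 : (d : ℝ) + 1 ≠ 0 := by positivity
  -- This is `a + b (x - x₀)` around the barycentre `x₀`; the slope `b = -r / d` is forced, since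
  -- the identity has trace `d`.
  let y : Euc d →ᵃ[ℝ] Euc d := AffineMap.const ℝ (Euc d) (a - b • x₀) + b • AffineMap.id ℝ (Euc d)
  have hy : ∀ x, y x = a + b • (x - x₀) := fun x => by
    simp [y, smul_sub]; abel
  refine ⟨y, ?_, ?_, ?_⟩
  · simp_rw [hy]
    rw [Finset.sum_add_distrib, Finset.sum_const, hT.2, ← Finset.smul_sum, Finset.sum_sub_distrib,
      Finset.sum_const, hT.2]
    have : ∑ q ∈ T, q = (d + 1) • x₀ := by
      rw [hx₀, ← Nat.cast_smul_eq_nsmul ℝ, smul_smul]; push_cast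
      rw [mul_inv_cancel₀ hd1, one_smul]
    rw [this, sub_self, smul_zero, add_zero, ← Nat.cast_smul_eq_nsmul ℝ, smul_smul]; push_cast
    rw [inv_mul_cancel₀ hd1, one_smul]
  · have : y.linear = b • LinearMap.id := by simp [y]
    rw [affDiv, this, map_smul, LinearMap.trace_id]
    simp [hb]; field_simp
  · intro p hp
    refine ⟨⟪affGrad (bary T p), a⟫_ℝ - b * bary T p x₀, fun q hq hqp => ?_⟩
    rw [hy, inner_add_right, real_inner_smul_right, affGrad_inner_sub, hT.bary_apply hp hq,
      if_neg hqp.symm]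
    ring

end IsSimplex

end LocalAlgebra

/-! ### Relative interiors of sides, and segments in general position -/

section Topology

open scoped Classical
open Filter Topology

variable {d : ℕ}

theorem continuous_bary (T : Finset (Euc d)) (p : Euc d) : Continuous (bary T p) :=
  (bary T p).continuous_of_finiteDimensional

theorem isClosed_hull (T : Finset (Euc d)) : IsClosed (hull T) :=
  (T.finite_toSet.isCompact_convexHull (𝕜 := ℝ)).isClosed

namespace IsSimplex

variable {T : Finset (Euc d)}

/-- The barycentre of a side lies in its relative interior. -/
theorem exists_mem_hull_pos (hT : IsSimplex T) (hd : 0 < d) {p : Euc d} (hp : p ∈ T) :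
    ∃ x ∈ hull (T.erase p), ∀ q ∈ T.erase p, 0 < bary T q x := by
  have hd0 : (0 : ℝ) < d := by exact_mod_cast hd
  set x : Euc d := (d : ℝ)⁻¹ • ∑ q ∈ T.erase p, q with hx
  have hb : ∀ r ∈ T, bary T r x = if r ∈ T.erase p then (d : ℝ)⁻¹ else 0 := by
    intro r hr
    have hlin : ∀ z, bary T r z = (bary T r).linear z + bary T r 0 := fun z =>
      congrFun (bary T r).decomp z
    have h1 : bary T r x = (d : ℝ)⁻¹ * ∑ q ∈ T.erase p, bary T r q := by
      rw [hlin, hx, map_smul, map_sum, Finset.sum_congr rfl fun q _ => hlin q,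
        Finset.sum_add_distrib, Finset.sum_const, hT.card_erase hp, smul_eq_mul, nsmul_eq_mul]
      field_simp
    rw [h1, Finset.sum_congr rfl fun q hq => hT.bary_apply hr (Finset.mem_of_mem_erase hq),
      Finset.sum_ite_eq]
    split_ifs <;> simp
  refine ⟨x, (hT.mem_hull_subset_iff (Finset.erase_subset p T)).mpr
    ⟨fun r hr => ?_, fun r hr hrp => ?_⟩, fun q hq => ?_⟩
  · rw [hb r hr]; split_ifs <;> positivity
  · rw [hb r hr, if_neg hrp]
  · rw [hb q (Finset.mem_of_mem_erase hq), if_pos hq]; positivity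

/-- Every neighbourhood of a point of a side meets the relative interior of the side. -/
theorem exists_mem_open_hull_pos (hT : IsSimplex T) (hd : 0 < d) {p : Euc d} (hp : p ∈ T)
    {U : Set (Euc d)} (hU : IsOpen U) {c : Euc d} (hc : c ∈ hull (T.erase p)) (hcU : c ∈ U) :
    ∃ x ∈ U, x ∈ hull (T.erase p) ∧ ∀ q ∈ T.erase p, 0 < bary T q x := by
  obtain ⟨x₀, hx₀, hpos⟩ := hT.exists_mem_hull_pos hd hp
  -- Moving `c` slightly towards a relative interior point `x₀` makes all coordinates of the side's
  -- vertices positive without leaving `U`.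
  have hcont : Tendsto (fun t : ℝ => AffineMap.lineMap c x₀ t) (𝓝[>] 0) (𝓝 c) := by
    have : Continuous (fun t : ℝ => (AffineMap.lineMap c x₀ t : Euc d)) :=
      AffineMap.lineMap_continuous
    have h := (this.tendsto 0).mono_left (nhdsWithin_le_nhds (s := Set.Ioi 0))
    simpa using h
  have h1 : ∀ᶠ t : ℝ in 𝓝[>] 0, (AffineMap.lineMap c x₀ t : Euc d) ∈ U :=
    hcont.eventually (hU.mem_nhds hcU)
  have h2 : ∀ᶠ t : ℝ in 𝓝[>] 0, t ∈ Set.Ioc (0 : ℝ) 1 := Ioc_mem_nhdsGT one_pos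
  obtain ⟨t, ht1, ht2⟩ := (h1.and h2).exists
  have hc' := (hT.mem_hull_subset_iff (Finset.erase_subset p T)).mp hc
  refine ⟨_, ht1, (convex_convexHull ℝ _).lineMap_mem hc hx₀ ⟨ht2.1.le, ht2.2⟩, fun q hq => ?_⟩
  rw [bary_lineMap]
  have := hc'.1 q (Finset.mem_of_mem_erase hq)
  have h3 := hpos q hq
  have := ht2.1
  have := ht2.2
  nlinarith [mul_nonneg (sub_nonneg.mpr ht2.2) (hc'.1 q (Finset.mem_of_mem_erase hq)),
    mul_pos ht2.1 h3]

theorem mem_intrinsicInterior_hull (hT : IsSimplex T) {p : Euc d} (hp : p ∈ T) {x : Euc d}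
    (hx : x ∈ hull (T.erase p)) (hpos : ∀ q ∈ T.erase p, 0 < bary T q x) :
    x ∈ intrinsicInterior ℝ (hull (T.erase p)) := by
  rw [mem_intrinsicInterior]
  refine ⟨⟨x, subset_affineSpan ℝ _ hx⟩, ?_, rfl⟩
  rw [mem_interior]
  refine ⟨{y | ∀ q ∈ T.erase p, 0 < bary T q (y : Euc d)}, ?_, ?_, hpos⟩
  · intro y hy
    have hyp : bary T p (y : Euc d) = 0 := by
      have hle : affineSpan ℝ (hull (T.erase p))
          ≤ AffineSubspace.comap (bary T p) (AffineSubspace.mk' (0 : ℝ) ⊥) := by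
        rw [affineSpan_le]
        intro z hz
        have := ((hT.mem_hull_subset_iff (Finset.erase_subset p T)).mp hz).2 p hp
          (Finset.notMem_erase p T)
        simp [this]
      simpa using hle y.2
    refine (hT.mem_hull_subset_iff (Finset.erase_subset p T)).mpr ⟨fun r hr => ?_, fun r hr hrp => ?_⟩
    · by_cases h : r = p
      · rw [h, hyp]
      · exact (hy r (Finset.mem_erase.mpr ⟨h, hr⟩)).le
    · have : r = p := by by_contra h; exact hrp (Finset.mem_erase.mpr ⟨h, hr⟩)
      rw [this, hyp]
  · have : {y : affineSpan ℝ (hull (T.erase p)) | ∀ q ∈ T.erase p, 0 < bary T q (y : Euc d)}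
        = ⋂ q ∈ T.erase p, {y : affineSpan ℝ (hull (T.erase p)) | 0 < bary T q (y : Euc d)} := by
      ext; simp
    rw [this]
    exact isOpen_biInter_finset fun q _ =>
      isOpen_lt continuous_const ((continuous_bary T q).comp continuous_subtype_val)

theorem interior_hull_nonempty (hT : IsSimplex T) : (interior (hull T)).Nonempty := by
  rw [hull, interior_convexHull_nonempty_iff_affineSpan_eq_top, ← hT.range_basis]
  exact hT.basis.tot

theorem closure_interior_hull (hT : IsSimplex T) : closure (interior (hull T)) = hull T := by
  rw [(convex_convexHull ℝ _).closure_interior_eq_closure_of_nonempty_interior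
    hT.interior_hull_nonempty, (isClosed_hull T).closure_eq]

end IsSimplex

/-- Two open sets can be joined by a segment that avoids finitely many simplices of codimension at
least two. -/
theorem exists_segment_disjoint {U V : Set (Euc d)} (hU : IsOpen U) (hV : IsOpen V)
    (hUne : U.Nonempty) (hVne : V.Nonempty) {𝓕 : Set (Finset (Euc d))} (h𝓕 : 𝓕.Finite)
    (hcard : ∀ F ∈ 𝓕, F.card < d) :
    ∃ a ∈ U, ∃ b ∈ V, ∀ F ∈ 𝓕, Disjoint (segment ℝ a b) (hull F) := by
  have key : ∀ F : Finset (Euc d), F.card ≤ d → affineSpan ℝ (F : Set (Euc d)) ≠ ⊤ := by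
    intro F hF htop
    have h1 : (F : Set (Euc d)).Nonempty := by
      rw [Set.nonempty_iff_ne_empty]
      intro h
      rw [h, AffineSubspace.span_empty] at htop
      exact AffineSubspace.bot_ne_top ℝ (Euc d) (Euc d) htop
    obtain ⟨n, hn⟩ : ∃ n, F.card = n + 1 :=
      ⟨F.card - 1, by have := Finset.card_pos.mpr (Finset.coe_nonempty.mp h1); omega⟩
    have h2 := finrank_vectorSpan_range_le ℝ ((↑) : F → Euc d) (n := n) (by simpa using hn)
    have h3 := congrArg AffineSubspace.direction htop
    rw [direction_affineSpan, AffineSubspace.direction_top] at h3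
    rw [Subtype.range_coe_subtype, Finset.setOfPred_mem, h3, finrank_top] at h2
    simp at h2
    omega
  -- At most `d` points span a proper affine subspace, so finitely many such spans form a null set,
  -- which cannot contain a nonempty open set.
  have pick : ∀ {W : Set (Euc d)}, IsOpen W → W.Nonempty → ∀ {𝓖 : Set (Finset (Euc d))},
      𝓖.Finite → (∀ F ∈ 𝓖, F.card ≤ d) →
      ∃ a ∈ W, ∀ F ∈ 𝓖, a ∉ affineSpan ℝ (F : Set (Euc d)) := by
    intro W hW hWne 𝓖 h𝓖 hc
    have hnull : volume (⋃ F ∈ 𝓖, (affineSpan ℝ (F : Set (Euc d)) : Set (Euc d))) = 0 :=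
      (measure_biUnion_null_iff h𝓖.countable).mpr fun F hF =>
        Measure.addHaar_affineSubspace _ _ (key F (hc F hF))
    by_contra! hcon
    have hsub : W ⊆ ⋃ F ∈ 𝓖, (affineSpan ℝ (F : Set (Euc d)) : Set (Euc d)) := by
      intro a ha
      obtain ⟨F, hF, haF⟩ := hcon a ha
      exact Set.mem_biUnion hF haF
    exact (hW.measure_pos volume hWne).ne' (measure_mono_null hsub hnull)
  -- First `a` avoids the span of every `F`; then `b` avoids the span of every `insert a F`, which
  -- still has at most `d` points. A segment meeting `F` away from `a` would put `b` in the latter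
  -- span.
  obtain ⟨a, haU, ha⟩ := pick hU hUne h𝓕 fun F hF => (hcard F hF).le
  obtain ⟨b, hbV, hb⟩ := pick hV hVne (h𝓕.image (insert a)) (by
    rintro _ ⟨F, hF, rfl⟩
    exact (Finset.card_insert_le a F).trans (hcard F hF))
  refine ⟨a, haU, b, hbV, fun F hF => Set.disjoint_left.mpr fun z hz hzF => ?_⟩
  rw [segment_eq_image_lineMap] at hz
  obtain ⟨t, -, rfl⟩ := hz
  have hzA := convexHull_subset_affineSpan (𝕜 := ℝ) (F : Set (Euc d)) hzF
  rcases eq_or_ne t 0 with rfl | ht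
  · rw [AffineMap.lineMap_apply_zero] at hzA
    exact ha F hF hzA
  · apply hb _ ⟨F, hF, rfl⟩
    have hle : affineSpan ℝ (F : Set (Euc d)) ≤ affineSpan ℝ ((insert a F : Finset (Euc d)) : Set (Euc d)) :=
      affineSpan_mono ℝ (by simp)
    have haA : a ∈ affineSpan ℝ ((insert a F : Finset (Euc d)) : Set (Euc d)) :=
      subset_affineSpan ℝ _ (by simp)
    have := AffineMap.lineMap_mem t⁻¹ haA (hle hzA)
    have e : AffineMap.lineMap a (AffineMap.lineMap a b t) t⁻¹ = b := by
      simp [AffineMap.lineMap_apply, smul_smul, inv_mul_cancel₀ ht]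
    rwa [e] at this

end Topology

/-! ### How elements meet along sides, and the boundary of the mesh -/

section MeshTopology

open scoped Classical
open Filter Topology

namespace Mesh

variable {d : ℕ} {K : Mesh d}

theorem Elem.isSimplex (T : K.Elem) : IsSimplex T.1 := ⟨K.indep T.2.1, T.2.2⟩

/-- The side of `T` opposite to the vertex `p`. -/
noncomputable def Elem.side (hd : 0 < d) (T : K.Elem) {p : Euc d} (hp : p ∈ T.1) : K.Side :=
  ⟨T.1.erase p, K.toSimplicialComplex.down_closed T.2.1 (Finset.erase_subset p T.1)
    (Finset.card_pos.mp (by rw [T.isSimplex.card_erase hp]; exact hd)), T.isSimplex.card_erase hp⟩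

theorem Side.exists_eq_erase (S : K.Side) {T : K.Elem} (h : S.1 ⊆ T.1) :
    ∃ p ∈ T.1, S.1 = T.1.erase p := by
  have hc : (T.1 \ S.1).card = 1 := by
    rw [Finset.card_sdiff_of_subset h, T.2.2, S.2.2]; omega
  obtain ⟨p, hp⟩ := Finset.card_eq_one.mp hc
  have hpm : p ∈ T.1 \ S.1 := hp ▸ Finset.mem_singleton_self p
  rw [Finset.mem_sdiff] at hpm
  refine ⟨p, hpm.1, Finset.eq_of_subset_of_card_le (fun q hq => ?_) ?_⟩
  · exact Finset.mem_erase.mpr ⟨fun h' => hpm.2 (h' ▸ hq), h hq⟩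
  · rw [T.isSimplex.card_erase hpm.1, S.2.2]

theorem mem_hull_inter {T T' : K.Elem} {x : Euc d} (h : x ∈ hull T.1) (h' : x ∈ hull T'.1) :
    x ∈ hull (T.1 ∩ T'.1) := by
  have := K.inter_subset_convexHull T.2.1 T'.2.1 ⟨h, h'⟩
  rwa [← Finset.coe_inter] at this

theorem inter_eq_side {S : K.Side} {T T' : K.Elem} (h : S.1 ⊆ T.1) (h' : S.1 ⊆ T'.1)
    (hne : T ≠ T') : T.1 ∩ T'.1 = S.1 := by
  refine (Finset.eq_of_subset_of_card_le (Finset.subset_inter h h') ?_).symm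
  rw [S.2.2]
  by_contra! hlt
  have hT : T.1 ∩ T'.1 = T.1 :=
    Finset.eq_of_subset_of_card_le Finset.inter_subset_left (by rw [T.2.2]; exact hlt)
  have hT' : T.1 ∩ T'.1 = T'.1 :=
    Finset.eq_of_subset_of_card_le Finset.inter_subset_right (by rw [T'.2.2]; exact hlt)
  exact hne (Subtype.ext (hT.symm.trans hT'))

theorem bary_eq_of_mem_side {T T' : K.Elem} {p : Euc d} {x q : Euc d} (hp : p ∈ T.1)
    (hsub : T.1.erase p ⊆ T'.1) (hx : x ∈ hull (T.1.erase p)) (hq : q ∈ T.1.erase p) :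
    bary T'.1 q x = bary T.1 q x := by
  have h0 := ((T.isSimplex.mem_hull_subset_iff (Finset.erase_subset p T.1)).mp hx).2 p hp
    (Finset.notMem_erase p _)
  rw [T.isSimplex.apply_eq_sum_bary (bary T'.1 q) x, ← Finset.add_sum_erase _ _ hp, h0, zero_smul,
    zero_add, Finset.sum_congr rfl fun r hr => by rw [T'.isSimplex.bary_apply (hsub hq) (hsub hr)]]
  simp only [smul_eq_mul, mul_ite, mul_one, mul_zero]
  rw [Finset.sum_ite_eq, if_pos hq]

/-- Two elements with a common side lie on different sides of it. -/
theorem bary_opposite_neg (hd : 0 < d) {T T' : K.Elem} (hne : T ≠ T') {p p' : Euc d} (hp : p ∈ T.1)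
    (hp' : p' ∈ T'.1) (hS : T.1.erase p = T'.1.erase p') : bary T.1 p p' < 0 := by
  have hT := T.isSimplex
  have hT' := T'.isSimplex
  by_contra! hge
  -- If the coordinate is zero, `p'` lies in the hyperplane of the common side, where its own
  -- coordinate in `T'` vanishes. If it is positive, points slightly off the side towards `p'` lie
  -- in both elements, hence by conformity in the side, where the coordinate is zero.
  rcases hge.eq_or_lt with h0 | hpos
  · have h1 : bary T'.1 p' p' = 1 := by rw [hT'.bary_apply hp' hp', if_pos rfl]
    rw [hT.apply_eq_sum_bary (bary T'.1 p') p', ← Finset.add_sum_erase _ _ hp, ← h0, zero_smul,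
      zero_add, Finset.sum_eq_zero] at h1
    · norm_num at h1
    · intro r hr
      rw [hS, Finset.mem_erase] at hr
      rw [hT'.bary_apply hp' hr.2, if_neg hr.1.symm, smul_zero]
  · obtain ⟨x, hx, hxpos⟩ := hT.exists_mem_hull_pos hd hp
    have hx0 := ((hT.mem_hull_subset_iff (Finset.erase_subset p T.1)).mp hx).2 p hp
      (Finset.notMem_erase p _)
    have hcont : ∀ q, Tendsto (fun t : ℝ => bary T.1 q (AffineMap.lineMap x p' t)) (𝓝[>] 0)
        (𝓝 (bary T.1 q x)) := by
      intro q
      have : Continuous (fun t : ℝ => bary T.1 q (AffineMap.lineMap x p' t)) :=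
        (continuous_bary T.1 q).comp AffineMap.lineMap_continuous
      simpa using (this.tendsto 0).mono_left (nhdsWithin_le_nhds (s := Set.Ioi 0))
    have h1 : ∀ᶠ t : ℝ in 𝓝[>] 0, ∀ q ∈ T.1.erase p, 0 < bary T.1 q (AffineMap.lineMap x p' t) :=
      (Filter.eventually_all_finset _).mpr fun q hq => (hcont q).eventually (lt_mem_nhds (hxpos q hq))
    have h2 : ∀ᶠ t : ℝ in 𝓝[>] 0, t ∈ Set.Ioc (0 : ℝ) 1 := Ioc_mem_nhdsGT one_pos
    obtain ⟨t, ht1, ht2⟩ := (h1.and h2).exists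
    set z : Euc d := AffineMap.lineMap x p' t with hz
    have hzp : bary T.1 p z = t * bary T.1 p p' := by
      rw [hz, IsSimplex.bary_lineMap, hx0]; ring
    have hzppos : 0 < bary T.1 p z := hzp ▸ mul_pos ht2.1 hpos
    have hzT : z ∈ hull T.1 := hT.mem_hull_iff.mpr fun q hq => by
      by_cases h : q = p
      · rw [h]; exact hzppos.le
      · exact (ht1 q (Finset.mem_erase.mpr ⟨h, hq⟩)).le
    have hzT' : z ∈ hull T'.1 := by
      refine (convex_convexHull ℝ _).lineMap_mem ?_ (subset_convexHull ℝ _ hp') ⟨ht2.1.le, ht2.2⟩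
      refine convexHull_mono ?_ hx
      rw [hS]; exact_mod_cast Finset.erase_subset p' T'.1
    have hzS := mem_hull_inter hzT hzT'
    rw [inter_eq_side (S := T.side hd hp) (Finset.erase_subset p T.1)
      (by change T.1.erase p ⊆ _; rw [hS]; exact Finset.erase_subset p' T'.1) hne] at hzS
    have := ((hT.mem_hull_subset_iff (Finset.erase_subset p T.1)).mp hzS).2 p hp
      (Finset.notMem_erase p _)
    linarith

/-- Both coordinates vanish on the common side, so they are proportional, and the factor is read off
at `p'`. -/
theorem bary_opposite_eq {T T' : K.Elem} {p p' : Euc d} (hp : p ∈ T.1)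
    (hp' : p' ∈ T'.1) (hS : T.1.erase p = T'.1.erase p') (x : Euc d) :
    bary T.1 p x = bary T.1 p p' * bary T'.1 p' x := by
  have : bary T.1 p = bary T.1 p p' • bary T'.1 p' := by
    refine T'.isSimplex.ext_affineMap fun q hq => ?_
    by_cases h : q = p'
    · subst h; simp [T'.isSimplex.bary_apply hq hq]
    · have hqS : q ∈ T.1.erase p := by rw [hS]; exact Finset.mem_erase.mpr ⟨h, hq⟩
      rw [Finset.mem_erase] at hqS
      simp [T'.isSimplex.bary_apply hp' hq, T.isSimplex.bary_apply hp hqS.2, Ne.symm h,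
        hqS.1.symm]
  conv_lhs => rw [this]
  simp

/-- The opposite vertices of three elements would lie pairwise on opposite sides of one hyperplane;
the proportionality of coordinates makes a product of two negative numbers negative. -/
theorem not_three_elems (hd : 0 < d) {S : K.Side} {T T' T'' : K.Elem} (h : S.1 ⊆ T.1)
    (h' : S.1 ⊆ T'.1) (h'' : S.1 ⊆ T''.1) (h1 : T ≠ T') (h2 : T ≠ T'') : T' = T'' := by
  by_contra h3
  obtain ⟨p, hp, hS⟩ := S.exists_eq_erase h
  obtain ⟨p', hp', hS'⟩ := S.exists_eq_erase h'
  obtain ⟨p'', hp'', hS''⟩ := S.exists_eq_erase h''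
  have e1 := bary_opposite_neg hd h1 hp hp' (hS ▸ hS')
  have e2 := bary_opposite_neg hd h2 hp hp'' (hS ▸ hS'')
  have e3 := bary_opposite_neg hd h3 hp' hp'' (hS' ▸ hS'')
  have := bary_opposite_eq hp hp' (hS ▸ hS') p''
  nlinarith [mul_pos_of_neg_of_neg e1 e3]

theorem mem_space_iff_elem {x : Euc d} : x ∈ K.space ↔ ∃ T : K.Elem, x ∈ hull T.1 := by
  rw [Geometry.SimplicialComplex.mem_space_iff]
  constructor
  · rintro ⟨s, hs, hx⟩
    obtain ⟨t, ht, hst, hc⟩ := K.pure s hs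
    exact ⟨⟨t, ht, hc⟩, convexHull_mono (by exact_mod_cast hst) hx⟩
  · rintro ⟨T, hT⟩
    exact ⟨T.1, T.2.1, hT⟩

/-- Close to `x` only the sign of the coordinate of `p` matters: nonnegative means the point is in
`T`, negative means that it is in `T'`. -/
theorem mem_interior_space (hd : 0 < d) {T T' : K.Elem} (hne : T ≠ T') {p : Euc d} (hp : p ∈ T.1)
    (hsub : T.1.erase p ⊆ T'.1) {x : Euc d} (hx : x ∈ hull (T.1.erase p))
    (hpos : ∀ q ∈ T.1.erase p, 0 < bary T.1 q x) : x ∈ interior K.space := by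
  obtain ⟨p', hp', hS⟩ := (T.side hd hp).exists_eq_erase (T := T') hsub
  change T.1.erase p = _ at hS
  have hneg := bary_opposite_neg hd hne hp hp' hS
  rw [mem_interior_iff_mem_nhds]
  have h1 : ∀ᶠ y in 𝓝 x, ∀ q ∈ T.1.erase p, 0 < bary T.1 q y :=
    (Filter.eventually_all_finset _).mpr fun q hq =>
      ((continuous_bary T.1 q).tendsto x).eventually (lt_mem_nhds (hpos q hq))
  have h2 : ∀ᶠ y in 𝓝 x, ∀ q ∈ T.1.erase p, 0 < bary T'.1 q y :=
    (Filter.eventually_all_finset _).mpr fun q hq =>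
      ((continuous_bary T'.1 q).tendsto x).eventually
        (lt_mem_nhds (by rw [bary_eq_of_mem_side hp hsub hx hq]; exact hpos q hq))
  filter_upwards [h1, h2] with y hy1 hy2
  rw [mem_space_iff_elem]
  rcases le_or_gt 0 (bary T.1 p y) with h | h
  · refine ⟨T, T.isSimplex.mem_hull_iff.mpr fun q hq => ?_⟩
    by_cases hqp : q = p
    · rw [hqp]; exact h
    · exact (hy1 q (Finset.mem_erase.mpr ⟨hqp, hq⟩)).le
  · refine ⟨T', T'.isSimplex.mem_hull_iff.mpr fun q hq => ?_⟩
    by_cases hqp : q = p'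
    · rw [hqp]
      rw [bary_opposite_eq hp hp' hS y] at h
      exact (pos_of_mul_neg_right h hneg.le).le
    · exact (hy2 q (by rw [hS]; exact Finset.mem_erase.mpr ⟨hqp, hq⟩)).le

variable {Ω : Set (Euc d)}

theorem interior_space (hreg : interior (closure Ω) = Ω) (hK : K.Triangulates Ω) :
    interior K.space = Ω := by
  rw [show K.space = closure Ω from hK, hreg]

theorem elem_eq_of_subset_frontier (hd : 0 < d) (hΩ : IsOpen Ω)
    (hreg : interior (closure Ω) = Ω) (hK : K.Triangulates Ω) {S : K.Side}
    (hS : hull S.1 ⊆ frontier Ω) {T T' : K.Elem} (h : S.1 ⊆ T.1) (h' : S.1 ⊆ T'.1) : T = T' := by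
  by_contra hne
  obtain ⟨p, hp, hSp⟩ := S.exists_eq_erase h
  obtain ⟨x, hx, hpos⟩ := T.isSimplex.exists_mem_hull_pos hd hp
  have hxi := mem_interior_space hd hne hp (hSp ▸ h') hx hpos
  rw [interior_space hreg hK] at hxi
  have hf := hS (hSp ▸ hx)
  rw [hΩ.frontier_eq] at hf
  exact hf.2 hxi

/-- If the side met `Ω`, some relative interior point `x` of it would lie in `Ω`, and so would the
points just beyond it, away from `p`. These belong to elements other than `T`; by closedness one
such element contains `x`, and conformity gives it the whole side. -/
theorem subset_frontier_of_unique (hd : 0 < d) (hΩ : IsOpen Ω)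
    (hK : K.Triangulates Ω) {S : K.Side} {T : K.Elem} (h : S.1 ⊆ T.1)
    (huniq : ∀ T' : K.Elem, S.1 ⊆ T'.1 → T' = T) : hull S.1 ⊆ frontier Ω := by
  have hT := T.isSimplex
  obtain ⟨p, hp, hSp⟩ := S.exists_eq_erase h
  intro c hc
  rw [hΩ.frontier_eq]
  refine ⟨?_, fun hcΩ => ?_⟩
  · rw [← show K.space = closure Ω from hK]
    exact Geometry.SimplicialComplex.convexHull_subset_space S.2.1 hc
  rw [hSp] at hc
  obtain ⟨x, hxΩ, hx, hpos⟩ := hT.exists_mem_open_hull_pos hd hp hΩ hc hcΩ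
  set C : Set (Euc d) := ⋃ T' ∈ {T' : K.Elem | T' ≠ T}, hull T'.1 with hC
  have hCclosed : IsClosed C :=
    (Set.toFinite _).isClosed_biUnion fun T' _ => isClosed_hull T'.1
  have hcont : Tendsto (fun t : ℝ => AffineMap.lineMap x p t) (𝓝[<] 0) (𝓝 x) := by
    have : Continuous (fun t : ℝ => (AffineMap.lineMap x p t : Euc d)) :=
      AffineMap.lineMap_continuous
    have h := (this.tendsto 0).mono_left (nhdsWithin_le_nhds (s := Set.Iio 0))
    simpa using h
  have hev : ∀ᶠ t : ℝ in 𝓝[<] 0, (AffineMap.lineMap x p t : Euc d) ∈ C := by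
    filter_upwards [hcont.eventually (hΩ.mem_nhds hxΩ), self_mem_nhdsWithin] with t ht ht0
    have hsp : (AffineMap.lineMap x p t : Euc d) ∈ K.space := by
      rw [show K.space = closure Ω from hK]; exact subset_closure ht
    obtain ⟨T', hT'⟩ := mem_space_iff_elem.mp hsp
    refine Set.mem_biUnion (x := T') ?_ hT'
    rintro rfl
    have h1 := T'.isSimplex.mem_hull_iff.mp hT' p hp
    have h2 := ((hT.mem_hull_subset_iff (Finset.erase_subset p _)).mp hx).2 p hp
      (Finset.notMem_erase p _)
    rw [IsSimplex.bary_lineMap, h2, hT.bary_apply hp hp, if_pos rfl] at h1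
    have : t < 0 := ht0
    linarith
  have hxC := hCclosed.mem_of_tendsto hcont hev
  simp only [hC, Set.mem_iUnion, Set.mem_ofPred_eq, exists_prop] at hxC
  obtain ⟨T', hne, hxT'⟩ := hxC
  refine hne (huniq T' fun q hq => ?_)
  rw [hSp] at hq
  have hxT : x ∈ hull T.1 := convexHull_mono (by exact_mod_cast Finset.erase_subset p T.1) hx
  by_contra hqT'
  have := ((hT.mem_hull_subset_iff Finset.inter_subset_left).mp (mem_hull_inter hxT hxT')).2 q
    (Finset.mem_of_mem_erase hq) (fun hmem => hqT' (Finset.mem_inter.mp hmem).2)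
  exact (hpos q hq).ne' this

/-- A property of elements that propagates across sides and holds for one element holds for all:
the elements of a triangulation of a domain are connected through sides. -/
theorem elem_induction (hconn : IsConnected Ω)
    (hΩ : IsOpen Ω) (hreg : interior (closure Ω) = Ω) (hK : K.Triangulates Ω) {P : K.Elem → Prop}
    (hP : ∀ (S : K.Side) (T T' : K.Elem), S.1 ⊆ T.1 → S.1 ⊆ T'.1 → P T → P T') {T₀ : K.Elem}
    (h₀ : P T₀) (T : K.Elem) : P T := by
  by_contra hT
  set A : Set (Euc d) := ⋃ T ∈ {T : K.Elem | P T}, hull T.1 with hA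
  set B : Set (Euc d) := ⋃ T ∈ {T : K.Elem | ¬ P T}, hull T.1 with hB
  have hAc : IsClosed A := (Set.toFinite _).isClosed_biUnion fun T' _ => isClosed_hull T'.1
  have hBc : IsClosed B := (Set.toFinite _).isClosed_biUnion fun T' _ => isClosed_hull T'.1
  have hcov : Ω ⊆ A ∪ B := by
    intro x hx
    have hsp : x ∈ K.space := by rw [show K.space = closure Ω from hK]; exact subset_closure hx
    obtain ⟨T', hT'⟩ := mem_space_iff_elem.mp hsp
    by_cases h : P T'
    · exact Or.inl (Set.mem_biUnion (x := T') h hT')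
    · exact Or.inr (Set.mem_biUnion (x := T') h hT')
  have hint : ∀ T : K.Elem, interior (hull T.1) ⊆ Ω := by
    intro T
    rw [← interior_space hreg hK]
    exact interior_mono (Geometry.SimplicialComplex.convexHull_subset_space T.2.1)
  -- Connectedness makes the closed unions `A` and `B` meet inside `Ω`, but perhaps only in a face
  -- of low dimension.
  obtain ⟨x, hxΩ, hxA, hxB⟩ : (Ω ∩ (A ∩ B)).Nonempty := by
    refine isPreconnected_closed_iff.mp hconn.isPreconnected A B hAc hBc hcov ?_ ?_
    · obtain ⟨x, hx⟩ := T₀.isSimplex.interior_hull_nonempty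
      exact ⟨x, hint T₀ hx, Set.mem_biUnion (x := T₀) h₀ (interior_subset hx)⟩
    · obtain ⟨x, hx⟩ := T.isSimplex.interior_hull_nonempty
      exact ⟨x, hint T hx, Set.mem_biUnion (x := T) hT (interior_subset hx)⟩
  simp only [hA, hB, Set.mem_iUnion, Set.mem_ofPred_eq, exists_prop] at hxA hxB
  obtain ⟨T₁, hP₁, hx₁⟩ := hxA
  obtain ⟨T₂, hP₂, hx₂⟩ := hxB
  obtain ⟨ε, hε, hball⟩ := Metric.isOpen_iff.mp hΩ x hxΩ
  have hne : ∀ T' : K.Elem, x ∈ hull T'.1 → (Metric.ball x ε ∩ interior (hull T'.1)).Nonempty := by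
    intro T' hT'
    rw [← T'.isSimplex.closure_interior_hull] at hT'
    exact mem_closure_iff.mp hT' _ Metric.isOpen_ball (Metric.mem_ball_self hε)
  -- A generic short segment near `x` passes from `A` to `B` avoiding faces with fewer than `d`
  -- vertices, so where it crosses, the two elements share a side or coincide.
  obtain ⟨a, ⟨ha, ha'⟩, b, ⟨hb, hb'⟩, hdisj⟩ :=
    exists_segment_disjoint (Metric.isOpen_ball.inter isOpen_interior)
      (Metric.isOpen_ball.inter isOpen_interior) (hne T₁ hx₁) (hne T₂ hx₂)
      (𝓕 := {F | F ∈ K.faces ∧ F.card < d}) (K.finite_faces.subset fun _ h => h.1) fun _ h => h.2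
  have hsegΩ : segment ℝ a b ⊆ Ω := ((convex_ball x ε).segment_subset ha hb).trans hball
  obtain ⟨z, hz, hzA, hzB⟩ : (segment ℝ a b ∩ (A ∩ B)).Nonempty := by
    refine isPreconnected_closed_iff.mp (convex_segment a b).isPreconnected A B hAc hBc
      (hsegΩ.trans hcov) ?_ ?_
    · exact ⟨a, left_mem_segment ℝ a b, Set.mem_biUnion (x := T₁) hP₁ (interior_subset ha')⟩
    · exact ⟨b, right_mem_segment ℝ a b, Set.mem_biUnion (x := T₂) hP₂ (interior_subset hb')⟩
  simp only [hA, hB, Set.mem_iUnion, Set.mem_ofPred_eq, exists_prop] at hzA hzB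
  obtain ⟨T₃, hP₃, hz₃⟩ := hzA
  obtain ⟨T₄, hP₄, hz₄⟩ := hzB
  have hzF := mem_hull_inter hz₃ hz₄
  have hFne : (T₃.1 ∩ T₄.1).Nonempty := by
    have : (hull (T₃.1 ∩ T₄.1)).Nonempty := ⟨z, hzF⟩
    rwa [hull, convexHull_nonempty_iff, Finset.coe_nonempty] at this
  have hFface : T₃.1 ∩ T₄.1 ∈ K.faces :=
    K.toSimplicialComplex.down_closed T₃.2.1 Finset.inter_subset_left hFne
  have hFcard : d ≤ (T₃.1 ∩ T₄.1).card := by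
    by_contra! hlt
    exact Set.disjoint_left.mp (hdisj _ ⟨hFface, hlt⟩) hz hzF
  rcases Nat.eq_or_lt_of_le hFcard with heq | hlt
  · exact hP₄ (hP ⟨_, hFface, heq.symm⟩ T₃ T₄ Finset.inter_subset_left Finset.inter_subset_right hP₃)
  · have hT₃ : T₃.1 ∩ T₄.1 = T₃.1 :=
      Finset.eq_of_subset_of_card_le Finset.inter_subset_left (by rw [T₃.2.2]; exact hlt)
    have hT₄ : T₃.1 ∩ T₄.1 = T₄.1 :=
      Finset.eq_of_subset_of_card_le Finset.inter_subset_right (by rw [T₄.2.2]; exact hlt)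
    have : T₃ = T₄ := Subtype.ext (hT₃.symm.trans hT₄)
    exact hP₄ (this ▸ hP₃)

/-- The boundary of the domain is covered by boundary sides. -/
theorem exists_bdry_side_mem (hd : 0 < d) (hΩ : IsOpen Ω) (hreg : interior (closure Ω) = Ω)
    (hK : K.Triangulates Ω) {x : Euc d} (hx : x ∈ frontier Ω) :
    ∃ S : K.Side, hull S.1 ⊆ frontier Ω ∧ x ∈ hull S.1 := by
  set C : Set (Euc d) := ⋃ S ∈ {S : K.Side | hull S.1 ⊆ frontier Ω}, hull S.1 with hC
  have hCclosed : IsClosed C := (Set.toFinite _).isClosed_biUnion fun S _ => isClosed_hull S.1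
  suffices hxC : x ∈ C by
    simp only [hC, Set.mem_iUnion, Set.mem_ofPred_eq, exists_prop] at hxC
    exact hxC
  -- The union of boundary sides is closed, so it suffices to find a point of it in every ball
  -- around `x`.
  rw [← hCclosed.closure_eq, Metric.mem_closure_iff]
  intro ε hε
  have hspace : K.space = closure Ω := hK
  have hxs : x ∈ K.space := by rw [hspace]; exact frontier_subset_closure hx
  have hxΩ : x ∉ interior K.space := by
    rw [interior_space hreg hK]; rw [hΩ.frontier_eq] at hx; exact hx.2
  obtain ⟨T, hxT⟩ := mem_space_iff_elem.mp hxs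
  have hU : (Metric.ball x ε ∩ interior (hull T.1)).Nonempty := by
    rw [← T.isSimplex.closure_interior_hull] at hxT
    exact mem_closure_iff.mp hxT _ Metric.isOpen_ball (Metric.mem_ball_self hε)
  have hclosed : IsClosed K.space := by rw [hspace]; exact isClosed_closure
  have hV : (Metric.ball x ε ∩ K.spaceᶜ).Nonempty := by
    have : x ∈ closure K.spaceᶜ := by rw [closure_compl]; exact hxΩ
    exact mem_closure_iff.mp this _ Metric.isOpen_ball (Metric.mem_ball_self hε)
  obtain ⟨a, ⟨ha, ha'⟩, b, ⟨hb, hb'⟩, hdisj⟩ :=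
    exists_segment_disjoint (Metric.isOpen_ball.inter isOpen_interior)
      (Metric.isOpen_ball.inter hclosed.isOpen_compl) hU hV
      (𝓕 := {F | F ∈ K.faces ∧ F.card < d}) (K.finite_faces.subset fun _ h => h.1) fun _ h => h.2
  -- The generic segment leaves the mesh at `z`. Since it misses all faces with fewer than `d`
  -- vertices, `z` is in the relative interior of a side, and a second element there would make `z`
  -- interior.
  obtain ⟨z, hz, hzf⟩ : (segment ℝ a b ∩ frontier K.space).Nonempty := by
    rw [frontier_eq_closure_inter_closure]
    refine isPreconnected_closed_iff.mp (convex_segment a b).isPreconnected _ _ isClosed_closure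
      isClosed_closure (fun z _ => ?_) ?_ ?_
    · exact (em (z ∈ K.space)).imp (fun h => subset_closure h) fun h => subset_closure h
    · exact ⟨a, left_mem_segment ℝ a b, subset_closure
        (Geometry.SimplicialComplex.convexHull_subset_space T.2.1 (interior_subset ha'))⟩
    · exact ⟨b, right_mem_segment ℝ a b, subset_closure hb'⟩
  have hzi : z ∉ interior K.space := hzf.2
  obtain ⟨T₁, hzT⟩ := mem_space_iff_elem.mp (hclosed.frontier_subset hzf)
  have hT₁ := T₁.isSimplex
  have hz0 := hT₁.mem_hull_iff.mp hzT
  obtain ⟨p, hp, hzp⟩ : ∃ p ∈ T₁.1, bary T₁.1 p z ≤ 0 := by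
    by_contra! hcon
    exact hzi (interior_mono (Geometry.SimplicialComplex.convexHull_subset_space T₁.2.1)
      (hT₁.mem_interior_hull_iff.mpr hcon))
  have hzp : bary T₁.1 p z = 0 := le_antisymm hzp (hz0 p hp)
  have hzS : z ∈ hull (T₁.1.erase p) :=
    (hT₁.mem_hull_subset_iff (Finset.erase_subset p _)).mpr ⟨hz0, fun r hr hrp => by
      have : r = p := by by_contra h; exact hrp (Finset.mem_erase.mpr ⟨h, hr⟩)
      rw [this, hzp]⟩
  have hpos : ∀ q ∈ T₁.1.erase p, 0 < bary T₁.1 q z := by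
    intro q hq
    by_contra! hle
    have hzq : bary T₁.1 q z = 0 := le_antisymm hle (hz0 q (Finset.mem_of_mem_erase hq))
    have hsub : (T₁.1.erase p).erase q ⊆ T₁.1 :=
      (Finset.erase_subset q _).trans (Finset.erase_subset p _)
    have hzF : z ∈ hull ((T₁.1.erase p).erase q) :=
      (hT₁.mem_hull_subset_iff hsub).mpr ⟨hz0, fun r hr hrp => by
        by_cases h1 : r = p
        · rw [h1, hzp]
        · by_cases h2 : r = q
          · rw [h2, hzq]
          · exact absurd (Finset.mem_erase.mpr ⟨h2, Finset.mem_erase.mpr ⟨h1, hr⟩⟩) hrp⟩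
    have hFne : ((T₁.1.erase p).erase q).Nonempty := by
      have : (hull ((T₁.1.erase p).erase q)).Nonempty := ⟨z, hzF⟩
      rwa [hull, convexHull_nonempty_iff, Finset.coe_nonempty] at this
    have hFface := K.toSimplicialComplex.down_closed T₁.2.1 hsub hFne
    refine Set.disjoint_left.mp (hdisj _ ⟨hFface, ?_⟩) hz hzF
    rw [Finset.card_erase_of_mem hq, hT₁.card_erase hp]; omega
  have hbd : hull (T₁.side hd hp).1 ⊆ frontier Ω := by
    refine subset_frontier_of_unique hd hΩ hK (T := T₁) (Finset.erase_subset p _) fun T' hT' => ?_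
    by_contra hne
    exact hzi (mem_interior_space hd (Ne.symm hne) hp hT' hzS hpos)
  refine ⟨z, Set.mem_biUnion (x := T₁.side hd hp) hbd hzS, ?_⟩
  rw [dist_comm]
  exact (convex_ball x ε).segment_subset ha hb hz

theorem elemOf_subset (S : K.Side) : S.1 ⊆ (K.elemOf S).1 :=
  (K.pure S.1 S.2.1).choose_spec.2.1

/-- A point of `Γ_I` lies on some boundary side, and by relative openness `Γ_I` also contains a
relative interior point of that side. Disjointness then rules out `Γ_D` and `Γ_N`. -/
theorem exists_bdrySide_of_nonempty (hd : 0 < d) (hΩ : IsOpen Ω) (hreg : interior (closure Ω) = Ω)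
    (hK : K.Triangulates Ω) {ΓI ΓD ΓN : Set (Euc d)} (hΓ : IsBoundarySplit Ω ΓI ΓD ΓN)
    (hΓI : ΓI.Nonempty) (hKΓ : K.Resolves Ω ΓI ΓD ΓN) : Nonempty (K.BdrySide Ω ΓI) := by
  obtain ⟨x, hx⟩ := hΓI
  obtain ⟨U, hU, hUeq⟩ := hΓ.openI
  have hxU : x ∈ U ∩ frontier Ω := hUeq ▸ hx
  obtain ⟨S, hS, hxS⟩ := exists_bdry_side_mem hd hΩ hreg hK hxU.2
  obtain ⟨p, hp, hSp⟩ := S.exists_eq_erase (elemOf_subset S)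
  rw [hSp] at hxS
  obtain ⟨z, hzU, hz, hpos⟩ := (K.elemOf S).isSimplex.exists_mem_open_hull_pos hd hp hU hxS hxU.1
  have hzi := (K.elemOf S).isSimplex.mem_intrinsicInterior_hull hp hz hpos
  rw [← hSp] at hzi hz
  have hzI : z ∈ ΓI := by rw [hUeq]; exact ⟨hzU, hS hz⟩
  rcases hKΓ S hS with h | h | h
  · exact ⟨⟨S, hS, h⟩⟩
  · exact absurd (h hzi) (Set.disjoint_left.mp hΓ.disjID hzI)
  · exact absurd (h hzi) (Set.disjoint_left.mp hΓ.disjIN hzI)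

end Mesh

end MeshTopology

/-! ### Crouzeix–Raviart and Raviart–Thomas fields on the mesh -/

section Discrete

open scoped Classical

namespace Mesh

variable {d : ℕ} {K : Mesh d}

noncomputable instance : Fintype K.Side := Fintype.ofFinite _

/-- The `d`-dimensional volume of an element. -/
noncomputable def Elem.vol (T : K.Elem) : ℝ := volume.real (hull T.1)

/-- The surface measure of a side. -/
noncomputable def Side.area (S : K.Side) : ℝ := (surf d).real (hull S.1)

theorem Elem.vol_pos (T : K.Elem) : 0 < T.vol := T.isSimplex.volume_pos

theorem Side.area_pos (hd : 0 < d) (S : K.Side) : 0 < S.area :=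
  hausdorff_hull_pos (K.indep S.2.1) (by rw [S.2.2]; omega)

theorem setAverage_side (hd : 0 < d) (S : K.Side) {F : Type*} [NormedAddCommGroup F]
    [NormedSpace ℝ F] [CompleteSpace F] (φ : Euc d →ᵃ[ℝ] F) :
    ⨍ x in hull S.1, φ x ∂(surf d) = (d : ℝ)⁻¹ • ∑ p ∈ S.1, φ p := by
  have h := setAverage_affineMap_hull (k := d - 1) (K.indep S.2.1) (by rw [S.2.2]; omega) φ
  have hd' : ((d - 1 : ℕ) : ℝ) + 1 = d := by
    rw [Nat.cast_sub hd]; simp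
  rwa [hd'] at h

theorem innerΩ_eq {F : Type*} [NormedAddCommGroup F] [InnerProductSpace ℝ F] (v w : K.Elem → F) :
    K.innerΩ v w = ∑ T, T.vol * ⟪v T, w T⟫_ℝ := by
  simp [innerΩ, Elem.vol]

theorem normSqΩ_eq {F : Type*} [NormedAddCommGroup F] [InnerProductSpace ℝ F] (v : K.Elem → F) :
    K.normSqΩ v = K.innerΩ v v := by
  simp [innerΩ, normSqΩ]

theorem innerΓ_eq {Ω Γ : Set (Euc d)} (a b : K.BdrySide Ω Γ → ℝ) :
    K.innerΓ a b = ∑ S, S.1.area * (a S * b S) := by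
  simp [innerΓ, Side.area]

theorem normOneΓ_eq {Ω Γ : Set (Euc d)} (a : K.BdrySide Ω Γ → ℝ) :
    K.normOneΓ a = ∑ S, S.1.area * |a S| := by
  simp [normOneΓ, Side.area]

theorem proj_apply {F : Type*} [NormedAddCommGroup F] [NormedSpace ℝ F] [CompleteSpace F]
    (v : K.Elem → (Euc d →ᵃ[ℝ] F)) (T : K.Elem) :
    K.proj v T = ((d : ℝ) + 1)⁻¹ • ∑ p ∈ T.1, v T p :=
  T.isSimplex.setAverage_hull (v T)

/-- The mean value of a Crouzeix–Raviart function on an arbitrary side. -/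
noncomputable def mean (v : K.CR) (S : K.Side) : ℝ :=
  ⨍ x in hull S.1, v.1 (K.elemOf S) x ∂(surf d)

/-- The mean normal component of an element-wise affine vector field on a side of an element. -/
noncomputable def flux (y : K.Elem → (Euc d →ᵃ[ℝ] Euc d)) (T : K.Elem) (S : K.Side) : ℝ :=
  ⨍ x in hull S.1, ⟪y T x, outwardNormal T.1 S.1⟫_ℝ ∂(surf d)

theorem sideMean_eq {Ω Γ : Set (Euc d)} (v : K.CR) (S : K.BdrySide Ω Γ) :
    K.sideMean v S = mean v S.1 := rfl

theorem normalTrace_eq {Ω Γ : Set (Euc d)} (y : K.RT) (S : K.BdrySide Ω Γ) :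
    K.normalTrace y S = flux y.1 (K.elemOf S.1) S.1 := rfl

/-- The mean of an affine function over a side is the average of its vertex values, so membership is
a finite condition. The case `T = T'` may be included since it is trivial. -/
theorem mem_CR_iff (hd : 0 < d) {v : K.Elem → (Euc d →ᵃ[ℝ] ℝ)} :
    v ∈ K.CR ↔ ∀ (S : K.Side) (T T' : K.Elem), S.1 ⊆ T.1 → S.1 ⊆ T'.1 →
      ∑ p ∈ S.1, v T p = ∑ p ∈ S.1, v T' p := by
  have hd0 : (d : ℝ) ≠ 0 := by exact_mod_cast hd.ne'
  have key : ∀ (S : K.Side) (T T' : K.Elem), ⨍ x in hull S.1, (v T x - v T' x) ∂(surf d)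
      = (d : ℝ)⁻¹ * (∑ p ∈ S.1, v T p - ∑ p ∈ S.1, v T' p) := by
    intro S T T'
    have := setAverage_side hd S (v T - v T')
    simpa [Finset.sum_sub_distrib] using this
  constructor
  · intro h S T T' hT hT'
    by_cases hne : T = T'
    · rw [hne]
    · have := h S T T' hT hT' hne
      rw [key] at this
      have := (mul_eq_zero.mp this).resolve_left (inv_ne_zero hd0)
      linarith
  · intro h S T T' hT hT' _
    rw [key, h S T T' hT hT', sub_self, mul_zero]

theorem mean_eq (hd : 0 < d) (v : K.CR) {S : K.Side} {T : K.Elem} (h : S.1 ⊆ T.1) :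
    mean v S = (d : ℝ)⁻¹ * ∑ p ∈ S.1, v.1 T p := by
  rw [mean, setAverage_side hd S, smul_eq_mul,
    (mem_CR_iff hd).mp v.2 S (K.elemOf S) T (elemOf_subset S) h]

/-- There is a Crouzeix–Raviart function with prescribed mean values on the sides. -/
theorem exists_CR_mean_eq (hd : 0 < d) (a : K.Side → ℝ) : ∃ v : K.CR, ∀ S, mean v S = a S := by
  have hd0 : (d : ℝ) ≠ 0 := by exact_mod_cast hd.ne'
  let A : Finset (Euc d) → ℝ := fun S => if h : S ∈ K.faces ∧ S.card = d then a ⟨S, h⟩ else 0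
  have hA : ∀ S : K.Side, A S.1 = a S := fun S => dif_pos S.2
  -- `1 - d * bary T p` is the Crouzeix–Raviart basis function: mean one on the side opposite to
  -- `p`, mean zero on the other sides of `T`.
  let v : K.Elem → (Euc d →ᵃ[ℝ] ℝ) := fun T =>
    ∑ p ∈ T.1, A (T.1.erase p) • (AffineMap.const ℝ (Euc d) (1 : ℝ) - (d : ℝ) • bary T.1 p)
  have hsum : ∀ (S : K.Side) (T : K.Elem), S.1 ⊆ T.1 → ∑ q ∈ S.1, v T q = d * a S := by
    intro S T h
    obtain ⟨p, hp, hS⟩ := S.exists_eq_erase h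
    have hv : ∀ q ∈ T.1, v T q = ∑ r ∈ T.1, A (T.1.erase r) - d * A (T.1.erase q) := by
      intro q hq
      have h1 : v T q = ∑ r ∈ T.1, A (T.1.erase r) * (1 - d * bary T.1 r q) := by
        have hs : ∀ (s : Finset (Euc d)) (φ : Euc d → (Euc d →ᵃ[ℝ] ℝ)),
            (∑ r ∈ s, φ r) q = ∑ r ∈ s, φ r q := fun s φ => by
          induction s using Finset.induction_on with
          | empty => simp
          | insert r s hr ih => simp [Finset.sum_insert hr, ih]
        simp [v, hs]
      rw [h1, Finset.sum_congr rfl fun r hr => by rw [T.isSimplex.bary_apply hr hq]]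
      simp only [mul_sub, mul_one, Finset.sum_sub_distrib, mul_ite, mul_zero]
      rw [Finset.sum_ite_eq', if_pos hq, mul_comm]
    rw [← hA S, hS, Finset.sum_congr rfl fun q hq => hv q (Finset.mem_of_mem_erase hq),
      Finset.sum_sub_distrib, Finset.sum_const, T.isSimplex.card_erase hp, ← Finset.mul_sum,
      ← Finset.add_sum_erase _ _ hp, nsmul_eq_mul]
    ring
  have hmem : v ∈ K.CR := (mem_CR_iff hd).mpr fun S T T' h h' => by rw [hsum S T h, hsum S T' h']
  refine ⟨⟨v, hmem⟩, fun S => ?_⟩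
  rw [mean_eq hd ⟨v, hmem⟩ (elemOf_subset S), hsum S _ (elemOf_subset S)]
  field_simp

/-- The normal components of `y` are constant on the sides of each element. -/
def HasConstFlux (y : K.Elem → (Euc d →ᵃ[ℝ] Euc d)) : Prop :=
  ∀ (T : K.Elem), ∀ p ∈ T.1, ∃ c, ∀ q ∈ T.1, q ≠ p → ⟪affGrad (bary T.1 p), y T q⟫_ℝ = c

theorem HasConstFlux.inner_eq_flux (hd : 0 < d) {y : K.Elem → (Euc d →ᵃ[ℝ] Euc d)}
    (hy : HasConstFlux y) {T : K.Elem} {S : K.Side} (h : S.1 ⊆ T.1) {x : Euc d}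
    (hx : x ∈ hull S.1) : ⟪y T x, outwardNormal T.1 S.1⟫_ℝ = flux y T S := by
  have hd0 : (d : ℝ) ≠ 0 := by exact_mod_cast hd.ne'
  obtain ⟨p, hp, hS⟩ := S.exists_eq_erase h
  obtain ⟨c, hc⟩ := hy T p hp
  set n := outwardNormal T.1 S.1 with hn
  let φ : Euc d →ᵃ[ℝ] ℝ := (innerSL ℝ n).toLinearMap.toAffineMap.comp (y T)
  have hφ : ∀ z, φ z = ⟪y T z, n⟫_ℝ := fun z => by
    simp [φ, real_inner_comm]
  set c' := -(‖affGrad (bary T.1 p)‖⁻¹ * c) with hc'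
  have hv : ∀ q ∈ S.1, φ q = c' := by
    intro q hq
    rw [hS, Finset.mem_erase] at hq
    rw [hφ, hn, hS, T.isSimplex.outwardNormal_erase hd hp, inner_neg_right, real_inner_smul_right,
      real_inner_comm, hc q hq.2 hq.1]
  have hx' : φ x = c' := by
    have hsub : hull S.1 ⊆ φ ⁻¹' {c'} :=
      convexHull_min (fun q hq => hv q hq) ((convex_singleton c').affine_preimage φ)
    exact hsub hx
  have hf : flux y T S = c' := by
    rw [flux]
    simp_rw [← hn, ← hφ]
    rw [setAverage_side hd S φ, Finset.sum_congr rfl hv, Finset.sum_const, S.2.2, smul_eq_mul,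
      nsmul_eq_mul]
    field_simp
  rw [← hφ, hx', hf]

theorem HasConstFlux.inner_affGrad (hd : 0 < d) {y : K.Elem → (Euc d →ᵃ[ℝ] Euc d)}
    (hy : HasConstFlux y) {T : K.Elem} {p q : Euc d} (hp : p ∈ T.1) (hq : q ∈ T.1) (hqp : q ≠ p) :
    ⟪affGrad (bary T.1 p), y T q⟫_ℝ
      = -((T.side hd hp).area * flux y T (T.side hd hp) / (d * T.vol)) := by
  have hd0 : (d : ℝ) ≠ 0 := by exact_mod_cast hd.ne'
  have hv := T.vol_pos.ne'
  have h1 := hy.inner_eq_flux hd (S := T.side hd hp) (Finset.erase_subset p T.1)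
    (subset_convexHull ℝ _ (Finset.mem_coe.mpr (Finset.mem_erase.mpr ⟨hqp, hq⟩)))
  have h2 := T.isSimplex.surf_mul_inner_outwardNormal hd hp (y T q)
  change (T.side hd hp).area * ⟪y T q, outwardNormal T.1 (T.side hd hp).1⟫_ℝ = -(d * T.vol * _) at h2
  rw [h1] at h2
  rw [h2]
  field_simp

theorem RT.hasConstFlux (hd : 0 < d) (y : K.RT) : HasConstFlux y.1 := by
  intro T p hp
  obtain ⟨c, hc⟩ := y.2.1 T (T.side hd hp) (Finset.erase_subset p T.1)
  have hG := norm_ne_zero_iff.mpr (T.isSimplex.affGrad_bary_ne_zero hd hp)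
  refine ⟨-(‖affGrad (bary T.1 p)‖ * c), fun q hq hqp => ?_⟩
  have h1 := hc q (subset_convexHull ℝ _ (Finset.mem_coe.mpr (Finset.mem_erase.mpr ⟨hqp, hq⟩)))
  change ⟪y.1 T q, outwardNormal T.1 (T.1.erase p)⟫_ℝ = c at h1
  rw [T.isSimplex.outwardNormal_erase hd hp, inner_neg_right, real_inner_smul_right,
    real_inner_comm] at h1
  rw [← h1]
  field_simp

theorem HasConstFlux.mem_RT (hd : 0 < d) {y : K.Elem → (Euc d →ᵃ[ℝ] Euc d)} (hy : HasConstFlux y)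
    (h : ∀ (S : K.Side) (T T' : K.Elem), S.1 ⊆ T.1 → S.1 ⊆ T'.1 → T ≠ T' →
      flux y T S + flux y T' S = 0) : y ∈ K.RT :=
  ⟨fun T S hS => ⟨flux y T S, fun _ hx => hy.inner_eq_flux hd hS hx⟩,
    fun S T T' hS hS' hne x hx => by
      rw [hy.inner_eq_flux hd hS hx, hy.inner_eq_flux hd hS' hx, h S T T' hS hS' hne]⟩

theorem RT.flux_add_flux (hd : 0 < d) (y : K.RT) {S : K.Side} {T T' : K.Elem} (h : S.1 ⊆ T.1)
    (h' : S.1 ⊆ T'.1) (hne : T ≠ T') : flux y.1 T S + flux y.1 T' S = 0 := by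
  obtain ⟨x, hx⟩ : (hull S.1).Nonempty := by
    rw [hull, convexHull_nonempty_iff, Finset.coe_nonempty]
    exact K.toSimplicialComplex.nonempty_of_mem_faces S.2.1
  rw [← (RT.hasConstFlux hd y).inner_eq_flux hd h hx,
    ← (RT.hasConstFlux hd y).inner_eq_flux hd h' hx]
  exact y.2.2 S T T' h h' hne x hx

theorem sum_attach_side (hd : 0 < d) (T : K.Elem) (F : K.Side → ℝ) :
    ∑ p ∈ T.1.attach, F (T.side hd p.2) = ∑ S : K.Side with S.1 ⊆ T.1, F S := by
  refine Finset.sum_bij (fun p _ => T.side hd p.2) ?_ ?_ ?_ (fun _ _ => rfl)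
  · intro p _
    exact Finset.mem_filter.mpr ⟨Finset.mem_univ _, Finset.erase_subset p.1 T.1⟩
  · intro p _ q _ h
    have h' : T.1.erase p.1 = T.1.erase q.1 := congrArg Subtype.val h
    by_contra hne
    have : p.1 ∈ T.1.erase q.1 := Finset.mem_erase.mpr ⟨fun h => hne (Subtype.ext h), p.2⟩
    rw [← h'] at this
    exact Finset.notMem_erase _ _ this
  · intro S hS
    obtain ⟨p, hp, hSp⟩ := S.exists_eq_erase (T := T) (by simpa using hS)
    exact ⟨⟨p, hp⟩, Finset.mem_attach _ _, Subtype.ext hSp.symm⟩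

theorem HasConstFlux.integration_by_parts_elem (hd : 0 < d) {y : K.Elem → (Euc d →ᵃ[ℝ] Euc d)}
    (hy : HasConstFlux y) (v : K.CR) (T : K.Elem) :
    T.vol * ⟪K.gradh v T, K.proj y T⟫_ℝ + T.vol * (affDiv (y T) * K.proj v.1 T)
      = ∑ S : K.Side with S.1 ⊆ T.1, S.area * (flux y T S * mean v S) := by
  have hd0 : (d : ℝ) ≠ 0 := by exact_mod_cast hd.ne'
  have hvol := T.vol_pos.ne'
  let c : Euc d → ℝ := fun p => if hp : p ∈ T.1 then
    -((T.side hd hp).area * flux y T (T.side hd hp) / (d * T.vol)) else 0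
  have hcp : ∀ p (hp : p ∈ T.1),
      c p = -((T.side hd hp).area * flux y T (T.side hd hp) / (d * T.vol)) :=
    fun p hp => dif_pos hp
  have h := T.isSimplex.integration_by_parts (c := c) (y := y T) (fun p hp q hq hqp => by
    rw [hcp p hp]; exact hy.inner_affGrad hd hp hq hqp) (v.1 T)
  rw [← proj_apply, ← proj_apply] at h
  change ⟪K.gradh v T, K.proj y T⟫_ℝ + _ = _ at h
  rw [← mul_add, h, ← sum_attach_side hd T, ← Finset.sum_attach, mul_neg, Finset.mul_sum,
    ← Finset.sum_neg_distrib]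
  refine Finset.sum_congr rfl fun p _ => ?_
  rw [hcp p p.2, mean_eq hd v (S := T.side hd p.2) (Finset.erase_subset p.1 T.1)]
  change -(T.vol * (_ * ∑ q ∈ T.1.erase p, _)) = _ * (_ * (_ * ∑ q ∈ T.1.erase p, _))
  field_simp

theorem HasConstFlux.integration_by_parts (hd : 0 < d) {y : K.Elem → (Euc d →ᵃ[ℝ] Euc d)}
    (hy : HasConstFlux y) (v : K.CR) :
    K.innerΩ (K.gradh v) (K.proj y) + K.innerΩ (fun T => affDiv (y T)) (K.proj v.1)
      = ∑ S : K.Side, S.area * mean v S * ∑ T : K.Elem with S.1 ⊆ T.1, flux y T S := by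
  rw [innerΩ_eq, innerΩ_eq, ← Finset.sum_add_distrib]
  have : ∀ T : K.Elem, T.vol * ⟪K.gradh v T, K.proj y T⟫_ℝ + T.vol * ⟪affDiv (y T), K.proj v.1 T⟫_ℝ
      = ∑ S : K.Side, if S.1 ⊆ T.1 then S.area * (flux y T S * mean v S) else 0 := by
    intro T
    rw [← Finset.sum_filter, ← hy.integration_by_parts_elem hd v T]
    simp [mul_comm]
  rw [Finset.sum_congr rfl fun T _ => this T, Finset.sum_comm]
  refine Finset.sum_congr rfl fun S _ => ?_
  rw [← Finset.sum_filter, Finset.mul_sum]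
  exact Finset.sum_congr rfl fun T _ => by ring

variable {Ω : Set (Euc d)}

theorem filter_elem_of_bdry (hd : 0 < d) (hΩ : IsOpen Ω) (hreg : interior (closure Ω) = Ω)
    (hK : K.Triangulates Ω) {S : K.Side} (hS : hull S.1 ⊆ frontier Ω) :
    (Finset.univ.filter fun T : K.Elem => S.1 ⊆ T.1) = {K.elemOf S} := by
  ext T
  simp only [Finset.mem_filter, Finset.mem_univ, true_and, Finset.mem_singleton]
  exact ⟨fun h => elem_eq_of_subset_frontier hd hΩ hreg hK hS h (elemOf_subset S),
    fun h => h ▸ elemOf_subset S⟩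

theorem exists_filter_elem_of_not_bdry (hd : 0 < d) (hΩ : IsOpen Ω)
    (hK : K.Triangulates Ω) {S : K.Side} (hS : ¬ hull S.1 ⊆ frontier Ω) :
    ∃ T' : K.Elem, K.elemOf S ≠ T' ∧ S.1 ⊆ T'.1 ∧
      (Finset.univ.filter fun T : K.Elem => S.1 ⊆ T.1) = {K.elemOf S, T'} := by
  obtain ⟨T', hT', hne⟩ : ∃ T' : K.Elem, S.1 ⊆ T'.1 ∧ T' ≠ K.elemOf S := by
    by_contra! hcon
    exact hS (subset_frontier_of_unique hd hΩ hK (elemOf_subset S) hcon)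
  refine ⟨T', hne.symm, hT', ?_⟩
  ext T
  simp only [Finset.mem_filter, Finset.mem_univ, true_and, Finset.mem_insert,
    Finset.mem_singleton]
  refine ⟨fun h => ?_, ?_⟩
  · by_cases h1 : T = K.elemOf S
    · exact Or.inl h1
    · exact Or.inr (not_three_elems hd (elemOf_subset S) h hT' (Ne.symm h1) hne.symm)
  · rintro (rfl | rfl)
    · exact elemOf_subset S
    · exact hT'

theorem RT.sum_flux (hd : 0 < d) (hΩ : IsOpen Ω) (hreg : interior (closure Ω) = Ω)
    (hK : K.Triangulates Ω) (y : K.RT) (S : K.Side) :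
    ∑ T : K.Elem with S.1 ⊆ T.1, flux y.1 T S
      = if hull S.1 ⊆ frontier Ω then flux y.1 (K.elemOf S) S else 0 := by
  split_ifs with hS
  · rw [filter_elem_of_bdry hd hΩ hreg hK hS, Finset.sum_singleton]
  · obtain ⟨T', hne, hT', hf⟩ := exists_filter_elem_of_not_bdry hd hΩ hK hS
    rw [hf, Finset.sum_pair hne, RT.flux_add_flux hd y (elemOf_subset S) hT' hne]

/-- A field of element-wise mean values whose weak divergence is represented by element-wise and
side-wise constants is the projection of a Raviart–Thomas field. -/
theorem exists_RT_of_forall (hd : 0 < d) (hΩ : IsOpen Ω) (hreg : interior (closure Ω) = Ω)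
    (hK : K.Triangulates Ω) (p : K.Elem → Euc d) (f : K.Elem → ℝ) (r : K.Side → ℝ)
    (h : ∀ v : K.CR, K.innerΩ p (K.gradh v) = K.innerΩ f (K.proj v.1)
      + ∑ S : K.Side with hull S.1 ⊆ frontier Ω, S.area * (r S * mean v S)) :
    ∃ y : K.RT, K.proj y.1 = p ∧ K.divh y = -f ∧
      ∀ S : K.Side, hull S.1 ⊆ frontier Ω → flux y.1 (K.elemOf S) S = r S := by
  -- Mean and divergence are imposed element by element; only the continuity of normal components
  -- remains to be shown.
  choose y hy1 hy2 hy3 using fun T : K.Elem =>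
    T.isSimplex.exists_affineMap_mean_affDiv hd (p T) (f T)
  have hy : HasConstFlux y := hy3
  have hproj : K.proj y = p := funext fun T => by rw [proj_apply]; exact hy1 T
  have hdiv : (fun T => affDiv (y T)) = -f := funext hy2
  -- Testing with the function of mean one on `S` and zero on all other sides isolates the total
  -- flux through `S`: zero for an interior side, `r S` on the boundary.
  have htest : ∀ S : K.Side, ∑ T : K.Elem with S.1 ⊆ T.1, flux y T S
      = if hull S.1 ⊆ frontier Ω then r S else 0 := by
    intro S
    obtain ⟨v, hv⟩ := exists_CR_mean_eq (K := K) hd (fun S' => if S' = S then 1 else 0)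
    have h1 := hy.integration_by_parts hd v
    have h2 := h v
    rw [hproj, hdiv] at h1
    have h3 : K.innerΩ (-f) (K.proj v.1) = -K.innerΩ f (K.proj v.1) := by
      simp [innerΩ_eq]
    have h4 : K.innerΩ (K.gradh v) p = K.innerΩ p (K.gradh v) := by
      simp_rw [innerΩ_eq, real_inner_comm]
    rw [h3, h4, h2, Finset.sum_filter] at h1
    simp only [hv] at h1
    rw [Finset.sum_eq_single S (fun S' _ hne => by simp [hne]) (fun h => absurd (Finset.mem_univ S) h),
      Finset.sum_eq_single S (fun S' _ hne => by simp [hne]) (fun h => absurd (Finset.mem_univ S) h)] at h1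
    simp only [if_true, mul_one] at h1
    have hpos := S.area_pos hd
    have h5 : S.area * ∑ T : K.Elem with S.1 ⊆ T.1, flux y T S
        = S.area * if hull S.1 ⊆ frontier Ω then r S else 0 := by
      rw [← h1, mul_ite, mul_zero]; ring
    exact mul_left_cancel₀ hpos.ne' h5
  have hmem : y ∈ K.RT := by
    refine hy.mem_RT hd fun S T T' hT hT' hne => ?_
    have hS : ¬ hull S.1 ⊆ frontier Ω := fun hS =>
      hne (elem_eq_of_subset_frontier hd hΩ hreg hK hS hT hT')
    have hfil : (Finset.univ.filter fun T : K.Elem => S.1 ⊆ T.1) = {T, T'} := by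
      ext T''
      simp only [Finset.mem_filter, Finset.mem_univ, true_and, Finset.mem_insert,
        Finset.mem_singleton]
      refine ⟨fun h => ?_, ?_⟩
      · by_cases h1 : T'' = T
        · exact Or.inl h1
        · exact Or.inr (not_three_elems hd hT h hT' (Ne.symm h1) hne)
      · rintro (rfl | rfl) <;> assumption
    have := htest S
    rwa [hfil, Finset.sum_pair hne, if_neg hS] at this
  refine ⟨⟨y, hmem⟩, hproj, hdiv, fun S hS => ?_⟩
  have := htest S
  rwa [filter_elem_of_bdry hd hΩ hreg hK hS, Finset.sum_singleton, if_pos hS] at this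

theorem RT.ext_of_proj_of_divh (hd : 0 < d) {y y' : K.RT} (hp : K.proj y.1 = K.proj y'.1)
    (hdiv : K.divh y = K.divh y') : y = y' := by
  refine Subtype.ext (funext fun T => ?_)
  have h1 := RT.hasConstFlux hd y
  have h2 := RT.hasConstFlux hd y'
  choose! c hc using fun p (hp : p ∈ T.1) => h1 T p hp
  choose! c' hc' using fun p (hp : p ∈ T.1) => h2 T p hp
  have hpT := congrFun hp T
  rw [proj_apply, proj_apply] at hpT
  exact T.isSimplex.eq_of_mean_eq_of_affDiv_eq hd hc hc' hpT (congrFun hdiv T)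

end Mesh

end Discrete

/-! ### Existence of constrained minimizers by coercivity -/

section Minimization

open Filter Topology

/-- A coercive functional, the sum of a definite `2`-homogeneous continuous function of `N v` and a
linear functional, attains its minimum under affine constraints. -/
theorem exists_minimizer_of_homogeneous {V Z W : Type*} [AddCommGroup V] [Module ℝ V]
    [NormedAddCommGroup Z] [NormedSpace ℝ Z] [FiniteDimensional ℝ Z]
    [NormedAddCommGroup W] [NormedSpace ℝ W]
    (N : V →ₗ[ℝ] Z) (hN : Function.Injective N) {Q : Z → ℝ} (hQ : Continuous Q)
    (hQ2 : ∀ (t : ℝ) z, Q (t • z) = t ^ 2 * Q z) (hQpos : ∀ z, z ≠ 0 → 0 < Q z)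
    (l : V →ₗ[ℝ] ℝ) (C : V →ₗ[ℝ] W) {v₀ : V} {w : W} (hv₀ : C v₀ = w) :
    ∃ u, C u = w ∧ ∀ v, C v = w → Q (N u) - l u ≤ Q (N v) - l v := by
  have hQ0 : Q 0 = 0 := by simpa using hQ2 0 0
  -- By homogeneity `c` is the minimum of `Q` on the unit sphere; if the sphere is empty, `Z` is
  -- trivial and any constant works.
  obtain ⟨c, hc, hcQ⟩ : ∃ c : ℝ, 0 < c ∧ ∀ z, c * ‖z‖ ^ 2 ≤ Q z := by
    have hz : ∀ z : Z, z ≠ 0 → Q z = ‖z‖ ^ 2 * Q (‖z‖⁻¹ • z) := fun z hz => by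
      have := norm_ne_zero_iff.mpr hz
      rw [← hQ2, smul_smul, mul_inv_cancel₀ this, one_smul]
    rcases (Metric.sphere (0 : Z) 1).eq_empty_or_nonempty with he | hne
    · refine ⟨1, one_pos, fun z => ?_⟩
      have : z = 0 := by
        by_contra h
        have hmem : ‖z‖⁻¹ • z ∈ Metric.sphere (0 : Z) 1 := by
          simp [norm_smul, inv_mul_cancel₀ (norm_ne_zero_iff.mpr h)]
        rw [he] at hmem
        exact hmem
      simp [this, hQ0]
    · have : ProperSpace Z := FiniteDimensional.proper ℝ Z
      obtain ⟨z₁, hz₁, hmin⟩ := (isCompact_sphere (0 : Z) 1).exists_isMinOn hne hQ.continuousOn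
      have hz₁0 : z₁ ≠ 0 := by rintro rfl; simp at hz₁
      refine ⟨Q z₁, hQpos z₁ hz₁0, fun z => ?_⟩
      by_cases h : z = 0
      · simp [h, hQ0]
      · rw [hz z h, mul_comm]
        refine mul_le_mul_of_nonneg_left (hmin ?_) (by positivity)
        simp [norm_smul, inv_mul_cancel₀ (norm_ne_zero_iff.mpr h)]
  -- `V` carries no topology, so the problem is moved to the finite-dimensional range of `N`.
  let e := LinearEquiv.ofInjective N hN
  let R := LinearMap.range N
  have : ProperSpace R := FiniteDimensional.proper ℝ R
  let l' : R →L[ℝ] ℝ := LinearMap.toContinuousLinearMap (l ∘ₗ e.symm.toLinearMap)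
  let C' : R →L[ℝ] W := LinearMap.toContinuousLinearMap (C ∘ₗ e.symm.toLinearMap)
  let F : R → ℝ := fun z => Q z - l' z
  have hF : Continuous F := by fun_prop
  have hclosed : IsClosed {z : R | C' z = w} := isClosed_eq C'.continuous continuous_const
  have hl' : ∀ v, l' (e v) = l v := fun v => by simp [l']
  have hC' : ∀ v, C' (e v) = C v := fun v => by simp [C']
  have hev : ∀ᶠ z in cocompact R ⊓ 𝓟 {z : R | C' z = w}, F (e v₀) ≤ F z := by
    refine Eventually.filter_mono inf_le_left ?_
    -- Beyond this radius `c ‖z‖²` dominates `(‖l'‖ + |F (e v₀)|) ‖z‖`, and `‖z‖ ≥ 1` turns the last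
    -- term into a bound for `F (e v₀)`.
    have h1 := (tendsto_norm_cocompact_atTop (E := R)).eventually
      (eventually_ge_atTop (max 1 ((‖l'‖ + |F (e v₀)|) / c)))
    filter_upwards [h1] with z hz
    have hz1 : 1 ≤ ‖z‖ := (le_max_left _ _).trans hz
    have hz2 : ‖l'‖ + |F (e v₀)| ≤ ‖z‖ * c := (div_le_iff₀ hc).mp ((le_max_right _ _).trans hz)
    have h2 : l' z ≤ ‖l'‖ * ‖z‖ := (le_abs_self _).trans (l'.le_opNorm z)
    have h3 : c * ‖z‖ ^ 2 ≤ Q z := hcQ z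
    have h4 := le_abs_self (F (e v₀))
    have h5 : |F (e v₀)| * 1 ≤ |F (e v₀)| * ‖z‖ := mul_le_mul_of_nonneg_left hz1 (abs_nonneg _)
    have h6 := mul_le_mul_of_nonneg_right hz2 (norm_nonneg z)
    change _ ≤ Q z - l' z
    nlinarith
  obtain ⟨z, hz, hmin⟩ := hF.continuousOn.exists_isMinOn' hclosed
    (show C' (e v₀) = w by rw [hC', hv₀]) hev
  refine ⟨e.symm z, ?_, fun v hv => ?_⟩
  · rw [← hC', e.apply_symm_apply]; exact hz
  · have h1 : F z ≤ F (e v) := hmin (show C' (e v) = w by rw [hC', hv])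
    have h2 : N (e.symm z) = z := by
      rw [← LinearEquiv.ofInjective_apply (h := hN) N, e.apply_symm_apply]
    have h3 : l (e.symm z) = l' z := by rw [← hl', e.apply_symm_apply]
    rw [h2, h3]
    change Q z - l' z ≤ Q (e v) - l' (e v) at h1
    rw [hl'] at h1
    exact h1

end Minimization

/-! ### Linear structure, global integration by parts, and definiteness -/

section Linear

open scoped Classical

namespace Mesh

variable {d : ℕ} {K : Mesh d}

/-- The standing assumptions on the domain, its boundary parts and the triangulation. -/
structure IsAdmissible (K : Mesh d) (Ω ΓI ΓD ΓN : Set (Euc d)) : Prop where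
  pos : 0 < d
  isOpen : IsOpen Ω
  isConnected : IsConnected Ω
  regular : interior (closure Ω) = Ω
  split : IsBoundarySplit Ω ΓI ΓD ΓN
  nonempty : ΓI.Nonempty
  triangulates : K.Triangulates Ω
  resolves : K.Resolves Ω ΓI ΓD ΓN

variable {Ω ΓI ΓD ΓN : Set (Euc d)}

theorem mean_linear (hd : 0 < d) (S : K.Side) :
    ∃ M : K.CR →ₗ[ℝ] ℝ, ∀ v, M v = mean v S := by
  refine ⟨{ toFun := fun v => mean v S, map_add' := fun v w => ?_, map_smul' := fun c v => ?_ },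
    fun v => rfl⟩
  · simp only [mean_eq hd _ (elemOf_subset S), Submodule.coe_add, Pi.add_apply, AffineMap.coe_add,
      Finset.sum_add_distrib, mul_add]
  · simp only [mean_eq hd _ (elemOf_subset S), Submodule.coe_smul, Pi.smul_apply,
      AffineMap.coe_smul, smul_eq_mul, ← Finset.mul_sum, RingHom.id_apply]
    ring

theorem mean_add (hd : 0 < d) (v w : K.CR) (S : K.Side) :
    mean (v + w) S = mean v S + mean w S := by
  obtain ⟨M, hM⟩ := mean_linear (K := K) hd S
  simp only [← hM, map_add]

theorem mean_smul (hd : 0 < d) (c : ℝ) (v : K.CR) (S : K.Side) :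
    mean (c • v) S = c * mean v S := by
  obtain ⟨M, hM⟩ := mean_linear (K := K) hd S
  simp only [← hM, map_smul, smul_eq_mul]

theorem mean_sum (hd : 0 < d) {ι : Type*} (s : Finset ι) (v : ι → K.CR) (S : K.Side) :
    mean (∑ i ∈ s, v i) S = ∑ i ∈ s, mean (v i) S := by
  obtain ⟨M, hM⟩ := mean_linear (K := K) hd S
  simp only [← hM, map_sum]

/-- The side-wise mean values as a linear map. -/
noncomputable def sideMeanLin (hd : 0 < d) (Ω Γ : Set (Euc d)) :
    K.CR →ₗ[ℝ] (K.BdrySide Ω Γ → ℝ) where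
  toFun v := K.sideMean v
  map_add' v w := funext fun S => mean_add hd v w S.1
  map_smul' c v := funext fun S => mean_smul hd c v S.1

theorem sideMean_add (hd : 0 < d) {Γ : Set (Euc d)} (v w : K.CR) :
    (K.sideMean (v + w) : K.BdrySide Ω Γ → ℝ) = K.sideMean v + K.sideMean w :=
  map_add (sideMeanLin hd Ω Γ) v w

theorem sideMean_smul (hd : 0 < d) {Γ : Set (Euc d)} (c : ℝ) (v : K.CR) :
    (K.sideMean (c • v) : K.BdrySide Ω Γ → ℝ) = c • K.sideMean v :=
  map_smul (sideMeanLin hd Ω Γ) c v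

theorem proj_add (v w : K.CR) : K.proj (v + w).1 = K.proj v.1 + K.proj w.1 := by
  funext T
  simp only [proj_apply, Pi.add_apply, Submodule.coe_add, AffineMap.coe_add,
    Finset.sum_add_distrib, smul_add]

theorem proj_smul (c : ℝ) (v : K.CR) : K.proj (c • v).1 = c • K.proj v.1 := by
  funext T
  simp only [proj_apply, Pi.smul_apply, Submodule.coe_smul, AffineMap.coe_smul,
    ← Finset.smul_sum, smul_comm c]

section Inner

variable {F : Type*} [NormedAddCommGroup F] [InnerProductSpace ℝ F]

theorem innerΩ_add_right (u v w : K.Elem → F) :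
    K.innerΩ u (v + w) = K.innerΩ u v + K.innerΩ u w := by
  simp [innerΩ_eq, inner_add_right, mul_add, Finset.sum_add_distrib]

theorem innerΩ_smul_right (c : ℝ) (u v : K.Elem → F) :
    K.innerΩ u (c • v) = c * K.innerΩ u v := by
  simp [innerΩ_eq, real_inner_smul_right, Finset.mul_sum, mul_left_comm]

theorem innerΩ_comm (u v : K.Elem → F) : K.innerΩ u v = K.innerΩ v u := by
  simp [innerΩ_eq, real_inner_comm]

theorem innerΩ_neg_left (u v : K.Elem → F) : K.innerΩ (-u) v = -K.innerΩ u v := by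
  simp [innerΩ_eq]

theorem innerΩ_self_nonneg (u : K.Elem → F) : 0 ≤ K.innerΩ u u := by
  rw [innerΩ_eq]
  exact Finset.sum_nonneg fun T _ => mul_nonneg T.vol_pos.le real_inner_self_nonneg

theorem innerΩ_self_eq_zero {u : K.Elem → F} (h : K.innerΩ u u = 0) : u = 0 := by
  rw [innerΩ_eq, Finset.sum_eq_zero_iff_of_nonneg
    (fun T _ => mul_nonneg T.vol_pos.le real_inner_self_nonneg)] at h
  funext T
  have := (mul_eq_zero.mp (h T (Finset.mem_univ T))).resolve_left T.vol_pos.ne'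
  exact inner_self_eq_zero.mp this

theorem innerΩ_sub_self (u v : K.Elem → F) :
    K.innerΩ (u - v) (u - v) = K.innerΩ u u - 2 * K.innerΩ u v + K.innerΩ v v := by
  simp only [innerΩ_eq, Finset.mul_sum, ← Finset.sum_sub_distrib, ← Finset.sum_add_distrib]
  refine Finset.sum_congr rfl fun T _ => ?_
  rw [Pi.sub_apply, real_inner_sub_sub_self]
  ring

end Inner

theorem innerΓ_add_right {Γ : Set (Euc d)} (a b c : K.BdrySide Ω Γ → ℝ) :
    K.innerΓ a (b + c) = K.innerΓ a b + K.innerΓ a c := by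
  simp only [innerΓ_eq, ← Finset.sum_add_distrib]
  exact Finset.sum_congr rfl fun S _ => by simp only [Pi.add_apply]; ring

theorem innerΓ_smul_right {Γ : Set (Euc d)} (t : ℝ) (a b : K.BdrySide Ω Γ → ℝ) :
    K.innerΓ a (t • b) = t * K.innerΓ a b := by
  simp only [innerΓ_eq, Finset.mul_sum]
  exact Finset.sum_congr rfl fun S _ => by simp only [Pi.smul_apply, smul_eq_mul]; ring

theorem innerΓ_zero_right {Γ : Set (Euc d)} (a : K.BdrySide Ω Γ → ℝ) : K.innerΓ a 0 = 0 := by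
  simp [innerΓ_eq]

theorem innerΓ_sub_left {Γ : Set (Euc d)} (a b c : K.BdrySide Ω Γ → ℝ) :
    K.innerΓ (a - b) c = K.innerΓ a c - K.innerΓ b c := by
  simp only [innerΓ_eq, ← Finset.sum_sub_distrib]
  exact Finset.sum_congr rfl fun S _ => by simp only [Pi.sub_apply]; ring

theorem innerΓ_self_pos (hd : 0 < d) {Γ : Set (Euc d)} {a : K.BdrySide Ω Γ → ℝ} (ha : a ≠ 0) :
    0 < K.innerΓ a a := by
  obtain ⟨S, hS⟩ := Function.ne_iff.mp ha
  rw [innerΓ_eq]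
  refine Finset.sum_pos' (fun S _ => mul_nonneg (S.1.area_pos hd).le (mul_self_nonneg _))
    ⟨S, Finset.mem_univ S, mul_pos (S.1.area_pos hd) (mul_self_pos.mpr hS)⟩

theorem normOneΓ_nonneg {Γ : Set (Euc d)} (a : K.BdrySide Ω Γ → ℝ) : 0 ≤ K.normOneΓ a := by
  rw [normOneΓ_eq]
  exact Finset.sum_nonneg fun S _ => mul_nonneg measureReal_nonneg (abs_nonneg _)

theorem normOneΓ_add_le {Γ : Set (Euc d)} (a b : K.BdrySide Ω Γ → ℝ) :
    K.normOneΓ (a + b) ≤ K.normOneΓ a + K.normOneΓ b := by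
  simp only [normOneΓ_eq, ← Finset.sum_add_distrib, ← mul_add]
  exact Finset.sum_le_sum fun S _ => mul_le_mul_of_nonneg_left (abs_add_le _ _) measureReal_nonneg

theorem normOneΓ_smul {Γ : Set (Euc d)} (t : ℝ) (a : K.BdrySide Ω Γ → ℝ) :
    K.normOneΓ (t • a) = |t| * K.normOneΓ a := by
  simp only [normOneΓ_eq, Finset.mul_sum, Pi.smul_apply, smul_eq_mul, abs_mul]
  exact Finset.sum_congr rfl fun S _ => by ring

theorem intrinsicInterior_side_nonempty (S : K.Side) :
    (intrinsicInterior ℝ (hull S.1)).Nonempty := by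
  refine Set.Nonempty.intrinsicInterior (convex_convexHull ℝ _) ?_
  rw [hull, convexHull_nonempty_iff, Finset.coe_nonempty]
  exact K.toSimplicialComplex.nonempty_of_mem_faces S.2.1

theorem not_mem_bdrySide_of_disjoint {Γ Γ' : Set (Euc d)} (h : Disjoint Γ Γ') {S : K.Side}
    (hS : intrinsicInterior ℝ (hull S.1) ⊆ Γ) : ¬ intrinsicInterior ℝ (hull S.1) ⊆ Γ' := by
  intro hS'
  obtain ⟨x, hx⟩ := intrinsicInterior_side_nonempty S
  exact Set.disjoint_left.mp h (hS hx) (hS' hx)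

namespace IsAdmissible

theorem nonempty_bdrySide (h : K.IsAdmissible Ω ΓI ΓD ΓN) : Nonempty (K.BdrySide Ω ΓI) :=
  exists_bdrySide_of_nonempty h.pos h.isOpen h.regular h.triangulates h.split h.nonempty h.resolves

/-- Each boundary side belongs to some part by `Resolves`, and to only one: its relative interior is
nonempty and the parts are disjoint. -/
theorem sum_bdry (h : K.IsAdmissible Ω ΓI ΓD ΓN) (F : K.Side → ℝ) :
    ∑ S : K.Side with hull S.1 ⊆ frontier Ω, F S
      = ∑ S : K.BdrySide Ω ΓI, F S.1 + ∑ S : K.BdrySide Ω ΓD, F S.1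
        + ∑ S : K.BdrySide Ω ΓN, F S.1 := by
  have key : ∀ Γ : Set (Euc d), ∑ S : K.BdrySide Ω Γ, F S.1 = ∑ S : K.Side,
      if hull S.1 ⊆ frontier Ω ∧ intrinsicInterior ℝ (hull S.1) ⊆ Γ then F S else 0 := by
    intro Γ
    rw [← Finset.sum_filter]
    exact (Finset.sum_subtype _ (fun S => by simp) F).symm
  rw [key, key, key, Finset.sum_filter, ← Finset.sum_add_distrib, ← Finset.sum_add_distrib]
  refine Finset.sum_congr rfl fun S _ => ?_
  by_cases hS : hull S.1 ⊆ frontier Ω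
  · rcases h.resolves S hS with h1 | h1 | h1
    · simp [hS, h1, not_mem_bdrySide_of_disjoint h.split.disjID h1,
        not_mem_bdrySide_of_disjoint h.split.disjIN h1]
    · simp [hS, h1, not_mem_bdrySide_of_disjoint h.split.disjID.symm h1,
        not_mem_bdrySide_of_disjoint h.split.disjDN h1]
    · simp [hS, h1, not_mem_bdrySide_of_disjoint h.split.disjIN.symm h1,
        not_mem_bdrySide_of_disjoint h.split.disjDN.symm h1]
  · simp [hS]

/-- The discrete integration by parts formula. -/
theorem integration_by_parts (h : K.IsAdmissible Ω ΓI ΓD ΓN) (v : K.CR) (y : K.RT) :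
    K.innerΩ (K.gradh v) (K.proj y.1) + K.innerΩ (K.divh y) (K.proj v.1)
      = K.innerΓ (K.normalTrace y : K.BdrySide Ω ΓI → ℝ) (K.sideMean v)
        + K.innerΓ (K.normalTrace y : K.BdrySide Ω ΓD → ℝ) (K.sideMean v)
        + K.innerΓ (K.normalTrace y : K.BdrySide Ω ΓN → ℝ) (K.sideMean v) := by
  have h1 := (RT.hasConstFlux h.pos y).integration_by_parts h.pos v
  simp only [RT.sum_flux h.pos h.isOpen h.regular h.triangulates y] at h1
  change _ + K.innerΩ (K.divh y) _ = _ at h1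
  have h2 := h.sum_bdry fun S => S.area * (flux y.1 (K.elemOf S) S * mean v S)
  simp only [innerΓ_eq, normalTrace_eq, sideMean_eq]
  rw [h1, ← h2, Finset.sum_filter]
  refine Finset.sum_congr rfl fun S _ => ?_
  split_ifs <;> ring

theorem exists_CR_sideMean_eq (h : K.IsAdmissible Ω ΓI ΓD ΓN) (aI : K.BdrySide Ω ΓI → ℝ)
    (aD : K.BdrySide Ω ΓD → ℝ) (aN : K.BdrySide Ω ΓN → ℝ) :
    ∃ v : K.CR, K.sideMean v = aI ∧ K.sideMean v = aD ∧ K.sideMean v = aN := by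
  obtain ⟨v, hv⟩ := exists_CR_mean_eq (K := K) h.pos fun S =>
    if hI : hull S.1 ⊆ frontier Ω ∧ intrinsicInterior ℝ (hull S.1) ⊆ ΓI then aI ⟨S, hI⟩ else
    if hD : hull S.1 ⊆ frontier Ω ∧ intrinsicInterior ℝ (hull S.1) ⊆ ΓD then aD ⟨S, hD⟩ else
    if hN : hull S.1 ⊆ frontier Ω ∧ intrinsicInterior ℝ (hull S.1) ⊆ ΓN then aN ⟨S, hN⟩ else 0
  refine ⟨v, funext fun S => ?_, funext fun S => ?_, funext fun S => ?_⟩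
  · rw [sideMean_eq, hv, dif_pos S.2]
  · rw [sideMean_eq, hv, dif_neg, dif_pos S.2]
    exact fun hI => not_mem_bdrySide_of_disjoint h.split.disjID hI.2 S.2.2
  · rw [sideMean_eq, hv, dif_neg, dif_neg, dif_pos S.2]
    · exact fun hD => not_mem_bdrySide_of_disjoint h.split.disjDN hD.2 S.2.2
    · exact fun hI => not_mem_bdrySide_of_disjoint h.split.disjIN hI.2 S.2.2

/-- An element-wise constant field `p` whose weak divergence plus `f` vanishes on all
Crouzeix–Raviart functions with vanishing boundary means is the projection of a Raviart–Thomas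
field with divergence `-f`. -/
theorem exists_RT_of_forall_bdry_zero (h : K.IsAdmissible Ω ΓI ΓD ΓN) (p : K.Elem → Euc d)
    (f : K.Elem → ℝ)
    (hp : ∀ v : K.CR, (∀ S : K.Side, hull S.1 ⊆ frontier Ω → mean v S = 0) →
      K.innerΩ p (K.gradh v) = K.innerΩ f (K.proj v.1)) :
    ∃ y : K.RT, K.proj y.1 = p ∧ K.divh y = -f := by
  choose φ hφ using fun S : K.Side =>
    exists_CR_mean_eq (K := K) h.pos (fun S' => if S' = S then 1 else 0)
  let L : K.CR →ₗ[ℝ] ℝ :=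
    { toFun := fun v => K.innerΩ p (K.gradh v) - K.innerΩ f (K.proj v.1)
      map_add' := fun v w => by
        rw [map_add, proj_add, innerΩ_add_right, innerΩ_add_right]; ring
      map_smul' := fun c v => by
        rw [map_smul, proj_smul, innerΩ_smul_right, innerΩ_smul_right, RingHom.id_apply,
          smul_eq_mul]; ring }
  have hL : ∀ v, L v = K.innerΩ p (K.gradh v) - K.innerΩ f (K.proj v.1) := fun v => rfl
  -- Subtracting from `v` the combination `w` of boundary basis functions with the same boundary
  -- means leaves a function on which the residual `L` vanishes. So `L` depends on the boundary
  -- means only, with density `L (φ S) / S.area`.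
  obtain ⟨y, hy1, hy2, -⟩ := exists_RT_of_forall h.pos h.isOpen h.regular h.triangulates p f
    (fun S => L (φ S) / S.area) (fun v => by
      set w : K.CR := ∑ S : K.Side with hull S.1 ⊆ frontier Ω, mean v S • φ S with hw
      have hzero : L (v + (-1 : ℝ) • w) = 0 := by
        rw [hL, sub_eq_zero]
        refine hp _ fun S hS => ?_
        rw [mean_add h.pos, mean_smul h.pos, hw, mean_sum h.pos]
        simp only [mean_smul h.pos, hφ, mul_ite, mul_one, mul_zero]
        rw [Finset.sum_ite_eq, if_pos (by simpa using hS)]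
        ring
      rw [map_add, map_smul, hw, map_sum, hL, smul_eq_mul] at hzero
      have e : ∑ S : K.Side with hull S.1 ⊆ frontier Ω, S.area * (L (φ S) / S.area * mean v S)
          = ∑ S : K.Side with hull S.1 ⊆ frontier Ω, L (mean v S • φ S) := by
        refine Finset.sum_congr rfl fun S _ => ?_
        have := (S.area_pos h.pos).ne'
        rw [map_smul, smul_eq_mul]
        field_simp
      rw [e]
      linarith)
  exact ⟨y, hy1, hy2⟩

/-- A zero gradient makes `v` constant on each element. The constant is zero next to a side of
`Γ_I`, and equality of side means carries this to all elements. -/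
theorem eq_zero_of_gradh_eq_zero (h : K.IsAdmissible Ω ΓI ΓD ΓN) {v : K.CR} (hg : K.gradh v = 0)
    (hI : (K.sideMean v : K.BdrySide Ω ΓI → ℝ) = 0) : v = 0 := by
  obtain ⟨S₀⟩ := h.nonempty_bdrySide
  have hd0 : (d : ℝ) ≠ 0 := by exact_mod_cast h.pos.ne'
  have hconst : ∀ (T : K.Elem) (x y : Euc d), v.1 T x = v.1 T y := by
    intro T x y
    have h1 := affGrad_inner_sub (v.1 T) x y
    have h2 : affGrad (v.1 T) = 0 := congrFun hg T
    rw [h2, inner_zero_left] at h1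
    linarith
  have hzero : ∀ (S : K.Side) (T : K.Elem), ∑ p ∈ S.1, v.1 T p = 0 → ∀ x, v.1 T x = 0 := by
    intro S T hs x
    rw [Finset.sum_congr rfl fun p _ => hconst T p x, Finset.sum_const, S.2.2, nsmul_eq_mul] at hs
    exact (mul_eq_zero.mp hs).resolve_left hd0
  have hall : ∀ T : K.Elem, ∀ x, v.1 T x = 0 := by
    intro T
    refine elem_induction (P := fun T => ∀ x, v.1 T x = 0) h.isConnected h.isOpen h.regular
      h.triangulates (fun S T T' hT hT' hP => hzero S T' ?_) (T₀ := K.elemOf S₀.1) ?_ T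
    · rw [← (mem_CR_iff h.pos).mp v.2 S T T' hT hT']
      exact Finset.sum_eq_zero fun p _ => hP p
    · refine hzero S₀.1 _ ?_
      have h1 : mean v S₀.1 = 0 := congrFun hI S₀
      rw [mean_eq h.pos v (elemOf_subset S₀.1)] at h1
      exact (mul_eq_zero.mp h1).resolve_left (inv_ne_zero hd0)
  refine Subtype.ext (funext fun T => ?_)
  ext x
  simpa using hall T x

end IsAdmissible

end Mesh

end Linear

/-! ### Duality gap, variational inequality, and strong duality -/

section Duality

open scoped Classical

namespace Mesh

variable {d : ℕ} {K : Mesh d} {Ω ΓI ΓD ΓN : Set (Euc d)}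

section BoundaryConjugate

variable {Γ : Set (Euc d)} {m : ℝ}

theorem abs_le_normInfΓ (r : K.BdrySide Ω Γ → ℝ) (S : K.BdrySide Ω Γ) : |r S| ≤ K.normInfΓ r :=
  le_ciSup (f := fun S => |r S|) (Set.finite_range _).bddAbove S

/-- Young's inequality for the squared `L¹` and `L^∞` norms on a boundary part. -/
theorem neg_innerΓ_le (hm : 0 < m) (r a : K.BdrySide Ω Γ → ℝ) :
    -K.innerΓ r a ≤ m / 2 * K.normInfΓ r ^ 2 + 1 / (2 * m) * K.normOneΓ a ^ 2 := by
  have h1 : -K.innerΓ r a ≤ K.normInfΓ r * K.normOneΓ a := by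
    rw [innerΓ_eq, normOneΓ_eq, Finset.mul_sum, ← Finset.sum_neg_distrib]
    refine Finset.sum_le_sum fun S _ => ?_
    have h2 : -(r S * a S) ≤ K.normInfΓ r * |a S| :=
      (neg_le_abs _).trans (by
        rw [abs_mul]; exact mul_le_mul_of_nonneg_right (abs_le_normInfΓ r S) (abs_nonneg _))
    have h3 : 0 ≤ S.1.area := measureReal_nonneg
    nlinarith [mul_le_mul_of_nonneg_left h2 h3]
  -- Young's inequality as a completed square.
  have h2 : m / 2 * K.normInfΓ r ^ 2 + 1 / (2 * m) * K.normOneΓ a ^ 2 - K.normInfΓ r * K.normOneΓ a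
      = 1 / (2 * m) * (m * K.normInfΓ r - K.normOneΓ a) ^ 2 := by
    field_simp; ring
  have h3 : 0 ≤ 1 / (2 * m) * (m * K.normInfΓ r - K.normOneΓ a) ^ 2 := by positivity
  linarith

/-- Equality in Hölder's inequality: `a` is concentrated on one side where `|r|` is maximal, with
sign opposite to `r`. Dividing by the area gives it `L¹` norm `m ‖r‖_∞`, which is equality in
Young's inequality. -/
theorem exists_neg_innerΓ_eq (hd : 0 < d) (hm : 0 < m) [Nonempty (K.BdrySide Ω Γ)]
    (r : K.BdrySide Ω Γ → ℝ) :
    ∃ a, -K.innerΓ r a = m / 2 * K.normInfΓ r ^ 2 + 1 / (2 * m) * K.normOneΓ a ^ 2 := by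
  obtain ⟨S₀, hS₀⟩ := Finite.exists_max fun S => |r S|
  have hinf : K.normInfΓ r = |r S₀| :=
    le_antisymm (ciSup_le hS₀) (abs_le_normInfΓ r S₀)
  have harea := S₀.1.area_pos hd
  refine ⟨Pi.single S₀ (-(m * r S₀) / S₀.1.area), ?_⟩
  have h1 : K.innerΓ r (Pi.single S₀ (-(m * r S₀) / S₀.1.area)) = -(m * r S₀ ^ 2) := by
    rw [innerΓ_eq, Finset.sum_eq_single S₀ (fun S _ hne => by simp [Pi.single_eq_of_ne hne])
      (fun h => absurd (Finset.mem_univ _) h), Pi.single_eq_same]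
    field_simp
  have h2 : K.normOneΓ (Pi.single S₀ (-(m * r S₀) / S₀.1.area)) = m * |r S₀| := by
    rw [normOneΓ_eq, Finset.sum_eq_single S₀ (fun S _ hne => by simp [Pi.single_eq_of_ne hne])
      (fun h => absurd (Finset.mem_univ _) h), Pi.single_eq_same, abs_div, abs_neg, abs_mul,
      abs_of_pos hm, abs_of_pos harea]
    field_simp
  rw [h1, h2, hinf, mul_pow, sq_abs]
  field_simp
  ring

theorem normOneΓ_sq_convex (a b : K.BdrySide Ω Γ → ℝ) {t : ℝ} (ht : 0 ≤ t) (ht1 : t ≤ 1) :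
    K.normOneΓ (a + t • b) ^ 2 ≤ (1 - t) * K.normOneΓ a ^ 2 + t * K.normOneΓ (a + b) ^ 2 := by
  have h1 : a + t • b = (1 - t) • a + t • (a + b) := by module
  have h2 : K.normOneΓ (a + t • b) ≤ (1 - t) * K.normOneΓ a + t * K.normOneΓ (a + b) := by
    rw [h1]
    refine (normOneΓ_add_le _ _).trans ?_
    rw [normOneΓ_smul, normOneΓ_smul, abs_of_nonneg ht, abs_of_nonneg (sub_nonneg.mpr ht1)]
  have h3 := normOneΓ_nonneg (a + t • b)
  calc K.normOneΓ (a + t • b) ^ 2 ≤ ((1 - t) * K.normOneΓ a + t * K.normOneΓ (a + b)) ^ 2 := by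
        gcongr
    _ ≤ _ := by
      nlinarith [mul_nonneg (mul_nonneg ht (sub_nonneg.mpr ht1))
        (sq_nonneg (K.normOneΓ a - K.normOneΓ (a + b)))]

end BoundaryConjugate

variable (ΓI) (m : ℝ) (f : K.Elem → ℝ) (g : K.BdrySide Ω ΓN → ℝ) (uD : K.BdrySide Ω ΓD → ℝ)

/-- The real-valued part of the discrete primal energy functional. -/
noncomputable def primalReal (v : K.CR) : ℝ :=
  1 / 2 * K.normSqΩ (K.gradh v) + 1 / (2 * m) * K.normOneΓ (K.sideMean v : K.BdrySide Ω ΓI → ℝ) ^ 2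
    - K.innerΩ f (K.proj v.1) - K.innerΓ g (K.sideMean v)

/-- The real-valued part of the discrete dual energy functional. -/
noncomputable def dualReal (y : K.RT) : ℝ :=
  - (1 / 2) * K.normSqΩ (K.proj y.1)
    - m / 2 * K.normInfΓ (K.normalTrace y : K.BdrySide Ω ΓI → ℝ) ^ 2
    + K.innerΓ (K.normalTrace y) uD

theorem primal_of_eq {v : K.CR} (hv : K.sideMean v = uD) :
    K.primal ΓI m f g uD v = (primalReal ΓI m f g v : EReal) := by
  simp [primal, indic, hv, primalReal]

theorem primal_of_ne {v : K.CR} (hv : K.sideMean v ≠ uD) : K.primal ΓI m f g uD v = ⊤ := by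
  rw [primal, indic, if_neg hv, EReal.coe_add_top]

theorem dual_of_eq {y : K.RT} (h1 : K.divh y = -f) (h2 : K.normalTrace y = g) :
    K.dual ΓI m f g uD y = (dualReal ΓI m uD y : EReal) := by
  simp [dual, indic, h1, h2, dualReal]

theorem dual_of_divh_ne {y : K.RT} (h : K.divh y ≠ -f) : K.dual ΓI m f g uD y = ⊥ := by
  rw [dual, indic, if_neg h, EReal.sub_top, EReal.bot_sub]

theorem dual_of_normalTrace_ne {y : K.RT} (h : K.normalTrace y ≠ g) :
    K.dual ΓI m f g uD y = ⊥ := by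
  rw [dual, indic, indic, if_neg h, EReal.sub_top]

theorem primal_eq_Gh_add_Fh (v : K.CR) :
    K.primal ΓI m f g uD v = K.Gh (K.gradh v) + K.Fh ΓI m f g uD v := by
  rw [primal, Gh, Fh, ← add_assoc, ← EReal.coe_add]
  congr 2
  ring

/-- The duality gap of an admissible pair. -/
theorem IsAdmissible.primalReal_sub_dualReal (h : K.IsAdmissible Ω ΓI ΓD ΓN) {v : K.CR} {y : K.RT}
    (hv : K.sideMean v = uD) (hdiv : K.divh y = -f) (hN : K.normalTrace y = g) :
    primalReal ΓI m f g v - dualReal ΓI m uD y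
      = 1 / 2 * K.innerΩ (K.gradh v - K.proj y.1) (K.gradh v - K.proj y.1)
        + (K.innerΓ (K.normalTrace y : K.BdrySide Ω ΓI → ℝ) (K.sideMean v)
          + m / 2 * K.normInfΓ (K.normalTrace y : K.BdrySide Ω ΓI → ℝ) ^ 2
          + 1 / (2 * m) * K.normOneΓ (K.sideMean v : K.BdrySide Ω ΓI → ℝ) ^ 2) := by
  have h1 := h.integration_by_parts v y
  rw [hdiv, hN, hv, innerΩ_neg_left] at h1
  rw [innerΩ_sub_self, primalReal, dualReal, normSqΩ_eq, normSqΩ_eq]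
  linarith

variable {m f g uD}

/-- The gap is a sum of two nonnegative terms, so both vanish. -/
theorem IsAdmissible.gap_zero (h : K.IsAdmissible Ω ΓI ΓD ΓN) (hm : 0 < m) {v : K.CR} {y : K.RT}
    (hv : K.sideMean v = uD) (hdiv : K.divh y = -f) (hN : K.normalTrace y = g)
    (heq : primalReal ΓI m f g v ≤ dualReal ΓI m uD y) :
    K.proj y.1 = K.gradh v ∧
      -K.innerΓ (K.normalTrace y : K.BdrySide Ω ΓI → ℝ) (K.sideMean v)
        = m / 2 * K.normInfΓ (K.normalTrace y : K.BdrySide Ω ΓI → ℝ) ^ 2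
          + 1 / (2 * m) * K.normOneΓ (K.sideMean v : K.BdrySide Ω ΓI → ℝ) ^ 2 := by
  have h1 := h.primalReal_sub_dualReal ΓI m f g uD hv hdiv hN
  have h2 := innerΩ_self_nonneg (K.gradh v - K.proj y.1)
  have h3 := neg_innerΓ_le hm (K.normalTrace y : K.BdrySide Ω ΓI → ℝ) (K.sideMean v)
  refine ⟨?_, by linarith⟩
  have h4 := innerΩ_self_eq_zero (u := K.gradh v - K.proj y.1) (by linarith)
  exact (sub_eq_zero.mp h4).symm

theorem IsAdmissible.dualReal_le_primalReal (h : K.IsAdmissible Ω ΓI ΓD ΓN) (hm : 0 < m) {v : K.CR}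
    {y : K.RT} (hv : K.sideMean v = uD) (hdiv : K.divh y = -f) (hN : K.normalTrace y = g) :
    dualReal ΓI m uD y ≤ primalReal ΓI m f g v := by
  have h1 := h.primalReal_sub_dualReal ΓI m f g uD hv hdiv hN
  have h2 := innerΩ_self_nonneg (K.gradh v - K.proj y.1)
  have h3 := neg_innerΓ_le hm (K.normalTrace y : K.BdrySide Ω ΓI → ℝ) (K.sideMean v)
  linarith

/-- The quadratic and linear terms are expanded exactly; for the nondifferentiable boundary term,
convexity replaces the derivative by the increment over the full step `w`. -/
theorem primalReal_add_smul_le (hd : 0 < d) (hm : 0 < m) (v w : K.CR) {t : ℝ} (ht : 0 ≤ t)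
    (ht1 : t ≤ 1) :
    primalReal ΓI m f g (v + t • w) ≤ primalReal ΓI m f g v
      + t * (K.innerΩ (K.gradh v) (K.gradh w) - K.innerΩ f (K.proj w.1) - K.innerΓ g (K.sideMean w)
        + 1 / (2 * m) * K.normOneΓ (K.sideMean v + K.sideMean w : K.BdrySide Ω ΓI → ℝ) ^ 2
        - 1 / (2 * m) * K.normOneΓ (K.sideMean v : K.BdrySide Ω ΓI → ℝ) ^ 2)
      + t ^ 2 * (1 / 2 * K.normSqΩ (K.gradh w)) := by
  have hJ := normOneΓ_sq_convex (K.sideMean v : K.BdrySide Ω ΓI → ℝ) (K.sideMean w) ht ht1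
  have hJ' := mul_le_mul_of_nonneg_left hJ (show 0 ≤ 1 / (2 * m) by positivity)
  have hsq : K.normSqΩ (K.gradh (v + t • w)) = K.normSqΩ (K.gradh v)
      + 2 * t * K.innerΩ (K.gradh v) (K.gradh w) + t ^ 2 * K.normSqΩ (K.gradh w) := by
    rw [map_add, map_smul, normSqΩ_eq, normSqΩ_eq, normSqΩ_eq, innerΩ_add_right, innerΩ_smul_right,
      innerΩ_comm _ (K.gradh v), innerΩ_comm _ (K.gradh w), innerΩ_add_right, innerΩ_add_right,
      innerΩ_smul_right, innerΩ_smul_right, innerΩ_comm (K.gradh w) (K.gradh v)]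
    ring
  rw [primalReal, primalReal, hsq, sideMean_add hd, sideMean_add hd, sideMean_smul hd,
    sideMean_smul hd, proj_add, proj_smul, innerΩ_add_right, innerΩ_smul_right, innerΓ_add_right,
    innerΓ_smul_right]
  linarith

/-- The variational inequality satisfied by a minimizer of the primal energy. -/
theorem variational_inequality (hd : 0 < d) (hm : 0 < m) {u : K.CR} (hu : K.sideMean u = uD)
    (hmin : ∀ v : K.CR, K.sideMean v = uD → primalReal ΓI m f g u ≤ primalReal ΓI m f g v)
    {w : K.CR} (hw : (K.sideMean w : K.BdrySide Ω ΓD → ℝ) = 0) :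
    0 ≤ K.innerΩ (K.gradh u) (K.gradh w) - K.innerΩ f (K.proj w.1) - K.innerΓ g (K.sideMean w)
        + 1 / (2 * m) * K.normOneΓ (K.sideMean u + K.sideMean w : K.BdrySide Ω ΓI → ℝ) ^ 2
        - 1 / (2 * m) * K.normOneΓ (K.sideMean u : K.BdrySide Ω ΓI → ℝ) ^ 2 := by
  set A := K.innerΩ (K.gradh u) (K.gradh w) - K.innerΩ f (K.proj w.1) - K.innerΓ g (K.sideMean w)
        + 1 / (2 * m) * K.normOneΓ (K.sideMean u + K.sideMean w : K.BdrySide Ω ΓI → ℝ) ^ 2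
        - 1 / (2 * m) * K.normOneΓ (K.sideMean u : K.BdrySide Ω ΓI → ℝ) ^ 2 with hA
  set B := 1 / 2 * K.normSqΩ (K.gradh w) with hB
  have hB0 : 0 ≤ B := by
    rw [hB, normSqΩ_eq]; exact mul_nonneg (by norm_num) (innerΩ_self_nonneg _)
  have key : ∀ t : ℝ, 0 ≤ t → t ≤ 1 → 0 ≤ t * A + t ^ 2 * B := by
    intro t ht ht1
    have h1 := hmin (u + t • w) (by rw [sideMean_add hd, sideMean_smul hd, hw, hu]; simp)
    have h2 := primalReal_add_smul_le (Ω := Ω) ΓI hd hm (f := f) (g := g) u w ht ht1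
    rw [← hA, ← hB] at h2
    linarith
  by_contra! hneg
  -- This step is small enough for `t * B` to be less than `-A`, contradicting `A + t * B ≥ 0`.
  set t := min 1 (-A / (2 * (B + 1))) with ht
  have hquot : 0 < -A / (2 * (B + 1)) := div_pos (by linarith) (by linarith)
  have htpos : 0 < t := lt_min one_pos hquot
  have h1 := key t htpos.le (min_le_left _ _)
  have h2 : t * (2 * (B + 1)) ≤ -A :=
    (le_div_iff₀ (by linarith)).mp (min_le_right _ _)
  have h3 : 0 ≤ t * (A + t * B) := by linarith [show t * A + t ^ 2 * B = t * (A + t * B) by ring]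
  have h4 : 0 ≤ A + t * B := nonneg_of_mul_nonneg_right h3 htpos
  nlinarith [mul_nonneg htpos.le hB0]

/-- The quadratic part factors through the pair of gradient and means on `Γ_I`, which determines the
function; the Dirichlet condition is feasible because side means can be prescribed. -/
theorem IsAdmissible.exists_primal_minimizer (h : K.IsAdmissible Ω ΓI ΓD ΓN) (hm : 0 < m)
    (f : K.Elem → ℝ) (g : K.BdrySide Ω ΓN → ℝ) (uD : K.BdrySide Ω ΓD → ℝ) :
    ∃ u : K.CR, K.sideMean u = uD ∧
      ∀ v : K.CR, K.sideMean v = uD → primalReal ΓI m f g u ≤ primalReal ΓI m f g v := by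
  obtain ⟨v₀, -, hv₀, -⟩ := h.exists_CR_sideMean_eq 0 uD 0
  let N : K.CR →ₗ[ℝ] (K.Elem → Euc d) × (K.BdrySide Ω ΓI → ℝ) :=
    K.gradh.prod (sideMeanLin h.pos Ω ΓI)
  have hN : Function.Injective N := by
    rw [← LinearMap.ker_eq_bot, LinearMap.ker_eq_bot']
    intro v hv
    exact h.eq_zero_of_gradh_eq_zero (congrArg Prod.fst hv) (congrArg Prod.snd hv)
  let Q : (K.Elem → Euc d) × (K.BdrySide Ω ΓI → ℝ) → ℝ := fun z =>
    1 / 2 * K.normSqΩ z.1 + 1 / (2 * m) * K.normOneΓ z.2 ^ 2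
  have hQ : Continuous Q := by
    simp only [Q, normSqΩ_eq, innerΩ_eq, normOneΓ_eq]
    fun_prop
  have hQ2 : ∀ (t : ℝ) z, Q (t • z) = t ^ 2 * Q z := by
    intro t z
    simp only [Q, Prod.smul_fst, Prod.smul_snd, normSqΩ_eq, normOneΓ_smul, mul_pow, sq_abs]
    rw [innerΩ_smul_right, innerΩ_comm, innerΩ_smul_right]
    ring
  have hQpos : ∀ z, z ≠ 0 → 0 < Q z := by
    intro z hz
    have h1 := innerΩ_self_nonneg z.1
    have h2 : 0 ≤ 1 / (2 * m) * K.normOneΓ z.2 ^ 2 := by positivity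
    simp only [Q, normSqΩ_eq]
    by_contra! hle
    have h3 : z.1 = 0 := innerΩ_self_eq_zero (by linarith)
    have h4 : 1 / (2 * m) * K.normOneΓ z.2 ^ 2 = 0 := by linarith
    have h5 : K.normOneΓ z.2 = 0 := by
      rcases mul_eq_zero.mp h4 with h | h
      · exact absurd h (by positivity)
      · exact pow_eq_zero_iff (two_ne_zero) |>.mp h
    have h6 : z.2 = 0 := by
      rw [normOneΓ_eq, Finset.sum_eq_zero_iff_of_nonneg
        (fun S _ => mul_nonneg (S.1.area_pos h.pos).le (abs_nonneg _))] at h5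
      funext S
      exact abs_eq_zero.mp
        ((mul_eq_zero.mp (h5 S (Finset.mem_univ S))).resolve_left (S.1.area_pos h.pos).ne')
    exact hz (Prod.ext h3 h6)
  let l : K.CR →ₗ[ℝ] ℝ :=
    { toFun := fun v => K.innerΩ f (K.proj v.1) + K.innerΓ g (K.sideMean v)
      map_add' := fun v w => by
        rw [proj_add, sideMean_add h.pos, innerΩ_add_right, innerΓ_add_right]; ring
      map_smul' := fun c v => by
        rw [proj_smul, sideMean_smul h.pos, innerΩ_smul_right, innerΓ_smul_right,
          RingHom.id_apply, smul_eq_mul]; ring }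
  obtain ⟨u, hu, hmin⟩ := exists_minimizer_of_homogeneous N hN hQ hQ2 hQpos l
    (sideMeanLin h.pos Ω ΓD) (v₀ := v₀) (w := uD) hv₀
  refine ⟨u, hu, fun v hv => ?_⟩
  have e : ∀ v, primalReal ΓI m f g v = Q (N v) - l v := fun v => by
    rw [primalReal]
    change _ = 1 / 2 * K.normSqΩ (K.gradh v) + 1 / (2 * m) * K.normOneΓ (K.sideMean v) ^ 2
      - (K.innerΩ f (K.proj v.1) + K.innerΓ g (K.sideMean v))
    ring
  rw [e, e]
  exact hmin v hv

/-- A minimizer of the primal energy gives rise to a dual field with vanishing duality gap. -/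
theorem IsAdmissible.exists_dual_of_minimizer (h : K.IsAdmissible Ω ΓI ΓD ΓN) (hm : 0 < m)
    {u : K.CR} (hu : K.sideMean u = uD)
    (hmin : ∀ v : K.CR, K.sideMean v = uD → primalReal ΓI m f g u ≤ primalReal ΓI m f g v) :
    ∃ z : K.RT, K.divh z = -f ∧ K.normalTrace z = g ∧
      primalReal ΓI m f g u = dualReal ΓI m uD z := by
  have hvi := fun w hw => variational_inequality (w := w) ΓI h.pos hm hu hmin hw
  obtain ⟨z, hz1, hz2⟩ := h.exists_RT_of_forall_bdry_zero (K.gradh u) f (by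
    have hle : ∀ v : K.CR, (∀ S : K.Side, hull S.1 ⊆ frontier Ω → mean v S = 0) →
        0 ≤ K.innerΩ (K.gradh u) (K.gradh v) - K.innerΩ f (K.proj v.1) := by
      intro v hv
      have hz : ∀ Γ : Set (Euc d), (K.sideMean v : K.BdrySide Ω Γ → ℝ) = 0 := fun Γ =>
        funext fun S => hv S.1 S.2.1
      have := hvi v (hz ΓD)
      rw [hz ΓI, hz ΓN, innerΓ_zero_right, add_zero] at this
      linarith
    intro v hv
    have h1 := hle v hv
    have h2 := hle ((-1 : ℝ) • v) fun S hS => by rw [mean_smul h.pos, hv S hS, mul_zero]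
    rw [map_smul, proj_smul, innerΩ_smul_right, innerΩ_smul_right] at h2
    linarith)
  have hibp : ∀ w : K.CR, (K.sideMean w : K.BdrySide Ω ΓD → ℝ) = 0 →
      K.innerΩ (K.gradh u) (K.gradh w) - K.innerΩ f (K.proj w.1)
        = K.innerΓ (K.normalTrace z : K.BdrySide Ω ΓI → ℝ) (K.sideMean w)
          + K.innerΓ (K.normalTrace z : K.BdrySide Ω ΓN → ℝ) (K.sideMean w) := by
    intro w hw
    have h1 := h.integration_by_parts w z
    rw [hz1, hz2, innerΩ_neg_left, hw, innerΓ_zero_right, innerΩ_comm] at h1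
    linarith
  have hN : K.normalTrace z = g := by
    -- With this test function the variational inequality reads `0 ≤ -‖g - z · n‖²` on `Γ_N`.
    obtain ⟨w, hwI, hwD, hwN⟩ := h.exists_CR_sideMean_eq 0 0 (g - K.normalTrace z)
    have h1 := hvi w hwD
    have h2 := hibp w hwD
    rw [hwI, hwN, innerΓ_zero_right] at h2
    rw [hwI, hwN, add_zero] at h1
    by_contra hne
    have h3 := innerΓ_self_pos h.pos (sub_ne_zero.mpr (Ne.symm hne))
    rw [innerΓ_sub_left] at h3
    linarith
  refine ⟨z, hz2, hN, ?_⟩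
  have := h.nonempty_bdrySide
  -- Replacing the means of `u` on `Γ_I` by a maximizer `a` in Young's inequality, the terms in `a`
  -- cancel from the variational inequality. What is left is the reverse of Young's inequality for
  -- `u`, so the gap is zero.
  obtain ⟨a, ha⟩ := exists_neg_innerΓ_eq h.pos hm (K.normalTrace z : K.BdrySide Ω ΓI → ℝ)
  obtain ⟨w, hwI, hwD, hwN⟩ := h.exists_CR_sideMean_eq (a + (-1 : ℝ) • K.sideMean u) 0 0
  have h1 := hvi w hwD
  have h2 := hibp w hwD
  rw [hwI, hwN, innerΓ_zero_right, innerΓ_add_right, innerΓ_smul_right] at h2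
  rw [hwI, hwN, innerΓ_zero_right,
    show K.sideMean u + (a + (-1 : ℝ) • K.sideMean u) = a by module] at h1
  have h3 := neg_innerΓ_le hm (K.normalTrace z : K.BdrySide Ω ΓI → ℝ) (K.sideMean u)
  have h4 := h.primalReal_sub_dualReal ΓI m f g uD hu hz2 hN
  rw [hz1, innerΩ_sub_self] at h4
  linarith

end Mesh

end Duality

/-! ### Fenchel conjugates and identification of the dual problem -/

section Fenchel

open scoped Classical

namespace Mesh

variable {d : ℕ} {K : Mesh d} {Ω ΓI ΓD ΓN : Set (Euc d)}

theorem fenchelConj_Gh (p : K.Elem → Euc d) :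
    fenchelConj K.Gh (K.toDualΩ p) = ((1 / 2 * K.normSqΩ p : ℝ) : EReal) := by
  have hterm : ∀ w : K.Elem → Euc d, ((K.toDualΩ p w : ℝ) : EReal) - K.Gh w
      = ((K.innerΩ p w - 1 / 2 * K.normSqΩ w : ℝ) : EReal) := fun w => by
    rw [Gh, ← EReal.coe_sub]; rfl
  rw [fenchelConj]
  refine le_antisymm (iSup_le fun w => ?_) (le_iSup_of_le p ?_)
  · rw [hterm, EReal.coe_le_coe_iff, normSqΩ_eq, normSqΩ_eq]
    have h1 := innerΩ_self_nonneg (p - w)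
    rw [innerΩ_sub_self] at h1
    linarith
  · rw [hterm, EReal.coe_le_coe_iff, normSqΩ_eq]
    linarith

variable (ΓI) (m : ℝ) (f : K.Elem → ℝ) (g : K.BdrySide Ω ΓN → ℝ) (uD : K.BdrySide Ω ΓD → ℝ)

/-- The real-valued part of the function whose supremum is `F_h* (-∇_h* p)`. -/
noncomputable def conjReal (p : K.Elem → Euc d) (v : K.CR) : ℝ :=
  -K.innerΩ p (K.gradh v) + K.innerΩ f (K.proj v.1) + K.innerΓ g (K.sideMean v)
    - 1 / (2 * m) * K.normOneΓ (K.sideMean v : K.BdrySide Ω ΓI → ℝ) ^ 2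

theorem conj_term_of_eq (p : K.Elem → Euc d) {v : K.CR} (hv : K.sideMean v = uD) :
    (((-(K.gradh.dualMap (K.toDualΩ p))) v : ℝ) : EReal) - K.Fh ΓI m f g uD v
      = (conjReal ΓI m f g p v : EReal) := by
  rw [Fh, indic, if_pos hv, add_zero, ← EReal.coe_sub, EReal.coe_eq_coe_iff, conjReal]
  change -K.innerΩ p (K.gradh v) - _ = _
  ring

theorem conj_term_of_ne (p : K.Elem → Euc d) {v : K.CR} (hv : K.sideMean v ≠ uD) :
    (((-(K.gradh.dualMap (K.toDualΩ p))) v : ℝ) : EReal) - K.Fh ΓI m f g uD v = ⊥ := by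
  rw [Fh, indic, if_neg hv, EReal.coe_add_top, EReal.sub_top]

/-- A feasible line along which the conjugate's objective grows linearly makes the conjugate `+∞`.
-/
theorem fenchelDualh_eq_bot {p : K.Elem → Euc d} {v w : K.CR} (c : ℝ) (hc : 0 < c)
    (hv : ∀ t : ℝ, K.sideMean (v + t • w) = uD)
    (hvw : ∀ t : ℝ, conjReal ΓI m f g p (v + t • w) = conjReal ΓI m f g p v + t * c) :
    K.fenchelDualh ΓI m f g uD p = ⊥ := by
  have htop : fenchelConj (K.Fh ΓI m f g uD) (-(K.gradh.dualMap (K.toDualΩ p))) = ⊤ := by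
    rw [EReal.eq_top_iff_forall_lt]
    intro b
    set t := (b + 1 - conjReal ΓI m f g p v) / c with ht
    have h1 : conjReal ΓI m f g p (v + t • w) = b + 1 := by
      rw [hvw, ht, div_mul_cancel₀ _ hc.ne']; ring
    refine lt_of_lt_of_le ?_ (le_iSup _ (v + t • w))
    rw [conj_term_of_eq ΓI m f g uD p (hv t), h1, EReal.coe_lt_coe_iff]
    linarith
  rw [fenchelDualh, fenchelDual, htop, EReal.sub_top]

variable {m f g uD}

/-- After integration by parts the conjugate's objective depends on boundary means alone: fixed on
`Γ_D`, linear and unconstrained on `Γ_N` (hence unbounded unless `y · n = g`), and bounded sharply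
on `Γ_I` by Young's inequality. -/
theorem IsAdmissible.fenchelDualh_proj (h : K.IsAdmissible Ω ΓI ΓD ΓN) (hm : 0 < m) {y : K.RT}
    (hdiv : K.divh y = -f) :
    K.fenchelDualh ΓI m f g uD (K.proj y.1) = K.dual ΓI m f g uD y := by
  have hconj : ∀ v : K.CR, conjReal ΓI m f g (K.proj y.1) v
      = -K.innerΓ (K.normalTrace y : K.BdrySide Ω ΓI → ℝ) (K.sideMean v)
        - K.innerΓ (K.normalTrace y : K.BdrySide Ω ΓD → ℝ) (K.sideMean v)
        + K.innerΓ (g - K.normalTrace y) (K.sideMean v)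
        - 1 / (2 * m) * K.normOneΓ (K.sideMean v : K.BdrySide Ω ΓI → ℝ) ^ 2 := by
    intro v
    have h1 := h.integration_by_parts v y
    rw [hdiv, innerΩ_neg_left, innerΩ_comm] at h1
    rw [conjReal, innerΓ_sub_left]
    linarith
  by_cases hN : K.normalTrace y = g
  · rw [dual_of_eq ΓI m f g uD hdiv hN, fenchelDualh, fenchelDual, fenchelConj_Gh]
    have hF : fenchelConj (K.Fh ΓI m f g uD) (-(K.gradh.dualMap (K.toDualΩ (K.proj y.1))))
        = ((m / 2 * K.normInfΓ (K.normalTrace y : K.BdrySide Ω ΓI → ℝ) ^ 2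
            - K.innerΓ (K.normalTrace y) uD : ℝ) : EReal) := by
      rw [fenchelConj]
      refine le_antisymm (iSup_le fun v => ?_) ?_
      · by_cases hv : K.sideMean v = uD
        · rw [conj_term_of_eq ΓI m f g uD _ hv, EReal.coe_le_coe_iff, hconj, hv, hN, sub_self]
          have h2 := neg_innerΓ_le hm (K.normalTrace y : K.BdrySide Ω ΓI → ℝ) (K.sideMean v)
          have h3 : K.innerΓ (0 : K.BdrySide Ω ΓN → ℝ) (K.sideMean v) = 0 := by simp [innerΓ_eq]
          rw [h3]
          linarith
        · rw [conj_term_of_ne ΓI m f g uD _ hv]; exact bot_le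
      · have := h.nonempty_bdrySide
        obtain ⟨a, ha⟩ := exists_neg_innerΓ_eq h.pos hm (K.normalTrace y : K.BdrySide Ω ΓI → ℝ)
        obtain ⟨v, hvI, hvD, hvN⟩ := h.exists_CR_sideMean_eq a uD 0
        refine le_iSup_of_le v ?_
        rw [conj_term_of_eq ΓI m f g uD _ hvD, EReal.coe_le_coe_iff, hconj, hvI, hvD, hvN,
          innerΓ_zero_right]
        linarith
    rw [hF, ← EReal.coe_neg, ← EReal.coe_sub, EReal.coe_eq_coe_iff, dualReal]
    ring
  · rw [dual_of_normalTrace_ne ΓI m f g uD hN]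
    obtain ⟨v, hvI, hvD, hvN⟩ := h.exists_CR_sideMean_eq (0 : K.BdrySide Ω ΓI → ℝ) uD
      (0 : K.BdrySide Ω ΓN → ℝ)
    obtain ⟨w, hwI, hwD, hwN⟩ := h.exists_CR_sideMean_eq (0 : K.BdrySide Ω ΓI → ℝ)
      (0 : K.BdrySide Ω ΓD → ℝ) (g - K.normalTrace y)
    refine fenchelDualh_eq_bot ΓI m f g uD (v := v) (w := w) _
      (innerΓ_self_pos h.pos (sub_ne_zero.mpr (Ne.symm hN))) (fun t => ?_) (fun t => ?_)
    · rw [sideMean_add h.pos, sideMean_smul h.pos, hvD, hwD]; simp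
    · rw [hconj, hconj]
      simp only [sideMean_add h.pos, sideMean_smul h.pos, hvI, hvD, hvN, hwI, hwD, hwN, smul_zero,
        add_zero, zero_add, innerΓ_smul_right, innerΓ_zero_right]
      ring

theorem IsAdmissible.fenchelDualh_eq_bot_of_not_exists (h : K.IsAdmissible Ω ΓI ΓD ΓN)
    {p : K.Elem → Euc d} (hp : ¬ ∃ y : K.RT, K.proj y.1 = p ∧ K.divh y = -f) :
    K.fenchelDualh ΓI m f g uD p = ⊥ := by
  obtain ⟨w, hw, hne⟩ : ∃ w : K.CR, (∀ S : K.Side, hull S.1 ⊆ frontier Ω → mean w S = 0) ∧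
      0 ≠ -K.innerΩ p (K.gradh w) + K.innerΩ f (K.proj w.1) := by
    by_contra! hcon
    exact hp (h.exists_RT_of_forall_bdry_zero p f fun v hv => by
      have := hcon v hv; linarith)
  have hwz : ∀ Γ : Set (Euc d), (K.sideMean w : K.BdrySide Ω Γ → ℝ) = 0 := fun Γ =>
    funext fun S => hw S.1 S.2.1
  set c := -K.innerΩ p (K.gradh w) + K.innerΩ f (K.proj w.1) with hc
  obtain ⟨v, -, hvD, -⟩ := h.exists_CR_sideMean_eq (0 : K.BdrySide Ω ΓI → ℝ) uD
    (0 : K.BdrySide Ω ΓN → ℝ)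
  -- Scaling the direction by the nonzero residual `c` makes the slope `c²` positive whatever the
  -- sign of `c`.
  refine fenchelDualh_eq_bot ΓI m f g uD (v := v) (w := c • w) (c * c)
    (mul_self_pos.mpr hne.symm) (fun t => ?_) (fun t => ?_)
  · rw [sideMean_add h.pos, sideMean_smul h.pos, sideMean_smul h.pos, hvD, hwz]; simp
  · rw [conjReal, conjReal, map_add, map_smul, map_smul, proj_add, proj_smul, proj_smul]
    simp only [sideMean_add h.pos, sideMean_smul h.pos, hwz, smul_zero, add_zero,
      innerΩ_add_right, innerΩ_smul_right]
    rw [hc]; ring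

theorem IsAdmissible.fenchelDualh_eq_iSup (h : K.IsAdmissible Ω ΓI ΓD ΓN) (hm : 0 < m)
    (p : K.Elem → Euc d) :
    K.fenchelDualh ΓI m f g uD p = ⨆ (y : K.RT) (_ : K.proj y.1 = p), K.dual ΓI m f g uD y := by
  refine le_antisymm ?_ (iSup₂_le fun y hy => ?_)
  · by_cases hp : ∃ y : K.RT, K.proj y.1 = p ∧ K.divh y = -f
    · obtain ⟨y, rfl, hy⟩ := hp
      rw [h.fenchelDualh_proj ΓI hm hy]
      exact le_iSup₂_of_le y rfl le_rfl
    · rw [h.fenchelDualh_eq_bot_of_not_exists ΓI hp]; exact bot_le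
  · by_cases hdiv : K.divh y = -f
    · rw [← hy, h.fenchelDualh_proj ΓI hm hdiv]
    · rw [dual_of_divh_ne ΓI m f g uD hdiv]; exact bot_le

end Mesh

end Fenchel

/-! ### The duality theorem -/

theorem theorem5p1 {d : ℕ} (hd : 0 < d) (Ω ΓI ΓD ΓN : Set (Euc d))
    -- the domain: open, connected, and lying locally on one side of its boundary
    (hΩ : IsOpen Ω) (hconn : IsConnected Ω) (hreg : interior (closure Ω) = Ω)
    (hΓ : IsBoundarySplit Ω ΓI ΓD ΓN) (hΓI : ΓI.Nonempty)
    -- the triangulation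
    (K : Mesh d) (hK : K.Triangulates Ω) (hKΓ : K.Resolves Ω ΓI ΓD ΓN)
    -- the data
    (m : ℝ) (hm : 0 < m) (f : K.Elem → ℝ) (g : K.BdrySide Ω ΓN → ℝ) (uD : K.BdrySide Ω ΓD → ℝ) :
    -- (i) the Fenchel dual problem is the maximization of the discrete dual energy functional
    (∀ v : K.CR, K.primal ΓI m f g uD v = K.Gh (K.gradh v) + K.Fh ΓI m f g uD v) ∧
    (∀ p : K.Elem → Euc d, K.fenchelDualh ΓI m f g uD p =
      ⨆ (y : K.RT) (_ : K.proj y.1 = p), K.dual ΓI m f g uD y) ∧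
    (∀ y : K.RT, K.divh y = -f →
      K.fenchelDualh ΓI m f g uD (K.proj y.1) = K.dual ΓI m f g uD y) ∧
    -- discrete primal solutions exist
    (∃ u : K.CR, ∀ v : K.CR, K.primal ΓI m f g uD u ≤ K.primal ΓI m f g uD v) ∧
    -- (ii) the discrete dual solution exists, is unique and admissible
    ∃ z : K.RT, (∀ y : K.RT, K.dual ΓI m f g uD y ≤ K.dual ΓI m f g uD z) ∧
      (∀ z' : K.RT, (∀ y : K.RT, K.dual ΓI m f g uD y ≤ K.dual ΓI m f g uD z') → z' = z) ∧
      (∀ T : K.Elem, affDiv (z.1 T) = -f T) ∧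
      (∀ S : K.BdrySide Ω ΓN, ∀ x ∈ hull S.1.1,
        ⟪z.1 (K.elemOf S.1) x, outwardNormal (K.elemOf S.1).1 S.1.1⟫_ℝ = g S) ∧
      ∀ u : K.CR, (∀ v : K.CR, K.primal ΓI m f g uD u ≤ K.primal ΓI m f g uD v) →
        -- strong duality
        K.primal ΓI m f g uD u = K.dual ΓI m f g uD z ∧
        -- (iii) the convex optimality relations
        K.proj z.1 = K.gradh u ∧
        -K.innerΓ (K.normalTrace z : K.BdrySide Ω ΓI → ℝ) (K.sideMean u) =
          m / 2 * K.normInfΓ (K.normalTrace z : K.BdrySide Ω ΓI → ℝ) ^ 2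
            + 1 / (2 * m) * K.normOneΓ (K.sideMean u : K.BdrySide Ω ΓI → ℝ) ^ 2 := by
  have h : K.IsAdmissible Ω ΓI ΓD ΓN := ⟨hd, hΩ, hconn, hreg, hΓ, hΓI, hK, hKΓ⟩
  obtain ⟨u, hu, hmin⟩ := h.exists_primal_minimizer ΓI hm f g uD
  obtain ⟨z, hz1, hz2, heq⟩ := h.exists_dual_of_minimizer ΓI hm hu hmin
  have hdz := Mesh.dual_of_eq ΓI m f g uD hz1 hz2
  refine ⟨Mesh.primal_eq_Gh_add_Fh ΓI m f g uD, h.fenchelDualh_eq_iSup ΓI hm,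
    fun y hy => h.fenchelDualh_proj ΓI hm hy, ⟨u, fun v => ?_⟩, z, fun y => ?_, fun z' hz' => ?_,
    fun T => congrFun hz1 T, fun S x hx => ?_, fun u' hu' => ?_⟩
  · rw [Mesh.primal_of_eq ΓI m f g uD hu]
    by_cases hv : K.sideMean v = uD
    · rw [Mesh.primal_of_eq ΓI m f g uD hv, EReal.coe_le_coe_iff]
      exact hmin v hv
    · rw [Mesh.primal_of_ne ΓI m f g uD hv]; exact le_top
  · rw [hdz]
    by_cases hy1 : K.divh y = -f
    · by_cases hy2 : K.normalTrace y = g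
      · rw [Mesh.dual_of_eq ΓI m f g uD hy1 hy2, EReal.coe_le_coe_iff, ← heq]
        exact h.dualReal_le_primalReal ΓI hm hu hy1 hy2
      · rw [Mesh.dual_of_normalTrace_ne ΓI m f g uD hy2]; exact bot_le
    · rw [Mesh.dual_of_divh_ne ΓI m f g uD hy1]; exact bot_le
  -- A second maximizer has finite value, hence is feasible, and has zero gap with `u`. Its mean is
  -- therefore `∇_h u` and its divergence `-f`, the same data as for `z`.
  · have hge := hz' z
    rw [hdz] at hge
    have hy1 : K.divh z' = -f := by
      by_contra hne
      rw [Mesh.dual_of_divh_ne ΓI m f g uD hne] at hge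
      exact EReal.coe_ne_bot _ (le_bot_iff.mp hge)
    have hy2 : K.normalTrace z' = g := by
      by_contra hne
      rw [Mesh.dual_of_normalTrace_ne ΓI m f g uD hne] at hge
      exact EReal.coe_ne_bot _ (le_bot_iff.mp hge)
    rw [Mesh.dual_of_eq ΓI m f g uD hy1 hy2, EReal.coe_le_coe_iff, ← heq] at hge
    have h1 := (h.gap_zero ΓI hm hu hy1 hy2 hge).1
    have h2 := (h.gap_zero ΓI hm hu hz1 hz2 heq.le).1
    exact Mesh.RT.ext_of_proj_of_divh hd (h1.trans h2.symm) (hy1.trans hz1.symm)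
  · rw [(Mesh.RT.hasConstFlux hd z).inner_eq_flux hd (Mesh.elemOf_subset S.1) hx]
    exact congrFun hz2 S
  · have hle := hu' u
    rw [Mesh.primal_of_eq ΓI m f g uD hu] at hle
    have hu'D : K.sideMean u' = uD := by
      by_contra hne
      rw [Mesh.primal_of_ne ΓI m f g uD hne] at hle
      exact EReal.coe_ne_top _ (top_le_iff.mp hle)
    rw [Mesh.primal_of_eq ΓI m f g uD hu'D, EReal.coe_le_coe_iff] at hle
    refine ⟨?_, h.gap_zero ΓI hm hu'D hz1 hz2 (hle.trans heq.le)⟩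
    rw [Mesh.primal_of_eq ΓI m f g uD hu'D, hdz, EReal.coe_eq_coe_iff, ← heq]
    exact le_antisymm hle (hmin u' hu'D)
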